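/- Let $L$ be any set of labels, let $\varepsilon\notin L$, and let $c\colon (L\cup\{\varepsilon\})\times(L\cup\{\varepsilon\})\to\mathbb{R}_{\ge 0}$ be an edit cost function. For rooted trees $T,T'$ with roots $r,r'$, parent maps $p$ and vertex labelings $\mu\colon V(T)\to L$, $\mu'\colon V(T')\to L$, a set $M\subseteq V(T)\times V(T')$ is called structure and depth preserving if (i) for all $(u,u'),(v,v')\in M$: $u=v\Leftrightarrow u'=v'$; (ii) $(r,r')\in M$; (iii) for all $(u,u')\in M$ with $u\neq r$ and $u'\neq r'$: $(p(u),p(u'))\in M$. The structure and depth preserving tree edit distance $\mathrm{SDTED}(T,T')$ is the minimum, over all such $M$, of $$\sum_{(u,v)\in M}c(\mu(u),\mu'(v))+\sum_{u\in M_1}c(\mu(u),\varepsilon)+\sum_{v\in M_2}c(\varepsilon,\mu'(v)),$$ where $M_1\subseteq V(T)$ and $M_2\subseteq V(T')$ are the sets of vertices that occur in no pair of $M$. **Theorem.** There is an algorithm that, given two labeled rooted trees $T,T'$ with $n$ and $n'$ vertices and an edit cost function $c$, computes $\mathrm{SDTED}(T,T')$ in $O(nn'\Delta)$ time, where $\Delta$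 is the maximum of the vertex degrees in $T$ and $T'$. Precisely: there are a constant $K$ and a single program for a random access machine (memory cells for natural numbers and for real numbers with indirect addressing; addition, subtraction and comparison of numbers, and evaluation of $c$ at $\varepsilon$ or at labels of given vertices, each in one step) which, for all $L$, $c$, $n$, $n'$, $T$, $T'$, with the trees given by their numbers of vertices, roots and parent arrays, halts with the result $\mathrm{SDTED}(T,T')$ after at most $K\,(nn'\Delta+1)$ steps and never stores a natural number larger than $(n+n')^K$. -/

import Mathlib

/-! ## Labeled rooted trees -/

/-- A vertex-labeled rooted tree: a connected acyclic graph with a distinguished root.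
The label type is arbitrary; the label of the edge between a vertex and its parent can be
recorded as a part of the label of the vertex. -/
structure LabeledRootedTree (V L : Type*) where
  graph : SimpleGraph V
  isTree : graph.IsTree
  root : V
  label : V → L

namespace LabeledRootedTree

/-- Every vertex other than the root has exactly one neighbour that is closer to the root. -/
theorem existsUnique_parent {V L : Type*} (T : LabeledRootedTree V L) {v : V}
    (hv : v ≠ T.root) :
    ∃! u, T.graph.Adj v u ∧ T.graph.dist T.root u < T.graph.dist T.root v := by
  have key : ∀ u, T.graph.Adj v u → T.graph.dist T.root u < T.graph.dist T.root v →
      ∃ p : T.graph.Walk T.root v, p.IsPath ∧ p.penultimate = u := by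
    intro u hadj hlt
    obtain ⟨q, hq⟩ := T.isTree.connected.exists_walk_length_eq_dist T.root u
    refine ⟨q.concat hadj.symm, ?_, by simp⟩
    apply SimpleGraph.Walk.isPath_of_length_eq_dist
    have h1 := SimpleGraph.dist_le (q.concat hadj.symm)
    rw [SimpleGraph.Walk.length_concat] at h1 ⊢
    omega
  obtain ⟨p, hp⟩ := T.isTree.connected.exists_walk_length_eq_dist T.root v
  have hnil : ¬ p.Nil := fun h => hv h.eq.symm
  refine ⟨p.penultimate, ⟨(p.adj_penultimate hnil).symm, ?_⟩, ?_⟩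
  · have h1 := SimpleGraph.dist_le p.dropLast
    have h2 : p.dropLast.length + 1 = p.length := by
      have := congrArg SimpleGraph.Walk.length (p.concat_dropLast (p.adj_penultimate hnil))
      rwa [SimpleGraph.Walk.length_concat] at this
    omega
  · rintro u ⟨hadj, hlt⟩
    obtain ⟨q, hq, rfl⟩ := key u hadj hlt
    rw [(T.isTree.existsUnique_path T.root v).unique hq
      (p.isPath_of_length_eq_dist hp)]

open Classical in
/-- The parent of a vertex: its unique neighbour closer to the root.
By convention, the root is its own parent. -/
noncomputable def parent {V L : Type*} (T : LabeledRootedTree V L) (v : V) : V :=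
  if hv : v = T.root then T.root else (T.existsUnique_parent hv).choose

open Classical in
/-- The maximum degree of the underlying graph. -/
noncomputable def maxDegree {V L : Type*} [Fintype V] (T : LabeledRootedTree V L) : ℕ :=
  T.graph.maxDegree

end LabeledRootedTree

/-! ## The structure and depth preserving tree edit distance -/

/-- `M` is a structure and depth preserving mapping between `T` and `T'`. -/
structure IsSDMapping {V V' L : Type*} (T : LabeledRootedTree V L) (T' : LabeledRootedTree V' L)
    (M : Finset (V × V')) : Prop where
  eq_iff_eq : ∀ p ∈ M, ∀ q ∈ M, p.1 = q.1 ↔ p.2 = q.2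
  root_mem : (T.root, T'.root) ∈ M
  parent_mem : ∀ p ∈ M, p.1 ≠ T.root → p.2 ≠ T'.root → (T.parent p.1, T'.parent p.2) ∈ M

/-- The cost of a mapping `M`: relabeling, deletion and insertion. The edit cost function `c`
takes labels or the symbol `ε`, which is `none`. -/
def mappingCost {V V' L : Type*} [Fintype V] [Fintype V'] [DecidableEq V] [DecidableEq V']
    (c : Option L → Option L → ℝ) (T : LabeledRootedTree V L) (T' : LabeledRootedTree V' L)
    (M : Finset (V × V')) : ℝ :=
  ∑ p ∈ M, c (some (T.label p.1)) (some (T'.label p.2))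
    + ∑ u ∈ Finset.univ \ M.image Prod.fst, c (some (T.label u)) none
    + ∑ v ∈ Finset.univ \ M.image Prod.snd, c none (some (T'.label v))

/-- The SDTED: the minimum cost of a structure and depth preserving mapping. -/
noncomputable def sdted {V V' L : Type*} [Fintype V] [Fintype V'] [DecidableEq V]
    [DecidableEq V'] (c : Option L → Option L → ℝ)
    (T : LabeledRootedTree V L) (T' : LabeledRootedTree V' L) : ℝ :=
  sInf {x | ∃ M : Finset (V × V'), IsSDMapping T T' M ∧ mappingCost c T T' M = x}

/-- The infimum in the definition of `sdted` is a minimum. -/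
theorem isLeast_sdted {V V' L : Type*} [Fintype V] [Fintype V'] [DecidableEq V]
    [DecidableEq V'] (c : Option L → Option L → ℝ)
    (T : LabeledRootedTree V L) (T' : LabeledRootedTree V' L) :
    IsLeast {x | ∃ M : Finset (V × V'), IsSDMapping T T' M ∧ mappingCost c T T' M = x}
      (sdted c T T') := by
  have hfin : {x | ∃ M : Finset (V × V'), IsSDMapping T T' M ∧ mappingCost c T T' M = x}.Finite :=
    (Set.finite_range (mappingCost c T T')).subset fun x ⟨M, _, h⟩ => ⟨M, h⟩
  have hne : {x | ∃ M : Finset (V × V'),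
      IsSDMapping T T' M ∧ mappingCost c T T' M = x}.Nonempty := by
    refine ⟨_, {(T.root, T'.root)}, ⟨?_, ?_, ?_⟩, rfl⟩ <;> simp
  exact ⟨hne.csInf_mem hfin, fun x hx => csInf_le hfin.bddBelow hx⟩

/-! ## The machine model

A random access machine with unit costs, programmed by structured programs. Its memory holds
arrays of natural numbers and arrays of real numbers, with indirect addressing. A program
mentions only finitely many arrays, by fixed names. The available operations are addition,
(truncated) subtraction and comparison of numbers; there is no multiplication or division, no
rounding, and no conversion between reals and natural numbers. A bound `W` on the natural
numbers that may be stored models the word length. The vertex labels of the two input trees are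
not inspected; they can only be passed to the edit cost function, which is evaluated in unit
time. -/

namespace RAM

/-- The memory: `nat a i` and `real a i` are the `i`-th cells of the `a`-th arrays. -/
structure State where
  nat : ℕ → ℕ → ℕ
  real : ℕ → ℕ → ℝ

/-- Write `x` to cell `i` of the array `a` of natural numbers. -/
def State.writeNat (s : State) (a i x : ℕ) : State :=
  { s with nat := fun b j => if b = a ∧ j = i then x else s.nat b j }

/-- Write `x` to cell `i` of the array `a` of real numbers. -/
noncomputable def State.writeReal (s : State) (a i : ℕ) (x : ℝ) : State :=
  { s with real := fun b j => if b = a ∧ j = i then x else s.real b j }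

/-- The read-only part of the input: the edit cost function and the labels of the vertices
(given by their numbers) of the first and of the second tree. -/
structure CostInput (L : Type*) where
  cost : Option L → Option L → ℝ
  label₁ : ℕ → Option L
  label₂ : ℕ → Option L

/-- Expressions whose values are natural numbers. -/
inductive NatExpr where
  | const (k : ℕ)
  | load (a : ℕ) (i : NatExpr)
  | add (e f : NatExpr)
  | sub (e f : NatExpr)

namespace NatExpr

/-- The value of an expression. -/
def eval (s : State) : NatExpr → ℕ
  | const k => k
  | load a i => s.nat a (i.eval s)
  | add e f => e.eval s + f.eval s
  | sub e f => e.eval s - f.eval s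

/-- The number of steps needed to evaluate an expression. -/
def steps : NatExpr → ℕ
  | const _ => 1
  | load _ i => i.steps + 1
  | add e f => e.steps + f.steps + 1
  | sub e f => e.steps + f.steps + 1

end NatExpr

/-- Arguments of the edit cost function: the symbol `ε`, the label of a vertex of the first
tree, or the label of a vertex of the second tree. -/
inductive LabelExpr where
  | eps
  | label₁ (i : NatExpr)
  | label₂ (i : NatExpr)

namespace LabelExpr

/-- The value of a label expression. -/
def eval {L : Type*} (D : CostInput L) (s : State) : LabelExpr → Option L
  | eps => none
  | label₁ i => D.label₁ (i.eval s)
  | label₂ i => D.label₂ (i.eval s)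

/-- The number of steps needed to evaluate an expression. -/
def steps : LabelExpr → ℕ
  | eps => 1
  | label₁ i => i.steps + 1
  | label₂ i => i.steps + 1

end LabelExpr

/-- Expressions whose values are real numbers. -/
inductive RealExpr where
  | zero
  | load (a : ℕ) (i : NatExpr)
  | add (e f : RealExpr)
  | sub (e f : RealExpr)
  | cost (x y : LabelExpr)

namespace RealExpr

/-- The value of an expression. -/
noncomputable def eval {L : Type*} (D : CostInput L) (s : State) : RealExpr → ℝ
  | zero => 0
  | load a i => s.real a (i.eval s)
  | add e f => e.eval D s + f.eval D s
  | sub e f => e.eval D s - f.eval D s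
  | cost x y => D.cost (x.eval D s) (y.eval D s)

/-- The number of steps needed to evaluate an expression. -/
def steps : RealExpr → ℕ
  | zero => 1
  | load _ i => i.steps + 1
  | add e f => e.steps + f.steps + 1
  | sub e f => e.steps + f.steps + 1
  | cost x y => x.steps + y.steps + 1

end RealExpr

/-- Tests. -/
inductive Test where
  | natEq (e f : NatExpr)
  | natLt (e f : NatExpr)
  | realLt (e f : RealExpr)
  | not (b : Test)
  | and (b d : Test)

namespace Test

/-- The outcome of a test. -/
def Holds {L : Type*} (D : CostInput L) (s : State) : Test → Prop
  | natEq e f => e.eval s = f.eval s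
  | natLt e f => e.eval s < f.eval s
  | realLt e f => e.eval D s < f.eval D s
  | not b => ¬ b.Holds D s
  | and b d => b.Holds D s ∧ d.Holds D s

/-- The number of steps needed to evaluate a test. -/
def steps : Test → ℕ
  | natEq e f => e.steps + f.steps + 1
  | natLt e f => e.steps + f.steps + 1
  | realLt e f => e.steps + f.steps + 1
  | not b => b.steps + 1
  | and b d => b.steps + d.steps + 1

end Test

/-- Programs. -/
inductive Program where
  | skip
  | setNat (a : ℕ) (i e : NatExpr)
  | setReal (a : ℕ) (i : NatExpr) (e : RealExpr)
  | seq (P Q : Program)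
  | ifThenElse (b : Test) (P Q : Program)
  | loop (b : Test) (P : Program)

/-- `Exec D W P s s' t`: with the costs and labels `D` and words that hold the natural numbers
up to `W`, the program `P`, started in the memory state `s`, halts in the state `s'` after `t`
steps. There is no such run if a number greater than `W` would have to be stored. -/
inductive Exec {L : Type*} (D : CostInput L) (W : ℕ) : Program → State → State → ℕ → Prop
  | skip (s : State) : Exec D W .skip s s 1
  | setNat (a : ℕ) (i e : NatExpr) (s : State) (h : e.eval s ≤ W) :
      Exec D W (.setNat a i e) s (s.writeNat a (i.eval s) (e.eval s)) (i.steps + e.steps + 1)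
  | setReal (a : ℕ) (i : NatExpr) (e : RealExpr) (s : State) :
      Exec D W (.setReal a i e) s (s.writeReal a (i.eval s) (e.eval D s))
        (i.steps + e.steps + 1)
  | seq {P Q : Program} {s s₁ s₂ : State} {t₁ t₂ : ℕ}
      (hP : Exec D W P s s₁ t₁) (hQ : Exec D W Q s₁ s₂ t₂) :
      Exec D W (.seq P Q) s s₂ (t₁ + t₂)
  | ifTrue {b : Test} {P Q : Program} {s s₁ : State} {t : ℕ}
      (hb : b.Holds D s) (hP : Exec D W P s s₁ t) :
      Exec D W (.ifThenElse b P Q) s s₁ (b.steps + t + 1)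
  | ifFalse {b : Test} {P Q : Program} {s s₁ : State} {t : ℕ}
      (hb : ¬ b.Holds D s) (hQ : Exec D W Q s s₁ t) :
      Exec D W (.ifThenElse b P Q) s s₁ (b.steps + t + 1)
  | loopStop {b : Test} {P : Program} {s : State} (hb : ¬ b.Holds D s) :
      Exec D W (.loop b P) s s (b.steps + 1)
  | loopStep {b : Test} {P : Program} {s s₁ s₂ : State} {t₁ t₂ : ℕ}
      (hb : b.Holds D s) (hP : Exec D W P s s₁ t₁) (hL : Exec D W (.loop b P) s₁ s₂ t₂) :
      Exec D W (.loop b P) s s₂ (b.steps + t₁ + t₂ + 1)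

end RAM

/-! ## Input of the machine -/

/-- The labels of a tree with vertices `0, …, n - 1` as an array. -/
def LabeledRootedTree.labelArray {n : ℕ} {L : Type*} (T : LabeledRootedTree (Fin n) L) (i : ℕ) :
    Option L :=
  if h : i < n then some (T.label ⟨i, h⟩) else none

/-- The parent array of a tree with vertices `0, …, n - 1`; all later cells contain `0`. -/
noncomputable def LabeledRootedTree.parentArray {n : ℕ} {L : Type*}
    (T : LabeledRootedTree (Fin n) L) (i : ℕ) : ℕ :=
  if h : i < n then (T.parent ⟨i, h⟩ : ℕ) else 0

/-- The costs and labels for two given trees. -/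
def costInput {n n' : ℕ} {L : Type*} (c : Option L → Option L → ℝ)
    (T : LabeledRootedTree (Fin n) L) (T' : LabeledRootedTree (Fin n') L) : RAM.CostInput L where
  cost := c
  label₁ := T.labelArray
  label₂ := T'.labelArray

/-- The initial memory for two given trees: the numbers of vertices and the roots are stored in
array `0`, the parent arrays are stored in the arrays `1` and `2`, and all other cells contain
zero. -/
noncomputable def initialState {n n' : ℕ} {L : Type*}
    (T : LabeledRootedTree (Fin n) L) (T' : LabeledRootedTree (Fin n') L) : RAM.State where
  nat a i :=
    match a, i with
    | 0, 0 => n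
    | 0, 1 => n'
    | 0, 2 => T.root
    | 0, 3 => T'.root
    | 1, i => T.parentArray i
    | 2, i => T'.parentArray i
    | _, _ => 0
  real _ _ := 0

/-! ## Reasoning about programs -/

namespace RAM

/-! Subtract from the cost of a mapping the cost of deleting all of `T` and inserting all of `T'`.
What remains is the sum over the pairs of the mapping of `g u v = c(u,v) - c(u,ε) - c(ε,v)`. Every
pair other than the root pair has its parent pair in the mapping, and the pairs below a given pair
form a matching between two sets of children. Hence the optimum `G u v` for the subtrees at `u` and
`v` with `u` mapped to `v` satisfies `G u v = g u v + minMatching (children u) (children v) G`. One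
inequality comes from grouping an arbitrary mapping by parent pairs (`IsSDMapping.sum_ge`), the
other from following optimal matchings down from the root pair (`exists_isSDMapping_sum_eq`).

A breadth-first order puts the children of each vertex into a segment of later positions, so a table
of `G` can be filled backwards. Each entry is one call of the Hungarian algorithm, with the smaller
set of children as the `k` rows and the larger one as the `m` columns, in time `O(k²m + m + 1)`. As
matchings may leave vertices out, the algorithm works with `min G 0` and nonpositive potentials; the
matching it maintains is then optimal by weak duality (`Invariant.minMatching_eq`). A lower bound of
the table is updated along with it, so initial potentials cost only linear time.

For the running time, `k` is at most the smaller maximum degree, and `k * m` is the product of the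
two numbers of children. Summed over all pairs of vertices, these products factor into two sums
bounded by `n` and `n'` (`sum_entries_le`), which gives `O(nn'Δ)`.

On the machine side, `Wp` states termination with a postcondition on the final state and the running
time. Its rules reduce each program to loop invariants, while `Frame` carries over all arrays that a
program does not write to. -/

@[simp] theorem State.writeNat_nat_self (s : State) (a i x : ℕ) :
    (s.writeNat a i x).nat a = Function.update (s.nat a) i x := by
  funext j
  simp [State.writeNat, Function.update_apply]

@[simp] theorem State.writeNat_nat_of_ne (s : State) {a b : ℕ} (i x : ℕ) (h : b ≠ a) :
    (s.writeNat a i x).nat b = s.nat b := by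
  funext j
  simp [State.writeNat, h]

@[simp] theorem State.writeNat_real (s : State) (a i x : ℕ) :
    (s.writeNat a i x).real = s.real := rfl

@[simp] theorem State.writeReal_real_self (s : State) (a i : ℕ) (x : ℝ) :
    (s.writeReal a i x).real a = Function.update (s.real a) i x := by
  funext j
  simp [State.writeReal, Function.update_apply]

@[simp] theorem State.writeReal_real_of_ne (s : State) {a b : ℕ} (i : ℕ) (x : ℝ) (h : b ≠ a) :
    (s.writeReal a i x).real b = s.real b := by
  funext j
  simp [State.writeReal, h]

@[simp] theorem State.writeReal_nat (s : State) (a i : ℕ) (x : ℝ) :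
    (s.writeReal a i x).nat = s.nat := rfl

attribute [simp] NatExpr.eval NatExpr.steps LabelExpr.eval LabelExpr.steps RealExpr.eval
  RealExpr.steps Test.Holds Test.steps

/-- The cell `0` of an array of natural numbers. -/
abbrev NatExpr.var (a : ℕ) : NatExpr := .load a (.const 0)

/-- The cell `0` of an array of real numbers. -/
abbrev RealExpr.var (a : ℕ) : RealExpr := .load a (.const 0)

/-- The arrays of natural numbers that a program may change. -/
def Program.natTargets : Program → List ℕ
  | skip => []
  | setNat a _ _ => [a]
  | setReal _ _ _ => []
  | seq P Q => P.natTargets ++ Q.natTargets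
  | ifThenElse _ P Q => P.natTargets ++ Q.natTargets
  | loop _ P => P.natTargets

/-- The arrays of real numbers that a program may change. -/
def Program.realTargets : Program → List ℕ
  | skip => []
  | setNat _ _ _ => []
  | setReal a _ _ => [a]
  | seq P Q => P.realTargets ++ Q.realTargets
  | ifThenElse _ P Q => P.realTargets ++ Q.realTargets
  | loop _ P => P.realTargets

/-- The states `s` and `s'` agree on all arrays that `P` does not write to. -/
structure Frame (P : Program) (s s' : State) : Prop where
  nat : ∀ a, a ∉ P.natTargets → s'.nat a = s.nat a
  real : ∀ a, a ∉ P.realTargets → s'.real a = s.real a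

theorem Frame.refl (P : Program) (s : State) : Frame P s s := ⟨fun _ _ => rfl, fun _ _ => rfl⟩

theorem Frame.trans {P : Program} {s s₁ s₂ : State} (h : Frame P s s₁) (h' : Frame P s₁ s₂) :
    Frame P s s₂ :=
  ⟨fun a ha => (h'.nat a ha).trans (h.nat a ha), fun a ha => (h'.real a ha).trans (h.real a ha)⟩

theorem Frame.mono {P Q : Program} {s s' : State} (h : Frame P s s')
    (hn : P.natTargets ⊆ Q.natTargets) (hr : P.realTargets ⊆ Q.realTargets) : Frame Q s s' :=
  ⟨fun a ha => h.nat a fun h' => ha (hn h'), fun a ha => h.real a fun h' => ha (hr h')⟩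

variable {L : Type*} {D : CostInput L} {W : ℕ}

/-- The target lists are syntactic, so preservation of an array across a whole subprogram reduces to
a membership question that `decide` or `simp` settles. -/
theorem Exec.frame {P : Program} {s s' : State} {t : ℕ} (h : Exec D W P s s' t) :
    Frame P s s' := by
  induction h with
  | skip s => exact Frame.refl _ _
  | setNat a i e s h =>
    refine ⟨fun b hb => ?_, fun _ _ => rfl⟩
    simp only [Program.natTargets, List.mem_singleton] at hb
    exact State.writeNat_nat_of_ne _ _ _ hb
  | setReal a i e s =>
    refine ⟨fun _ _ => rfl, fun b hb => ?_⟩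
    simp only [Program.realTargets, List.mem_singleton] at hb
    exact State.writeReal_real_of_ne _ _ _ hb
  | seq _ _ h₁ h₂ =>
    exact (h₁.mono (List.subset_append_left _ _) (List.subset_append_left _ _)).trans
      (h₂.mono (List.subset_append_right _ _) (List.subset_append_right _ _))
  | ifTrue _ _ h =>
    exact h.mono (List.subset_append_left _ _) (List.subset_append_left _ _)
  | ifFalse _ _ h =>
    exact h.mono (List.subset_append_right _ _) (List.subset_append_right _ _)
  | loopStop _ => exact Frame.refl _ _
  | loopStep _ _ _ h₁ h₂ =>
    exact Frame.trans (h₁.mono (List.Subset.refl _) (List.Subset.refl _)) h₂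

/-- Total correctness: the program `P` halts when started in `s`, and the final state and the
running time satisfy `R`. -/
def Wp (D : CostInput L) (W : ℕ) (P : Program) (s : State) (R : State → ℕ → Prop) : Prop :=
  ∃ s' t, Exec D W P s s' t ∧ R s' t

/-- Besides weakening the postcondition, this hands the frame of the run to the continuation, so
specifications need not list what stays unchanged. -/
theorem Wp.mono {P : Program} {s : State} {R R' : State → ℕ → Prop} (h : Wp D W P s R)
    (hR : ∀ s' t, Frame P s s' → R s' t → R' s' t) : Wp D W P s R' := by
  obtain ⟨s', t, h₁, h₂⟩ := h
  exact ⟨s', t, h₁, hR _ _ h₁.frame h₂⟩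

theorem Wp.skip {s : State} {R : State → ℕ → Prop} (h : R s 1) : Wp D W .skip s R :=
  ⟨_, _, .skip s, h⟩

theorem Wp.setNat {a : ℕ} {i e : NatExpr} {s : State} {R : State → ℕ → Prop}
    (hW : e.eval s ≤ W) (h : R (s.writeNat a (i.eval s) (e.eval s)) (i.steps + e.steps + 1)) :
    Wp D W (.setNat a i e) s R :=
  ⟨_, _, .setNat a i e s hW, h⟩

theorem Wp.setReal {a : ℕ} {i : NatExpr} {e : RealExpr} {s : State} {R : State → ℕ → Prop}
    (h : R (s.writeReal a (i.eval s) (e.eval D s)) (i.steps + e.steps + 1)) :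
    Wp D W (.setReal a i e) s R :=
  ⟨_, _, .setReal a i e s, h⟩

theorem Wp.seq {P Q : Program} {s : State} {R : State → ℕ → Prop}
    (h : Wp D W P s fun s₁ t₁ => Wp D W Q s₁ fun s₂ t₂ => R s₂ (t₁ + t₂)) :
    Wp D W (.seq P Q) s R := by
  obtain ⟨s₁, t₁, h₁, s₂, t₂, h₂, h₃⟩ := h
  exact ⟨_, _, .seq h₁ h₂, h₃⟩

theorem Wp.ite {b : Test} {P Q : Program} {s : State} {R : State → ℕ → Prop}
    (hP : b.Holds D s → Wp D W P s fun s' t => R s' (b.steps + t + 1))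
    (hQ : ¬ b.Holds D s → Wp D W Q s fun s' t => R s' (b.steps + t + 1)) :
    Wp D W (.ifThenElse b P Q) s R := by
  by_cases hb : b.Holds D s
  · obtain ⟨s₁, t₁, h₁, h₂⟩ := hP hb
    exact ⟨_, _, .ifTrue hb h₁, h₂⟩
  · obtain ⟨s₁, t₁, h₁, h₂⟩ := hQ hb
    exact ⟨_, _, .ifFalse hb h₁, h₂⟩

/-- The rule for loops, with an invariant `I n` in which `n` bounds the remaining time. -/
theorem Wp.loop {b : Test} {P : Program} {s : State} (I : ℕ → State → Prop) {n : ℕ}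
    (h₀ : I n s)
    (hexit : ∀ n s', Frame P s s' → I n s' → ¬ b.Holds D s' → b.steps + 1 ≤ n)
    (hstep : ∀ n s', Frame P s s' → I n s' → b.Holds D s' →
      Wp D W P s' fun s'' t => ∃ n', I n' s'' ∧ b.steps + t + n' + 1 ≤ n) :
    Wp D W (.loop b P) s fun s' t => t ≤ n ∧ ¬ b.Holds D s' ∧ ∃ n', I n' s' := by
  suffices H : ∀ n s₁, Frame P s s₁ → I n s₁ →
      Wp D W (.loop b P) s₁ fun s' t => t ≤ n ∧ ¬ b.Holds D s' ∧ ∃ n', I n' s' from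
    H n s (Frame.refl _ _) h₀
  intro n
  induction n using Nat.strong_induction_on with
  | _ n ih =>
    intro s₁ hf hI
    by_cases hb : b.Holds D s₁
    · obtain ⟨s₂, t, hP, n', hI', hn⟩ := hstep n s₁ hf hI hb
      obtain ⟨s₃, t', hL, ht, hR⟩ := ih n' (by omega) s₂ (hf.trans hP.frame) hI'
      exact ⟨_, _, .loopStep hb hP hL, by omega, hR⟩
    · exact ⟨_, _, .loopStop hb, hexit n s₁ hf hI hb, hb, n, hI⟩

/-- `x` runs from its current value up to, but not including, the value of `lim`. -/
def Program.upTo (x : ℕ) (lim : NatExpr) (P : Program) : Program :=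
  .loop (.natLt (.load x (.const 0)) lim)
    (.seq P (.setNat x (.const 0) (.add (.load x (.const 0)) (.const 1))))

/-- The limit is evaluated anew in every round, hence `hlim` fixes its value in all states of the
frame. Beyond the body, a round costs `lim.steps + 3` for the test, `6` for the increment and `1`
for the loop, which explains the `10`. The invariant is required after the increment, since the body
itself must leave the counter alone. -/
theorem Wp.upTo {x : ℕ} {lim : NatExpr} {P : Program} {s : State} (I : ℕ → State → Prop)
    {N : ℕ} (C : ℕ) (hx : s.nat x 0 ≤ N) (hW : N ≤ W) (h₀ : I (s.nat x 0) s)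
    (hlim : ∀ s', Frame (.upTo x lim P) s s' → lim.eval s' = N)
    (hstep : ∀ i s', Frame (.upTo x lim P) s s' → s'.nat x 0 = i → i < N → I i s' →
      Wp D W P s' fun s'' t => t ≤ C ∧ s''.nat x 0 = i ∧ I (i + 1) (s''.writeNat x 0 (i + 1))) :
    Wp D W (.upTo x lim P) s fun s' t =>
      t ≤ (N - s.nat x 0) * (C + lim.steps + 10) + lim.steps + 4 ∧ s'.nat x 0 = N ∧ I N s' := by
  have hlim' : ∀ s', Frame (Program.seq P (.setNat x (.const 0)
      (.add (.load x (.const 0)) (.const 1)))) s s' → lim.eval s' = N :=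
    fun s' h => hlim s' (h.mono (List.Subset.refl _) (List.Subset.refl _))
  refine (Wp.loop (fun n s' => s'.nat x 0 ≤ N ∧ I (s'.nat x 0) s' ∧
    n = (N - s'.nat x 0) * (C + lim.steps + 10) + lim.steps + 4) ⟨hx, h₀, rfl⟩ ?_ ?_).mono ?_
  · rintro n s' hf ⟨h1, h2, rfl⟩ h3
    simp
    omega
  · rintro n s' hf ⟨h1, h2, rfl⟩ h3
    simp only [Test.Holds, NatExpr.eval, hlim' s' hf] at h3
    refine Wp.seq ((hstep _ s' (hf.mono (List.Subset.refl _) (List.Subset.refl _)) rfl h3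
      h2).mono ?_)
    rintro s'' t - ⟨ht, hx', hI⟩
    refine Wp.setNat (by simp [hx']; omega) ?_
    refine ⟨(N - (s'.nat x 0 + 1)) * (C + lim.steps + 10) + lim.steps + 4, ?_, ?_⟩
    · simp [hx', hI]
      omega
    · obtain ⟨e, he⟩ : ∃ e, N - s'.nat x 0 = e + 1 := ⟨N - s'.nat x 0 - 1, by omega⟩
      rw [he, show N - (s'.nat x 0 + 1) = e by omega, add_mul]
      simp
      omega
  · rintro s' t hf ⟨ht, hb, n', h1, h2, -⟩
    simp only [Test.Holds, NatExpr.eval, hlim s' hf] at hb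
    have : s'.nat x 0 = N := by omega
    exact ⟨ht, this, this ▸ h2⟩

/-- `x` runs from `a` up to, but not including, the value of `lim`. -/
def Program.range (x a : ℕ) (lim : NatExpr) (P : Program) : Program :=
  .seq (.setNat x (.const 0) (.const a)) (.upTo x lim P)

theorem Wp.range {x a : ℕ} {lim : NatExpr} {P : Program} {s : State} (I : ℕ → State → Prop)
    {N : ℕ} (C : ℕ) (ha : a ≤ N) (hW : N ≤ W) (h₀ : I a (s.writeNat x 0 a))
    (hlim : ∀ s', Frame (.range x a lim P) s s' → lim.eval s' = N)
    (hstep : ∀ i s', Frame (.range x a lim P) s s' → s'.nat x 0 = i → a ≤ i → i < N → I i s' →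
      Wp D W P s' fun s'' t => t ≤ C ∧ s''.nat x 0 = i ∧ I (i + 1) (s''.writeNat x 0 (i + 1))) :
    Wp D W (.range x a lim P) s fun s' t =>
      t ≤ (N - a) * (C + lim.steps + 10) + lim.steps + 7 ∧ I N s' := by
  have hf₀ : Frame (.range x a lim P) s (s.writeNat x 0 a) := by
    refine ⟨fun b hb => ?_, fun _ _ => rfl⟩
    refine State.writeNat_nat_of_ne _ _ _ ?_
    rintro rfl
    exact hb (List.mem_append_left _ (List.mem_singleton.2 rfl))
  have hf : ∀ s', Frame (.upTo x lim P) (s.writeNat x 0 a) s' → Frame (.range x a lim P) s s' :=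
    fun s' h => hf₀.trans (h.mono (List.subset_append_right _ _) (List.subset_append_right _ _))
  refine Wp.seq (Wp.setNat (by simp; omega) ((Wp.upTo (fun i s' => a ≤ i ∧ I i s') (N := N) C
    (by simpa using ha) hW ⟨by simp, by simpa using h₀⟩ (fun s' h => hlim s' (hf s' h)) ?_).mono
    ?_))
  · rintro i s' h h1 h2 ⟨h3, h4⟩
    refine (hstep i s' (hf s' h) h1 h3 h2 h4).mono ?_
    rintro s'' t - ⟨h5, h6, h7⟩
    exact ⟨h5, h6, by omega, h7⟩
  · rintro s' t - ⟨h1, -, -, h2⟩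
    refine ⟨?_, h2⟩
    simp at h1 ⊢
    omega

/-- `x` runs down from the predecessor of its current value to zero. -/
def Program.downTo (x : ℕ) (P : Program) : Program :=
  .loop (.natLt (.const 0) (.load x (.const 0)))
    (.seq (.setNat x (.const 0) (.sub (.load x (.const 0)) (.const 1))) P)

/-- The bound `C i` may depend on the counter, unlike in `Wp.upTo`: the cost of a table entry
depends on the numbers of children, and only the sum of these costs is small enough. -/
theorem Wp.downTo {x : ℕ} {P : Program} {s : State} (I : ℕ → State → Prop) (C : ℕ → ℕ)
    (hW : s.nat x 0 ≤ W) (h₀ : I (s.nat x 0) s)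
    (hstep : ∀ i s', Frame (.downTo x P) s s' → s'.nat x 0 = i + 1 → i < s.nat x 0 →
      I (i + 1) s' →
      Wp D W P (s'.writeNat x 0 i) fun s'' t => t ≤ C i ∧ s''.nat x 0 = i ∧ I i s'') :
    Wp D W (.downTo x P) s fun s' t =>
      t ≤ ∑ i ∈ Finset.range (s.nat x 0), (C i + 12) + 5 ∧ s'.nat x 0 = 0 ∧ I 0 s' := by
  refine (Wp.loop (fun n s' => s'.nat x 0 ≤ s.nat x 0 ∧ I (s'.nat x 0) s' ∧
    n = ∑ i ∈ Finset.range (s'.nat x 0), (C i + 12) + 5) ⟨le_rfl, h₀, rfl⟩ ?_ ?_).mono ?_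
  · rintro n s' hf ⟨h1, h2, rfl⟩ h3
    simp
  · rintro n s' hf ⟨h1, h2, rfl⟩ h3
    simp only [Test.Holds, NatExpr.eval] at h3
    obtain ⟨i, hi⟩ : ∃ i, s'.nat x 0 = i + 1 := ⟨s'.nat x 0 - 1, by omega⟩
    refine Wp.seq (Wp.setNat (by simp; omega) ?_)
    simp only [NatExpr.eval, hi, Nat.add_sub_cancel]
    refine (hstep i s' (hf.mono (List.Subset.refl _) (List.Subset.refl _)) hi (by omega)
      (hi ▸ h2)).mono ?_
    rintro s'' t - ⟨ht, hx', hI⟩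
    refine ⟨∑ i ∈ Finset.range i, (C i + 12) + 5, ⟨by omega, by rwa [hx'], by rw [hx']⟩, ?_⟩
    rw [Finset.sum_range_succ]
    simp
    omega
  · rintro s' t hf ⟨ht, hb, n', h1, h2, -⟩
    simp only [Test.Holds, NatExpr.eval] at hb
    have : s'.nat x 0 = 0 := by omega
    exact ⟨ht, this, this ▸ h2⟩

end RAM

/-! ## Minimum weight matchings in bipartite graphs -/

/-- `N` is a matching between the finite sets `S` and `T`. -/
structure IsBipartiteMatching {α β : Type*} (S : Finset α) (T : Finset β)
    (N : Finset (α × β)) : Prop where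
  fst_mem : ∀ p ∈ N, p.1 ∈ S
  snd_mem : ∀ p ∈ N, p.2 ∈ T
  eq_iff_eq : ∀ p ∈ N, ∀ q ∈ N, p.1 = q.1 ↔ p.2 = q.2

/-- The minimum weight of a matching between `S` and `T`. -/
noncomputable def minMatching {α β : Type*} (S : Finset α) (T : Finset β) (w : α → β → ℝ) : ℝ :=
  sInf {x | ∃ N : Finset (α × β), IsBipartiteMatching S T N ∧ ∑ p ∈ N, w p.1 p.2 = x}

section minMatching

variable {α β γ δ : Type*} {S : Finset α} {T : Finset β}

theorem isLeast_minMatching (S : Finset α) (T : Finset β) (w : α → β → ℝ) :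
    IsLeast {x | ∃ N : Finset (α × β), IsBipartiteMatching S T N ∧ ∑ p ∈ N, w p.1 p.2 = x}
      (minMatching S T w) := by
  classical
  have hfin : {x | ∃ N : Finset (α × β), IsBipartiteMatching S T N ∧
      ∑ p ∈ N, w p.1 p.2 = x}.Finite := by
    -- The ambient types may be infinite, but a matching is a subset of `S ×ˢ T`.
    refine ((S ×ˢ T).powerset.finite_toSet.image fun N => ∑ p ∈ N, w p.1 p.2).subset ?_
    rintro x ⟨N, hN, rfl⟩
    refine ⟨N, ?_, rfl⟩
    simp only [Finset.mem_coe, Finset.mem_powerset]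
    intro p hp
    exact Finset.mem_product.2 ⟨hN.fst_mem p hp, hN.snd_mem p hp⟩
  have hne : {x | ∃ N : Finset (α × β), IsBipartiteMatching S T N ∧
      ∑ p ∈ N, w p.1 p.2 = x}.Nonempty :=
    ⟨_, ∅, ⟨by simp, by simp, by simp⟩, rfl⟩
  exact ⟨hne.csInf_mem hfin, fun x hx => csInf_le hfin.bddBelow hx⟩

theorem minMatching_congr {w w' : α → β → ℝ} (h : ∀ a ∈ S, ∀ b ∈ T, w a b = w' a b) :
    minMatching S T w = minMatching S T w' := by
  have : ∀ N, IsBipartiteMatching S T N → ∑ p ∈ N, w p.1 p.2 = ∑ p ∈ N, w' p.1 p.2 :=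
    fun N hN => Finset.sum_congr rfl fun p hp => h _ (hN.fst_mem p hp) _ (hN.snd_mem p hp)
  unfold minMatching
  congr 1
  ext x
  constructor
  · rintro ⟨N, hN, rfl⟩
    exact ⟨N, hN, (this N hN).symm⟩
  · rintro ⟨N, hN, rfl⟩
    exact ⟨N, hN, this N hN⟩

theorem IsBipartiteMatching.swap {N : Finset (α × β)} (h : IsBipartiteMatching S T N) :
    IsBipartiteMatching T S (N.map (Equiv.prodComm α β).toEmbedding) := by
  refine ⟨?_, ?_, ?_⟩
  · simp only [Finset.mem_map]
    rintro _ ⟨p, hp, rfl⟩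
    exact h.snd_mem p hp
  · simp only [Finset.mem_map]
    rintro _ ⟨p, hp, rfl⟩
    exact h.fst_mem p hp
  · simp only [Finset.mem_map]
    rintro _ ⟨p, hp, rfl⟩ _ ⟨q, hq, rfl⟩
    exact (h.eq_iff_eq p hp q hq).symm

theorem minMatching_swap (S : Finset α) (T : Finset β) (w : α → β → ℝ) :
    minMatching T S (fun b a => w a b) = minMatching S T w := by
  unfold minMatching
  congr 1
  ext x
  constructor
  · rintro ⟨N, hN, rfl⟩
    exact ⟨_, hN.swap, by simp⟩
  · rintro ⟨N, hN, rfl⟩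
    exact ⟨_, hN.swap, by simp⟩

/-- Injective renamings carry matchings back and forth with the same weight. This passes from sets
of children to the index ranges of the Hungarian algorithm. -/
theorem minMatching_image [DecidableEq γ] [DecidableEq δ] (f : α → γ) (g : β → δ)
    (hf : Set.InjOn f S) (hg : Set.InjOn g T) (w : γ → δ → ℝ) :
    minMatching (S.image f) (T.image g) w = minMatching S T fun a b => w (f a) (g b) := by
  classical
  have hfg : ∀ N, IsBipartiteMatching S T N → Set.InjOn (Prod.map f g) (N : Set (α × β)) := by
    intro N hN p hp q hq hpq
    rw [Prod.ext_iff] at hpq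
    exact Prod.ext (hf (hN.fst_mem p hp) (hN.fst_mem q hq) hpq.1)
      (hg (hN.snd_mem p hp) (hN.snd_mem q hq) hpq.2)
  unfold minMatching
  congr 1
  ext x
  constructor
  · rintro ⟨N, hN, rfl⟩
    refine ⟨(S ×ˢ T).filter fun p => Prod.map f g p ∈ N, ⟨?_, ?_, ?_⟩, ?_⟩
    · simp +contextual
    · simp +contextual
    · simp only [Finset.mem_filter, Finset.mem_product]
      rintro p ⟨⟨hp1, hp2⟩, hp⟩ q ⟨⟨hq1, hq2⟩, hq⟩
      have := hN.eq_iff_eq _ hp _ hq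
      simp only [Prod.map_fst, Prod.map_snd] at this
      rwa [hf.eq_iff hp1 hq1, hg.eq_iff hp2 hq2] at this
    · refine Finset.sum_bij (fun p _ => Prod.map f g p) ?_ ?_ ?_ ?_
      · simp
      · simp only [Finset.mem_filter, Finset.mem_product]
        rintro p ⟨⟨hp1, hp2⟩, hp⟩ q ⟨⟨hq1, hq2⟩, hq⟩ hpq
        rw [Prod.ext_iff] at hpq
        exact Prod.ext (hf hp1 hq1 hpq.1) (hg hp2 hq2 hpq.2)
      · rintro ⟨x, y⟩ hxy
        obtain ⟨a, ha, hax⟩ := Finset.mem_image.1 (hN.fst_mem _ hxy)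
        obtain ⟨b, hb, hby⟩ := Finset.mem_image.1 (hN.snd_mem _ hxy)
        simp only at hax hby
        exact ⟨(a, b), by simp [ha, hb, hax, hby, hxy], by simp [hax, hby]⟩
      · simp
  · rintro ⟨N, hN, rfl⟩
    refine ⟨N.image (Prod.map f g), ⟨?_, ?_, ?_⟩, ?_⟩
    · simp only [Finset.mem_image]
      rintro _ ⟨p, hp, rfl⟩
      exact ⟨_, hN.fst_mem p hp, rfl⟩
    · simp only [Finset.mem_image]
      rintro _ ⟨p, hp, rfl⟩
      exact ⟨_, hN.snd_mem p hp, rfl⟩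
    · simp only [Finset.mem_image]
      rintro _ ⟨p, hp, rfl⟩ _ ⟨q, hq, rfl⟩
      simp only [Prod.map_fst, Prod.map_snd]
      rw [hf.eq_iff (hN.fst_mem p hp) (hN.fst_mem q hq),
        hg.eq_iff (hN.snd_mem p hp) (hN.snd_mem q hq)]
      exact hN.eq_iff_eq p hp q hq
    · rw [Finset.sum_image (hfg N hN)]
      rfl

end minMatching

/-! ## The Hungarian algorithm -/

namespace Hungarian

/-- The data of the Hungarian algorithm: feasible potentials `u` for the rows `1, …, k` and `v`
for the columns `1, …, m` of the matrix `a`, and a matching that covers the rows `1, …, i`: the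
column `j` is matched to the row `p j`, or free if `p j = 0`. The column `0` is an auxiliary one
to which the row `i` can be assigned before it is matched. The column `e` is ignored. -/
structure Invariant (a : ℕ → ℕ → ℝ) (k m i e : ℕ) (u v : ℕ → ℝ) (p : ℕ → ℕ) : Prop where
  feasible : ∀ r, 1 ≤ r → r ≤ k → ∀ j, 1 ≤ j → j ≤ m → u r + v j ≤ a r j
  row_nonpos : ∀ r, 1 ≤ r → r ≤ k → u r ≤ 0
  col_nonpos : ∀ j, 1 ≤ j → j ≤ m → v j ≤ 0
  le : ∀ j ≤ m, j ≠ e → p j ≤ i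
  inj : ∀ j ≤ m, j ≠ e → ∀ j' ≤ m, j' ≠ e → p j = p j' → p j ≠ 0 → j = j'
  surj : ∀ r, 1 ≤ r → r ≤ i → ∃ j ≤ m, j ≠ e ∧ p j = r
  tight : ∀ j, 1 ≤ j → j ≤ m → j ≠ e → p j ≠ 0 → u (p j) + v j = a (p j) j
  free : ∀ j, 1 ≤ j → j ≤ m → j ≠ e → p j = 0 → v j = 0

variable {a w : ℕ → ℕ → ℝ} {k m i e : ℕ} {u v : ℕ → ℝ} {p : ℕ → ℕ}

/-- A common lower bound of the entries serves as potential of every row; the columns are free and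
have potential zero. -/
theorem Invariant.initial {B : ℝ} (hu : ∀ r, 1 ≤ r → r ≤ k → u r = B)
    (hv : ∀ j, 1 ≤ j → j ≤ m → v j = 0) (hp : ∀ j, 1 ≤ j → j ≤ m → p j = 0) (hB : B ≤ 0)
    (hBa : ∀ r, 1 ≤ r → r ≤ k → ∀ j, 1 ≤ j → j ≤ m → B ≤ a r j) :
    Invariant a k m 0 0 u v p where
  feasible r h1 h2 j h3 h4 := by simpa [hu r h1 h2, hv j h3 h4] using hBa r h1 h2 j h3 h4
  row_nonpos r h1 h2 := (hu r h1 h2).le.trans hB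
  col_nonpos j h1 h2 := (hv j h1 h2).le
  le j h1 h2 := (hp j (by omega) h1).le
  inj j h1 h2 _ _ _ _ h3 := absurd (hp j (by omega) h1) h3
  surj r h1 h2 := by omega
  tight j h1 h2 _ h3 := absurd (hp j h1 h2) h3
  free j h1 h2 _ _ := hv j h1 h2

/-- A new row is assigned to the auxiliary column. -/
theorem Invariant.addRow (h : Invariant a k m i 0 u v p) :
    Invariant a k m (i + 1) (m + 1) u v (Function.update p 0 (i + 1)) where
  feasible := h.feasible
  row_nonpos := h.row_nonpos
  col_nonpos := h.col_nonpos
  le j h1 h2 := by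
    rcases eq_or_ne j 0 with rfl | h0
    · simp
    · rw [Function.update_of_ne h0]
      exact (h.le j h1 h0).trans (by omega)
  inj j h1 _ j' h2 _ := by
    rcases eq_or_ne j 0 with rfl | h0 <;> rcases eq_or_ne j' 0 with rfl | h0'
    · simp
    · have := h.le j' h2 h0'
      rw [Function.update_self, Function.update_of_ne h0']
      omega
    · have := h.le j h1 h0
      rw [Function.update_self, Function.update_of_ne h0]
      omega
    · rw [Function.update_of_ne h0, Function.update_of_ne h0']
      exact h.inj j h1 h0 j' h2 h0'
  surj r h1 h2 := by
    rcases eq_or_ne r (i + 1) with rfl | h0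
    · exact ⟨0, by omega, by omega, by simp⟩
    · obtain ⟨j, h3, h4, h5⟩ := h.surj r h1 (by omega)
      exact ⟨j, h3, by omega, by rwa [Function.update_of_ne h4]⟩
  tight j h1 h2 _ := by
    rw [Function.update_of_ne (by omega)]
    exact h.tight j h1 h2 (by omega)
  free j h1 h2 _ := by
    rw [Function.update_of_ne (by omega)]
    exact h.free j h1 h2 (by omega)

/-- A free column may be ignored. -/
theorem Invariant.ignore (h : Invariant a k m i (m + 1) u v p) {j : ℕ} (hj : p j = 0) :
    Invariant a k m i j u v p where
  feasible := h.feasible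
  row_nonpos := h.row_nonpos
  col_nonpos := h.col_nonpos
  le j h1 _ := h.le j h1 (by omega)
  inj j h1 _ j' h2 _ := h.inj j h1 (by omega) j' h2 (by omega)
  surj r h1 h2 := by
    obtain ⟨j', h3, h4, h5⟩ := h.surj r h1 h2
    exact ⟨j', h3, by rintro rfl; omega, h5⟩
  tight j h1 h2 _ := h.tight j h1 h2 (by omega)
  free j h1 h2 _ := h.free j h1 h2 (by omega)

/-- The row of the column `j` is moved to the ignored column, and `j` is ignored instead. -/
theorem Invariant.move (h : Invariant a k m i e u v p) {j : ℕ} (hj : j ≤ m) (hje : j ≠ e)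
    (he : e ≤ m) (hp : p j ≠ 0) (ht : 1 ≤ e → u (p j) + v e = a (p j) e) :
    Invariant a k m i j u v (Function.update p e (p j)) where
  feasible := h.feasible
  row_nonpos := h.row_nonpos
  col_nonpos := h.col_nonpos
  le j' h1 h2 := by
    rcases eq_or_ne j' e with rfl | h0
    · simpa using h.le j hj hje
    · rw [Function.update_of_ne h0]
      exact h.le j' h1 h0
  inj j₁ h1 h2 j₂ h3 h4 := by
    by_cases h0 : j₁ = e <;> by_cases h0' : j₂ = e
    · exact fun _ _ => h0.trans h0'.symm
    · rw [h0, Function.update_self, Function.update_of_ne h0']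
      exact fun h5 h6 => absurd (h.inj j hj hje j₂ h3 h0' h5 h6).symm h4
    · rw [h0', Function.update_self, Function.update_of_ne h0]
      exact fun h5 h6 => absurd (h.inj j₁ h1 h0 j hj hje h5 h6) h2
    · rw [Function.update_of_ne h0, Function.update_of_ne h0']
      exact h.inj j₁ h1 h0 j₂ h3 h0'
  surj r h1 h2 := by
    obtain ⟨j', h3, h4, h5⟩ := h.surj r h1 h2
    rcases eq_or_ne j' j with rfl | h0
    · exact ⟨e, he, hje.symm, by simpa using h5⟩
    · exact ⟨j', h3, h0, by rwa [Function.update_of_ne h4]⟩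
  tight j' h1 h2 h3 := by
    rcases eq_or_ne j' e with rfl | h0
    · simpa using fun _ => ht h1
    · rw [Function.update_of_ne h0]
      exact h.tight j' h1 h2 h0
  free l h1 h2 h3 := by
    rcases eq_or_ne l e with rfl | h0
    · simpa using fun h4 => absurd h4 hp
    · rw [Function.update_of_ne h0]
      exact h.free l h1 h2 h0

/-- As long as not all rows are matched, there is a free column. -/
theorem Invariant.exists_free (h : Invariant a k m i (m + 1) u v p) (him : i ≤ m)
    (h0 : p 0 ≠ 0) : ∃ j, 1 ≤ j ∧ j ≤ m ∧ p j = 0 := by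
  by_contra! hc
  have hne : ∀ j ≤ m, p j ≠ 0 := fun j hj => by
    rcases Nat.eq_zero_or_pos j with rfl | h1
    · exact h0
    · exact hc j h1 hj
  -- Pigeonhole: otherwise `p` would map the `m + 1` columns, including the auxiliary one,
  -- injectively to the rows `1, …, i`.
  have := Finset.card_le_card_of_injOn (s := Finset.range (m + 1)) (t := Finset.Icc 1 i) p
    (fun j hj => by
      have hj' : j ≤ m := by simpa [Nat.lt_succ_iff] using hj
      have h1 := hne j hj'
      have h2 := h.le j hj' (by omega)
      simp
      omega)
    (fun j hj j' hj' he => by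
      simp only [Finset.coe_range, Set.mem_Iio] at hj hj'
      exact h.inj j (by omega) (by omega) j' (by omega) (by omega) he (hne j (by omega)))
  simp at this
  omega

/-- When all rows are matched, the matching is optimal. -/
theorem Invariant.minMatching_eq (h : Invariant a k m k 0 u v p)
    (ha : ∀ r, 1 ≤ r → r ≤ k → ∀ j, 1 ≤ j → j ≤ m → a r j = min (w r j) 0) :
    minMatching (Finset.Icc 1 k) (Finset.Icc 1 m) w =
      ∑ r ∈ Finset.Icc 1 k, u r + ∑ j ∈ Finset.Icc 1 m, v j := by
  refine (isLeast_minMatching _ _ w).unique ⟨?_, ?_⟩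
  -- Attainment. The matched columns correspond to all rows, and free columns have potential zero,
  -- so both sums of potentials become sums over `F`.
  · set F := (Finset.Icc 1 m).filter fun j => p j ≠ 0 with hF
    have hFmem : ∀ j ∈ F, 1 ≤ j ∧ j ≤ m ∧ p j ≠ 0 := by
      intro j hj
      simpa [hF, and_assoc] using hj
    have hrow : ∑ r ∈ Finset.Icc 1 k, u r = ∑ j ∈ F, u (p j) := by
      symm
      refine Finset.sum_bij (fun j _ => p j) ?_ ?_ ?_ fun _ _ => rfl
      · intro j hj
        obtain ⟨h1, h2, h3⟩ := hFmem j hj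
        have := h.le j h2 (by omega)
        simp
        omega
      · intro j hj j' hj' he
        obtain ⟨h1, h2, h3⟩ := hFmem j hj
        obtain ⟨h4, h5, h6⟩ := hFmem j' hj'
        exact h.inj j h2 (by omega) j' h5 (by omega) he h3
      · intro r hr
        rw [Finset.mem_Icc] at hr
        obtain ⟨j, h1, h2, h3⟩ := h.surj r hr.1 hr.2
        exact ⟨j, by simp [hF]; omega, h3⟩
    have hcol : ∑ j ∈ Finset.Icc 1 m, v j = ∑ j ∈ F, v j := by
      symm
      refine Finset.sum_subset (Finset.filter_subset _ _) fun j hj hj' => ?_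
      rw [Finset.mem_Icc] at hj
      refine h.free j hj.1 hj.2 (by omega) ?_
      by_contra h0
      exact hj' (by simp [hF]; omega)
    -- Pairs of nonnegative weight are dropped: their entry `min w 0` is zero, so they do not
    -- contribute to the sum of potentials.
    refine ⟨(F.filter fun j => w (p j) j < 0).image fun j => (p j, j), ⟨?_, ?_, ?_⟩, ?_⟩
    · simp only [Finset.mem_image, Finset.mem_filter]
      rintro _ ⟨j, ⟨hj, -⟩, rfl⟩
      obtain ⟨h1, h2, h3⟩ := hFmem j hj
      have := h.le j h2 (by omega)
      simp
      omega
    · simp only [Finset.mem_image, Finset.mem_filter]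
      rintro _ ⟨j, ⟨hj, -⟩, rfl⟩
      obtain ⟨h1, h2, h3⟩ := hFmem j hj
      simp
      omega
    · simp only [Finset.mem_image, Finset.mem_filter]
      rintro _ ⟨j, ⟨hj, -⟩, rfl⟩ _ ⟨j', ⟨hj', -⟩, rfl⟩
      obtain ⟨h1, h2, h3⟩ := hFmem j hj
      obtain ⟨h4, h5, h6⟩ := hFmem j' hj'
      exact ⟨fun he => h.inj j h2 (by omega) j' h5 (by omega) he h3, fun he => congrArg p he⟩
    · rw [Finset.sum_image fun j _ j' _ he => congrArg Prod.snd he, hrow, hcol,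
        ← Finset.sum_add_distrib, Finset.sum_filter]
      refine Finset.sum_congr rfl fun j hj => ?_
      obtain ⟨h1, h2, h3⟩ := hFmem j hj
      rw [h.tight j h1 h2 (by omega) h3,
        ha _ (by omega) (h.le j h2 (by omega)) j h1 h2]
      split_ifs with h4
      · exact (min_eq_left h4.le).symm
      · exact (min_eq_right (not_lt.1 h4)).symm
  -- Weak duality. Rows and columns missed by `N` have nonpositive potentials, so omitting them only
  -- increases the sum; feasibility bounds the rest by the weights.
  · rintro _ ⟨N, hN, rfl⟩
    have hrow : ∑ r ∈ Finset.Icc 1 k, u r ≤ ∑ q ∈ N, u q.1 := by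
      rw [← Finset.sum_image (s := N) (g := Prod.fst) (f := u) fun q hq q' hq' he =>
        Prod.ext he ((hN.eq_iff_eq q hq q' hq').1 he)]
      refine Finset.sum_le_sum_of_subset_of_nonpos' ?_ fun r hr _ => ?_
      · exact Finset.image_subset_iff.2 hN.fst_mem
      · rw [Finset.mem_Icc] at hr
        exact h.row_nonpos r hr.1 hr.2
    have hcol : ∑ j ∈ Finset.Icc 1 m, v j ≤ ∑ q ∈ N, v q.2 := by
      rw [← Finset.sum_image (s := N) (g := Prod.snd) (f := v) fun q hq q' hq' he =>
        Prod.ext ((hN.eq_iff_eq q hq q' hq').2 he) he]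
      refine Finset.sum_le_sum_of_subset_of_nonpos' ?_ fun r hr _ => ?_
      · exact Finset.image_subset_iff.2 hN.snd_mem
      · rw [Finset.mem_Icc] at hr
        exact h.col_nonpos r hr.1 hr.2
    refine (add_le_add hrow hcol).trans ?_
    rw [← Finset.sum_add_distrib]
    refine Finset.sum_le_sum fun q hq => ?_
    have h1 := Finset.mem_Icc.1 (hN.fst_mem q hq)
    have h2 := Finset.mem_Icc.1 (hN.snd_mem q hq)
    have h3 := h.feasible _ h1.1 h1.2 _ h2.1 h2.2
    rw [ha _ h1.1 h1.2 _ h2.1 h2.2] at h3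
    exact h3.trans (min_le_left _ _)

variable {used way : ℕ → ℕ} {minv : ℕ → ℝ} {c j₀ j₁ : ℕ}

/-- The alternating tree that is grown by the search for a free column: the columns `j` with
`used j ≠ 0` are those in the tree, numbered in the order of their discovery, and the edge
between a column and the row of its predecessor `way j` is tight. -/
structure AlternatingTree (a : ℕ → ℕ → ℝ) (k m i : ℕ) (u v : ℕ → ℝ) (p used way : ℕ → ℕ)
    (c : ℕ) : Prop where
  invariant : Invariant a k m i (m + 1) u v p
  root : p 0 ≠ 0
  lt : ∀ j ≤ m, used j < c
  card : ((Finset.range (m + 1)).filter fun j => used j ≠ 0).card + 1 = c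
  matched : ∀ j ≤ m, used j ≠ 0 → p j ≠ 0
  way_spec : ∀ j, 1 ≤ j → j ≤ m → used j ≠ 0 → way j ≤ m ∧ used (way j) ≠ 0 ∧
    used (way j) < used j ∧ u (p (way j)) + v j = a (p (way j)) j

/-- For the columns `j` outside of the tree, `minv j` is the least slack of an edge to the tree,
and this edge leads to the row of `way j`. -/
def Frontier (a : ℕ → ℕ → ℝ) (m : ℕ) (u v : ℕ → ℝ) (p used way : ℕ → ℕ) (minv : ℕ → ℝ) : Prop :=
  ∀ j, 1 ≤ j → j ≤ m → used j = 0 → way j ≤ m ∧ used (way j) ≠ 0 ∧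
    minv j = a (p (way j)) j - u (p (way j)) - v j ∧
    ∀ l ≤ m, used l ≠ 0 → minv j ≤ a (p l) j - u (p l) - v j

/-- The state of the search just before the column `j₀` is added to the tree. -/
structure Search (a : ℕ → ℕ → ℝ) (k m i : ℕ) (u v : ℕ → ℝ) (p used way : ℕ → ℕ)
    (minv : ℕ → ℝ) (c j₀ : ℕ) : Prop extends AlternatingTree a k m i u v p used way c where
  le : j₀ ≤ m
  unused : used j₀ = 0
  start : j₀ = 0 → ∀ j ≤ m, used j = 0
  frontier : j₀ ≠ 0 → Frontier a m u v p used way minv ∧ minv j₀ = 0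

/-- The columns of the tree are matched to distinct rows among `1, …, i`. This bounds the number of
rounds of the search. -/
theorem AlternatingTree.count_le (h : AlternatingTree a k m i u v p used way c) : c ≤ i + 1 := by
  rw [← h.card]
  have := Finset.card_le_card_of_injOn
    (s := (Finset.range (m + 1)).filter fun j => used j ≠ 0) (t := Finset.Icc 1 i) p
    (fun j hj => by
      simp only [Finset.coe_filter, Finset.mem_range, Set.mem_ofPred_eq] at hj
      have h1 := h.matched j (by omega) hj.2
      have h2 := h.invariant.le j (by omega) (by omega)
      simp
      omega)
    (fun j hj j' hj' he => by
      simp only [Finset.coe_filter, Finset.mem_range, Set.mem_ofPred_eq] at hj hj'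
      exact h.invariant.inj j (by omega) (by omega) j' (by omega) (by omega) he
        (h.matched j (by omega) hj.2))
  simpa using this

/-- The column `j₀` is added to the tree, and the slacks of the other columns are updated. -/
theorem Search.relax (h : Search a k m i u v p used way minv c j₀) (hp : p j₀ ≠ 0)
    {way' : ℕ → ℕ} {minv' : ℕ → ℝ}
    (hused : ∀ j, 1 ≤ j → j ≤ m → Function.update used j₀ c j ≠ 0 → way' j = way j)
    (hnew : ∀ j, 1 ≤ j → j ≤ m → Function.update used j₀ c j = 0 →
      (j₀ = 0 ∨ a (p j₀) j - u (p j₀) - v j < minv j) →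
      way' j = j₀ ∧ minv' j = a (p j₀) j - u (p j₀) - v j)
    (hold : ∀ j, 1 ≤ j → j ≤ m → Function.update used j₀ c j = 0 →
      ¬ (j₀ = 0 ∨ a (p j₀) j - u (p j₀) - v j < minv j) → way' j = way j ∧ minv' j = minv j) :
    AlternatingTree a k m i u v p (Function.update used j₀ c) way' (c + 1) ∧
      Frontier a m u v p (Function.update used j₀ c) way' minv' := by
  have hc : 1 ≤ c := by have := h.card; omega
  have hmono : ∀ j, used j ≠ 0 → Function.update used j₀ c j = used j := by
    intro j hj
    rw [Function.update_of_ne]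
    rintro rfl
    exact hj h.unused
  refine ⟨⟨h.invariant, h.root, ?_, ?_, ?_, ?_⟩, ?_⟩
  · intro j hj
    rcases eq_or_ne j j₀ with rfl | h0
    · simp
    · rw [Function.update_of_ne h0]
      exact (h.lt j hj).trans (by omega)
  · have : ((Finset.range (m + 1)).filter fun j => Function.update used j₀ c j ≠ 0) =
        insert j₀ ((Finset.range (m + 1)).filter fun j => used j ≠ 0) := by
      ext j
      rcases eq_or_ne j j₀ with rfl | h0
      · have := h.le
        simp
        omega
      · simp [h0]
    rw [this, Finset.card_insert_of_notMem (by simp [h.unused]), h.card]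
  · intro j hj
    rcases eq_or_ne j j₀ with rfl | h0
    · exact fun _ => hp
    · rw [Function.update_of_ne h0]
      exact h.matched j hj
  · intro j h1 h2 h3
    rw [hused j h1 h2 h3]
    rcases eq_or_ne j j₀ with rfl | h0
    -- For the new column itself, `minv` is zero, which says that its edge to the tree is tight. The
    -- predecessor was discovered earlier, so its number is below `c`.
    · obtain ⟨hF, h5⟩ := h.frontier (by omega)
      obtain ⟨h6, h7, h8, -⟩ := hF j h1 h2 h.unused
      refine ⟨h6, ?_, ?_, by linarith⟩
      · rwa [hmono _ h7]
      · rw [hmono _ h7, Function.update_self]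
        exact h.lt _ h6
    · rw [Function.update_of_ne h0] at h3 ⊢
      obtain ⟨h6, h7, h8, h9⟩ := h.way_spec j h1 h2 h3
      exact ⟨h6, by rwa [hmono _ h7], by rwa [hmono _ h7], h9⟩
  · intro j h1 h2 h3
    have h0 : j ≠ j₀ := by
      rintro rfl
      simp at h3
      omega
    have h3' : used j = 0 := by rwa [Function.update_of_ne h0] at h3
    by_cases hlt : j₀ = 0 ∨ a (p j₀) j - u (p j₀) - v j < minv j
    · obtain ⟨h4, h5⟩ := hnew j h1 h2 h3 hlt
      rw [h4, h5]
      refine ⟨h.le, by simp; omega, rfl, fun j' hj' h6 => ?_⟩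
      rcases eq_or_ne j' j₀ with rfl | h0'
      · rfl
      · rw [Function.update_of_ne h0'] at h6
        -- If `j₀ = 0`, the tree was empty and there is no older edge to compare with. Testing for
        -- this case replaces an initialization of `minv` by infinity.
        rcases hlt with hlt | hlt
        · exact absurd (h.start hlt j' hj') h6
        · have h7 : j₀ ≠ 0 := fun h7 => h6 (h.start h7 j' hj')
          exact hlt.le.trans (((h.frontier h7).1 j h1 h2 h3').2.2.2 j' hj' h6)
    · obtain ⟨h4, h5⟩ := hold j h1 h2 h3 hlt
      rw [h4, h5]
      push Not at hlt
      obtain ⟨h6, h7, h8, h9⟩ := (h.frontier hlt.1).1 j h1 h2 h3'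
      refine ⟨h6, by rwa [hmono _ h7], h8, fun j' hj' h10 => ?_⟩
      rcases eq_or_ne j' j₀ with rfl | h0'
      · exact hlt.2
      · rw [Function.update_of_ne h0'] at h10
        exact h9 j' hj' h10

theorem AlternatingTree.exists_unused (h : AlternatingTree a k m i u v p used way c)
    (him : i ≤ m) : ∃ j, 1 ≤ j ∧ j ≤ m ∧ used j = 0 := by
  obtain ⟨j, h1, h2, h3⟩ := h.invariant.exists_free him h.root
  exact ⟨j, h1, h2, by by_contra h4; exact h.matched j h2 h4 h3⟩

/-- The potentials are changed so that the edge from the tree to the column `j₁` becomes tight. -/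
theorem AlternatingTree.update (h : AlternatingTree a k m i u v p used way c)
    (hF : Frontier a m u v p used way minv) (him : i ≤ m)
    (ha : ∀ r, 1 ≤ r → r ≤ k → ∀ j, 1 ≤ j → j ≤ m → a r j ≤ 0) (hj₁ : 1 ≤ j₁) (hj₁m : j₁ ≤ m)
    (hj₁u : used j₁ = 0)
    (hmin : ∀ j, 1 ≤ j → j ≤ m → used j = 0 → minv j₁ ≤ minv j)
    {u' v' minv' : ℕ → ℝ} (hik : i ≤ k)
    (hu : ∀ j ≤ m, used j ≠ 0 → u' (p j) = u (p j) + minv j₁)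
    (hu' : ∀ r, (∀ j ≤ m, used j ≠ 0 → p j ≠ r) → u' r = u r)
    (hv : ∀ j ≤ m, used j ≠ 0 → v' j = v j - minv j₁)
    (hv' : ∀ j ≤ m, used j = 0 → v' j = v j)
    (hminv : ∀ j ≤ m, used j = 0 → minv' j = minv j - minv j₁) :
    Search a k m i u' v' p used way minv' c j₁ := by
  have hI := h.invariant
  -- The shift is the slack of an actual edge, hence nonnegative by feasibility.
  have hδ : 0 ≤ minv j₁ := by
    obtain ⟨h1, h2, h3, -⟩ := hF j₁ hj₁ hj₁m hj₁u
    have h4 := h.matched _ h1 h2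
    have h5 := hI.le _ h1 (by omega)
    have h6 := hI.feasible (p (way j₁)) (by omega) (by omega) j₁ hj₁ hj₁m
    linarith
  have hfeas : ∀ r, 1 ≤ r → r ≤ k → ∀ j, 1 ≤ j → j ≤ m → u' r + v' j ≤ a r j := by
    intro r hr hrk j hj hjm
    have h1 := hI.feasible r hr hrk j hj hjm
    by_cases hr' : ∃ j' ≤ m, used j' ≠ 0 ∧ p j' = r
    · obtain ⟨j', hj', h2, rfl⟩ := hr'
      rw [hu j' hj' h2]
      by_cases h3 : used j = 0
      · rw [hv' j hjm h3]
        have h4 := (hF j hj hjm h3).2.2.2 j' hj' h2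
        have h5 := hmin j hj hjm h3
        linarith
      · rw [hv j hjm h3]
        linarith
    · push Not at hr'
      rw [hu' r hr']
      by_cases h3 : used j = 0
      · rw [hv' j hjm h3]
        linarith
      · rw [hv j hjm h3]
        linarith
  have hfree : ∀ j, 1 ≤ j → j ≤ m → p j = 0 → v' j = 0 := by
    intro j hj hjm hp
    rw [hv' j hjm (by by_contra h1; exact h.matched j hjm h1 hp)]
    exact hI.free j hj hjm (by omega) hp
  refine ⟨⟨⟨hfeas, ?_, ?_, hI.le, hI.inj, hI.surj, ?_, fun j h1 h2 _ => hfree j h1 h2⟩, h.root,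
    h.lt, h.card, h.matched, ?_⟩, hj₁m, hj₁u, by omega, fun _ => ⟨?_, by simp [hminv j₁ hj₁m hj₁u]⟩⟩
  · intro r hr hrk
    -- Row potentials grow, but stay nonpositive: a free column still exists, its potential is zero
    -- after the change too, and feasibility there gives `u' r ≤ a r j ≤ 0`.
    obtain ⟨j, h1, h2, h3⟩ := hI.exists_free him h.root
    have h4 := hfeas r hr hrk j h1 h2
    rw [hfree j h1 h2 h3] at h4
    linarith [ha r hr hrk j h1 h2]
  · intro j hj hjm
    have h1 := hI.col_nonpos j hj hjm
    by_cases h3 : used j = 0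
    · rwa [hv' j hjm h3]
    · rw [hv j hjm h3]
      linarith
  · intro j hj hjm _ hp
    have h1 := hI.tight j hj hjm (by omega) hp
    by_cases h3 : used j = 0
    · rw [hv' j hjm h3, hu' (p j), h1]
      rintro j' hj' h4 h5
      have h6 := hI.inj j' hj' (by omega) j hjm (by omega) h5 (h.matched j' hj' h4)
      exact h4 (h6 ▸ h3)
    · rw [hv j hjm h3, hu j hjm h3]
      linarith
  · intro j hj hjm h3
    obtain ⟨h4, h5, h6, h7⟩ := h.way_spec j hj hjm h3
    refine ⟨h4, h5, h6, ?_⟩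
    rw [hu _ h4 h5, hv j hjm h3]
    linarith
  · intro j hj hjm h3
    obtain ⟨h4, h5, h6, h7⟩ := hF j hj hjm h3
    refine ⟨h4, h5, ?_, ?_⟩
    · rw [hminv j hjm h3, hu _ h4 h5, hv' j hjm h3]
      linarith
    · intro j' hj' h8
      rw [hminv j hjm h3, hu _ hj' h8, hv' j hjm h3]
      have := h7 j' hj' h8
      linarith

/-- The state of the augmentation, where the column `j₀` was discovered at time `ρ` and is still
to be matched to the row of its predecessor. -/
structure Augment (a : ℕ → ℕ → ℝ) (k m i : ℕ) (u v : ℕ → ℝ) (p used way : ℕ → ℕ)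
    (ρ j₀ : ℕ) : Prop where
  invariant : Invariant a k m i j₀ u v p
  le : j₀ ≤ m
  used_eq : used j₀ = 0 ∨ used j₀ = ρ
  way_spec : ∀ j, 1 ≤ j → j ≤ m → (j = j₀ ∨ used j ≠ 0 ∧ used j < ρ) → way j ≤ m ∧
    used (way j) ≠ 0 ∧ used (way j) < ρ ∧ (used j ≠ 0 → used (way j) < used j) ∧
    p (way j) ≠ 0 ∧ u (p (way j)) + v j = a (p (way j)) j

theorem Search.augment (h : Search a k m i u v p used way minv c j₀) (hp : p j₀ = 0) :
    Augment a k m i u v p used way c j₀ where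
  invariant := h.invariant.ignore hp
  le := h.le
  used_eq := Or.inl h.unused
  way_spec j hj hjm h1 := by
    by_cases h2 : used j = 0
    · have h3 : j = j₀ := h1.resolve_right fun h => h.1 h2
      subst h3
      obtain ⟨hF, h4⟩ := h.frontier (by omega)
      obtain ⟨h5, h6, h7, -⟩ := hF j hj hjm h2
      exact ⟨h5, h6, h.lt _ h5, fun h8 => absurd h2 h8, h.matched _ h5 h6, by linarith⟩
    · obtain ⟨h5, h6, h7, h8⟩ := h.way_spec j hj hjm h2
      exact ⟨h5, h6, h.lt _ h5, fun _ => h7, h.matched _ h5 h6, h8⟩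

/-- The discovery numbers decrease strictly along predecessors. So the walk ends at column `0`, and
the changed entries of `p` are not consulted again. -/
theorem Augment.step {ρ : ℕ} (h : Augment a k m i u v p used way ρ j₀) (h0 : j₀ ≠ 0) :
    used (way j₀) < ρ ∧ Augment a k m i u v (Function.update p j₀ (p (way j₀))) used way
      (used (way j₀)) (way j₀) := by
  obtain ⟨h1, h2, h3, h4, h5, h6⟩ := h.way_spec j₀ (by omega) h.le (Or.inl rfl)
  have hne : ∀ j, used j ≠ 0 → used j < ρ → j ≠ j₀ := by
    rintro j h7 h8 rfl
    rcases h.used_eq with h9 | h9 <;> omega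
  refine ⟨h3, h.invariant.move h1 (hne _ h2 h3) h.le h5 fun _ => h6, h1, Or.inr rfl, ?_⟩
  intro j hj hjm h7
  have h8 : used j ≠ 0 ∧ used j ≤ used (way j₀) := by
    rcases h7 with rfl | h7
    · exact ⟨h2, le_rfl⟩
    · exact ⟨h7.1, h7.2.le⟩
  obtain ⟨h9, h10, h11, h12, h13, h14⟩ := h.way_spec j hj hjm (Or.inr ⟨h8.1, by omega⟩)
  have h15 := h12 h8.1
  rw [Function.update_of_ne (hne _ h10 h11)]
  exact ⟨h9, h10, by omega, h12, h13, h14⟩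

/-- The counter starts at `1` because the number `0` marks columns outside of the tree. -/
theorem Invariant.search (h : Invariant a k m i 0 u v p)
    (hused : ∀ j ≤ m, used j = 0) :
    Search a k m (i + 1) u v (Function.update p 0 (i + 1)) used way minv 1 0 where
  invariant := h.addRow
  root := by simp
  lt j hj := by simp [hused j hj]
  card := by
    rw [Nat.add_eq_right, Finset.card_eq_zero, Finset.filter_eq_empty_iff]
    intro j hj
    simpa using hused j (by simpa [Nat.lt_succ_iff] using hj)
  matched j hj h1 := absurd (hused j hj) h1
  way_spec j _ hj h1 := absurd (hused j hj) h1
  le := Nat.zero_le _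
  unused := hused 0 (Nat.zero_le _)
  start _ := hused
  frontier h := absurd rfl h

end Hungarian

/-! ## A program for the Hungarian algorithm -/

namespace RAM

/-- The initial potentials and the empty matching. -/
def initRows : Program :=
  .range 42 1 (.add (.var 32) (.const 1)) (.setReal 3 (.var 42) (.var 2))

/-- Memory layout of the Hungarian programs. Natural numbers: `36`, `37`, `38` are the arrays `p`,
`used`, `way`; cell `39` is the row to be matched, `40` the current column `j₀`, `41` the next
column, `42` the counter of the inner loops, `43` the row of `j₀`, and `44` the discovery counter
`c`. Real numbers: `3`, `4`, `5` are `u`, `v`, `minv`; cell `6` holds a slack and cell `8` the shift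
of the potentials. -/
def initCols : Program :=
  .range 42 1 (.add (.var 33) (.const 1))
    (.seq (.setReal 4 (.var 42) .zero) (.setNat 36 (.var 42) (.const 0)))

def clearUsed : Program :=
  .range 42 0 (.add (.var 33) (.const 1)) (.setNat 37 (.var 42) (.const 0))

/-- Update the slacks of the columns outside of the alternating tree after the column in cell
`40` has been added. -/
def relaxCols : Program :=
  .range 42 1 (.add (.var 33) (.const 1))
    (.ifThenElse (.natEq (.load 37 (.var 42)) (.const 0))
      (.seq
        (.setReal 6 (.const 0) (.sub (.sub
          (.load 1 (.add (.load 34 (.var 43)) (.load 35 (.var 42))))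
          (.load 3 (.var 43))) (.load 4 (.var 42))))
        (.ifThenElse (.and (.not (.natEq (.var 40) (.const 0)))
            (.not (.realLt (.var 6) (.load 5 (.var 42)))))
          .skip
          (.seq (.setReal 5 (.var 42) (.var 6)) (.setNat 38 (.var 42) (.var 40)))))
      .skip)

/-- Find a column outside of the alternating tree with the least slack. -/
def selectCol : Program :=
  .seq (.setNat 41 (.const 0) (.const 0))
    (.range 42 1 (.add (.var 33) (.const 1))
      (.ifThenElse (.and (.natEq (.load 37 (.var 42)) (.const 0))
          (.not (.and (.not (.natEq (.var 41) (.const 0)))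
            (.not (.realLt (.load 5 (.var 42)) (.load 5 (.var 41)))))))
        (.setNat 41 (.const 0) (.var 42))
        .skip))

/-- Change the potentials. -/
def updateDuals : Program :=
  .seq (.setReal 8 (.const 0) (.load 5 (.var 41)))
    (.range 42 0 (.add (.var 33) (.const 1))
      (.ifThenElse (.natEq (.load 37 (.var 42)) (.const 0))
        (.setReal 5 (.var 42) (.sub (.load 5 (.var 42)) (.var 8)))
        (.seq
          (.setReal 3 (.load 36 (.var 42)) (.add (.load 3 (.load 36 (.var 42))) (.var 8)))
          (.setReal 4 (.var 42) (.sub (.load 4 (.var 42)) (.var 8))))))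

/-- Add the column in cell `40` to the alternating tree. -/
def growTree : Program :=
  .seq (.setNat 37 (.var 40) (.var 44))
    (.seq (.setNat 44 (.const 0) (.add (.var 44) (.const 1)))
      (.seq (.setNat 43 (.const 0) (.load 36 (.var 40)))
        (.seq relaxCols (.seq selectCol (.seq updateDuals
          (.setNat 40 (.const 0) (.var 41)))))))

/-- Augment the matching along the path in the alternating tree to the column in cell `40`. -/
def augmentPath : Program :=
  .loop (.not (.natEq (.var 40) (.const 0)))
    (.seq (.setNat 41 (.const 0) (.load 38 (.var 40)))
      (.seq (.setNat 36 (.var 40) (.load 36 (.var 41)))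
        (.setNat 40 (.const 0) (.var 41))))

/-- Match the row in cell `39`. -/
def matchRow : Program :=
  .seq (.setNat 36 (.const 0) (.var 39))
    (.seq clearUsed
      (.seq (.setNat 40 (.const 0) (.const 0))
        (.seq (.setNat 44 (.const 0) (.const 1))
          (.seq (.loop (.not (.natEq (.load 36 (.var 40)) (.const 0))) growTree)
            augmentPath))))

/-- Sum up the potentials. -/
def sumDuals : Program :=
  .seq (.setReal 7 (.const 0) .zero)
    (.seq
      (.range 42 1 (.add (.var 32) (.const 1))
        (.setReal 7 (.const 0) (.add (.var 7) (.load 3 (.var 42)))))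
      (.range 42 1 (.add (.var 33) (.const 1))
        (.setReal 7 (.const 0) (.add (.var 7) (.load 4 (.var 42))))))

/-- The Hungarian algorithm. The numbers of rows and columns are given in the cells `32` and
`33`, the position of the entry `(r, j)` of the matrix in the real array `1` is given as the sum
of the `r`-th entry of the array `34` and the `j`-th entry of the array `35`, and the real
cell `2` contains a lower bound for the entries. The result is stored in the real cell `7`. -/
def hungarian : Program :=
  .seq initRows (.seq initCols
    (.seq (.range 39 1 (.add (.var 32) (.const 1)) matchRow) sumDuals))

/-! ### Correctness of the loops over rows and columns -/

variable {L : Type*} {D : CostInput L} {W : ℕ} {s : State}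

theorem Frame.nat_eq {P : Program} {s s' : State} (h : Frame P s s') (a : ℕ)
    (ha : a ∉ P.natTargets := by decide) : s'.nat a = s.nat a := h.nat a ha

theorem Frame.real_eq {P : Program} {s s' : State} (h : Frame P s s') (a : ℕ)
    (ha : a ∉ P.realTargets := by decide) : s'.real a = s.real a := h.real a ha

theorem wp_initRows (hW : s.nat 32 0 + 1 ≤ W) :
    Wp D W initRows s fun s' t => t ≤ 30 * (s.nat 32 0 + 1) ∧
      ∀ r, 1 ≤ r → r ≤ s.nat 32 0 → s'.real 3 r = s.real 2 0 := by
  refine (Wp.range (fun i s' => ∀ r, 1 ≤ r → r < i → s'.real 3 r = s.real 2 0)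
    (N := s.nat 32 0 + 1) 5 (by omega) hW (by intros; omega) ?_ ?_).mono ?_
  · intro s' hf
    simp [hf.nat_eq 32]
  · intro i s' hf hi h1 h2 hI
    refine Wp.setReal ?_
    simp only [NatExpr.eval, RealExpr.eval, NatExpr.steps, RealExpr.steps, hi, hf.real_eq 2]
    refine ⟨by omega, by simp [hi], fun r hr hr' => ?_⟩
    by_cases h : r = i
    · simp [h]
    · simp [h]
      exact hI r hr (by omega)
  · rintro s' t hf ⟨ht, h⟩
    refine ⟨?_, fun r h1 h2 => h r h1 (by omega)⟩
    simp at ht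
    omega

theorem wp_initCols (hW : s.nat 33 0 + 1 ≤ W) :
    Wp D W initCols s fun s' t => t ≤ 30 * (s.nat 33 0 + 1) ∧
      ∀ j, 1 ≤ j → j ≤ s.nat 33 0 → s'.real 4 j = 0 ∧ s'.nat 36 j = 0 := by
  refine (Wp.range (fun i s' => ∀ j, 1 ≤ j → j < i → s'.real 4 j = 0 ∧ s'.nat 36 j = 0)
    (N := s.nat 33 0 + 1) 10 (by omega) hW (by intros; omega) ?_ ?_).mono ?_
  · intro s' hf
    simp [hf.nat_eq 33]
  · intro i s' hf hi h1 h2 hI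
    refine Wp.seq (Wp.setReal (Wp.setNat (by simp) ?_))
    simp only [NatExpr.eval, RealExpr.eval, NatExpr.steps, RealExpr.steps, hi]
    refine ⟨by omega, by simp [hi], fun r hr hr' => ?_⟩
    by_cases h : r = i
    · simp [h, hi]
    · simp [h, hi]
      exact hI r hr (by omega)
  · rintro s' t hf ⟨ht, h⟩
    refine ⟨?_, fun r h1 h2 => h r h1 (by omega)⟩
    simp at ht
    omega

theorem wp_clearUsed (hW : s.nat 33 0 + 1 ≤ W) :
    Wp D W clearUsed s fun s' t => t ≤ 30 * (s.nat 33 0 + 1) ∧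
      ∀ j ≤ s.nat 33 0, s'.nat 37 j = 0 := by
  refine (Wp.range (fun i s' => ∀ j < i, s'.nat 37 j = 0)
    (N := s.nat 33 0 + 1) 5 (by omega) hW (by intros; omega) ?_ ?_).mono ?_
  · intro s' hf
    simp [hf.nat_eq 33]
  · intro i s' hf hi h1 h2 hI
    refine Wp.setNat (by simp) ?_
    simp only [NatExpr.eval, NatExpr.steps, hi]
    refine ⟨by omega, by simp [hi], fun r hr => ?_⟩
    by_cases h : r = i
    · simp [h]
    · simp [h]
      exact hI r (by omega)
  · rintro s' t hf ⟨ht, h⟩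
    refine ⟨?_, fun r h2 => h r (by omega)⟩
    simp at ht
    omega

/-- The three cases are the hypotheses of `Search.relax`. The loop invariant also records that cells
not yet visited are unchanged, so the comparison reads the old slack. -/
theorem wp_relaxCols (hW : s.nat 33 0 + 1 ≤ W) (hj₀ : s.nat 40 0 ≤ W) {cur : ℕ → ℝ}
    (hcur : ∀ j, cur j = s.real 1 (s.nat 34 (s.nat 43 0) + s.nat 35 j) -
      s.real 3 (s.nat 43 0) - s.real 4 j) :
    Wp D W relaxCols s fun s' t => t ≤ 80 * (s.nat 33 0 + 1) ∧
      ∀ j, 1 ≤ j → j ≤ s.nat 33 0 →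
        (s.nat 37 j ≠ 0 → s'.nat 38 j = s.nat 38 j) ∧
        (s.nat 37 j = 0 → (s.nat 40 0 = 0 ∨ cur j < s.real 5 j) →
          s'.nat 38 j = s.nat 40 0 ∧ s'.real 5 j = cur j) ∧
        (s.nat 37 j = 0 → ¬ (s.nat 40 0 = 0 ∨ cur j < s.real 5 j) →
          s'.nat 38 j = s.nat 38 j ∧ s'.real 5 j = s.real 5 j) := by
  refine (Wp.range (fun i s' =>
      (∀ j, i ≤ j → s'.nat 38 j = s.nat 38 j ∧ s'.real 5 j = s.real 5 j) ∧
      ∀ j, 1 ≤ j → j < i →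
        (s.nat 37 j ≠ 0 → s'.nat 38 j = s.nat 38 j) ∧
        (s.nat 37 j = 0 → (s.nat 40 0 = 0 ∨ cur j < s.real 5 j) →
          s'.nat 38 j = s.nat 40 0 ∧ s'.real 5 j = cur j) ∧
        (s.nat 37 j = 0 → ¬ (s.nat 40 0 = 0 ∨ cur j < s.real 5 j) →
          s'.nat 38 j = s.nat 38 j ∧ s'.real 5 j = s.real 5 j))
    (N := s.nat 33 0 + 1) 60 (by omega) hW ⟨by simp, by intros; omega⟩ ?_ ?_).mono ?_
  · intro s' hf
    simp [hf.nat_eq 33]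
  · rintro i s' hf hi h1 h2 ⟨hI, hI'⟩
    refine Wp.ite (fun hb => ?_) (fun hb => ?_)
    · simp only [Test.Holds, NatExpr.eval, hi, hf.nat_eq 37] at hb
      refine Wp.seq (Wp.setReal ?_)
      simp only [NatExpr.eval, RealExpr.eval, NatExpr.steps, RealExpr.steps, hi, hf.real_eq 1,
        hf.real_eq 3, hf.real_eq 4, hf.nat_eq 34, hf.nat_eq 35, hf.nat_eq 43, ← hcur]
      refine Wp.ite (fun hb' => ?_) (fun hb' => ?_)
      · simp [hi, hf.nat_eq 40, (hI i le_rfl).2] at hb'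
        refine Wp.skip ⟨by simp, by simpa using hi, ?_, ?_⟩
        · intro j hj
          simpa using hI j (by omega)
        · intro j hj hj'
          rcases eq_or_ne j i with rfl | h
          · simp [hb, hI j le_rfl, hb']
          · simpa using hI' j hj (by omega)
      · simp [hi, hf.nat_eq 40, (hI i le_rfl).2] at hb'
        refine Wp.seq (Wp.setReal (Wp.setNat (by simpa [hf.nat_eq 40] using hj₀) ?_))
        refine ⟨by simp, by simpa using hi, ?_, ?_⟩
        · intro j hj
          have : j ≠ i := by omega
          simpa [hi, this] using hI j (by omega)
        · intro j hj hj'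
          rcases eq_or_ne j i with rfl | h
          · have : s.nat 40 0 = 0 ∨ cur j < s.real 5 j := by tauto
            simp [hi, hb, hf.nat_eq 40, this]
          · simpa [hi, h] using hI' j hj (by omega)
    · simp only [Test.Holds, NatExpr.eval, hi, hf.nat_eq 37] at hb
      refine Wp.skip ⟨by simp, hi, ?_, ?_⟩
      · intro j hj
        simpa using hI j (by omega)
      · intro j hj hj'
        rcases eq_or_ne j i with rfl | h
        · simp [hb, hI j le_rfl]
        · simpa using hI' j hj (by omega)
  · rintro s' t hf ⟨ht, -, h⟩
    refine ⟨?_, fun r h1 h2 => h r h1 (by omega)⟩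
    simp at ht
    omega

/-- The value `0` in cell `41` means that no candidate has been met; `hex` rules this out at the
end. -/
theorem wp_selectCol (hW : s.nat 33 0 + 1 ≤ W)
    (hex : ∃ j, 1 ≤ j ∧ j ≤ s.nat 33 0 ∧ s.nat 37 j = 0) :
    Wp D W selectCol s fun s' t => t ≤ 60 * (s.nat 33 0 + 1) ∧
      1 ≤ s'.nat 41 0 ∧ s'.nat 41 0 ≤ s.nat 33 0 ∧ s.nat 37 (s'.nat 41 0) = 0 ∧
      ∀ j, 1 ≤ j → j ≤ s.nat 33 0 → s.nat 37 j = 0 →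
        s.real 5 (s'.nat 41 0) ≤ s.real 5 j := by
  refine Wp.seq (Wp.setNat (by simp) ?_)
  simp only [NatExpr.eval, NatExpr.steps]
  set s₁ := s.writeNat 41 0 0 with hs₁
  have h33 : s₁.nat 33 = s.nat 33 := by simp [hs₁]
  have h37 : s₁.nat 37 = s.nat 37 := by simp [hs₁]
  have h5 : s₁.real 5 = s.real 5 := by simp [hs₁]
  refine (Wp.range (fun i s' => (s'.nat 41 0 = 0 ∧ ∀ j, 1 ≤ j → j < i → s.nat 37 j ≠ 0) ∨
      (1 ≤ s'.nat 41 0 ∧ s'.nat 41 0 < i ∧ s.nat 37 (s'.nat 41 0) = 0 ∧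
      ∀ j, 1 ≤ j → j < i → s.nat 37 j = 0 → s.real 5 (s'.nat 41 0) ≤ s.real 5 j))
    (N := s.nat 33 0 + 1) 35 (by omega) hW (Or.inl ⟨by simp [hs₁], by intros; omega⟩) ?_ ?_).mono ?_
  · intro s' hf
    simp [hf.nat_eq 33, h33]
  · rintro i s' hf hi h1 h2 hI
    refine Wp.ite (fun hb => ?_) (fun hb => ?_)
    · simp only [Test.Holds, NatExpr.eval, RealExpr.eval, hi, hf.nat_eq 37, hf.real_eq 5, h37,
        h5] at hb
      refine Wp.setNat (by simp [hi]; omega) ?_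
      refine ⟨by simp, by simpa using hi, Or.inr ?_⟩
      simp only [NatExpr.eval, hi]
      simp only [ne_eq, Nat.reduceEqDiff, not_false_eq_true,
        State.writeNat_nat_of_ne, State.writeNat_nat_self, Function.update_self]
      refine ⟨h1, by omega, hb.1, fun j hj hj' hju => ?_⟩
      rcases eq_or_ne j i with rfl | h
      · exact le_rfl
      · rcases hI with ⟨hI1, hI2⟩ | ⟨hI1, hI2, hI3, hI4⟩
        · exact absurd hju (hI2 j hj (by omega))
        · have := hI4 j hj (by omega) hju
          have hb2 := hb.2
          push Not at hb2
          exact (hb2 (by omega)).le.trans this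
    · simp only [Test.Holds, NatExpr.eval, RealExpr.eval, hi, hf.nat_eq 37, hf.real_eq 5, h37,
        h5] at hb
      refine Wp.skip ⟨by simp, hi, ?_⟩
      simp only [ne_eq, Nat.reduceEqDiff, not_false_eq_true,
        State.writeNat_nat_of_ne]
      push Not at hb
      rcases hI with ⟨hI1, hI2⟩ | ⟨hI1, hI2, hI3, hI4⟩
      · refine Or.inl ⟨hI1, fun j hj hj' hju => ?_⟩
        rcases eq_or_ne j i with rfl | h
        · exact (hb hju).1 hI1
        · exact hI2 j hj (by omega) hju
      · refine Or.inr ⟨hI1, by omega, hI3, fun j hj hj' hju => ?_⟩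
        rcases eq_or_ne j i with rfl | h
        · exact (hb hju).2
        · exact hI4 j hj (by omega) hju
  · rintro s' t hf ⟨ht, h⟩
    simp at ht
    refine ⟨by omega, ?_⟩
    obtain ⟨j, hj, hjm, hju⟩ := hex
    rcases h with ⟨hI1, hI2⟩ | ⟨hI1, hI2, hI3, hI4⟩
    · exact absurd hju (hI2 j hj (by omega))
    · exact ⟨hI1, by omega, hI3, fun j hj hjm => hI4 j hj (by omega)⟩

/-- Row potentials are addressed through the matching `p`. By `hinj` no row is addressed twice, so
each receives the shift exactly once. The shift is copied to cell `8` first because the loop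
overwrites the array `5`. -/
theorem wp_updateDuals (hW : s.nat 33 0 + 1 ≤ W)
    (hinj : ∀ j ≤ s.nat 33 0, ∀ j' ≤ s.nat 33 0, s.nat 37 j ≠ 0 → s.nat 37 j' ≠ 0 →
      s.nat 36 j = s.nat 36 j' → j = j') :
    Wp D W updateDuals s fun s' t => t ≤ 80 * (s.nat 33 0 + 1) ∧
      (∀ j ≤ s.nat 33 0, s.nat 37 j ≠ 0 →
        s'.real 3 (s.nat 36 j) = s.real 3 (s.nat 36 j) + s.real 5 (s.nat 41 0)) ∧
      (∀ r, (∀ j ≤ s.nat 33 0, s.nat 37 j ≠ 0 → s.nat 36 j ≠ r) → s'.real 3 r = s.real 3 r) ∧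
      (∀ j ≤ s.nat 33 0, s.nat 37 j ≠ 0 → s'.real 4 j = s.real 4 j - s.real 5 (s.nat 41 0)) ∧
      (∀ j ≤ s.nat 33 0, s.nat 37 j = 0 → s'.real 4 j = s.real 4 j) ∧
      (∀ j ≤ s.nat 33 0, s.nat 37 j = 0 → s'.real 5 j = s.real 5 j - s.real 5 (s.nat 41 0)) := by
  refine Wp.seq (Wp.setReal ?_)
  simp only [NatExpr.eval, NatExpr.steps, RealExpr.eval, RealExpr.steps]
  set δ := s.real 5 (s.nat 41 0) with hδ
  set s₁ := s.writeReal 8 0 δ with hs₁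
  have h33 : s₁.nat 33 = s.nat 33 := by simp [hs₁]
  have h36 : s₁.nat 36 = s.nat 36 := by simp [hs₁]
  have h37 : s₁.nat 37 = s.nat 37 := by simp [hs₁]
  have h8 : s₁.real 8 0 = δ := by simp [hs₁]
  refine (Wp.range (fun i s' =>
      (∀ j < i, s.nat 37 j ≠ 0 → s'.real 3 (s.nat 36 j) = s.real 3 (s.nat 36 j) + δ) ∧
      (∀ r, (∀ j < i, s.nat 37 j ≠ 0 → s.nat 36 j ≠ r) → s'.real 3 r = s.real 3 r) ∧
      (∀ j < i, s.nat 37 j ≠ 0 → s'.real 4 j = s.real 4 j - δ) ∧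
      (∀ j, i ≤ j ∨ s.nat 37 j = 0 → s'.real 4 j = s.real 4 j) ∧
      (∀ j < i, s.nat 37 j = 0 → s'.real 5 j = s.real 5 j - δ) ∧
      (∀ j, i ≤ j → s'.real 5 j = s.real 5 j))
    (N := s.nat 33 0 + 1) 50 (by omega) hW (by simp [hs₁]) ?_ ?_).mono ?_
  · intro s' hf
    simp [hf.nat_eq 33, h33]
  · rintro i s' hf hi - h2 ⟨hI1, hI2, hI3, hI4, hI5, hI6⟩
    have h8' : s'.real 8 0 = δ := by rw [hf.real_eq 8, h8]
    refine Wp.ite (fun hb => ?_) (fun hb => ?_)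
    · simp only [Test.Holds, NatExpr.eval, hi, hf.nat_eq 37, h37] at hb
      refine Wp.setReal ⟨by simp, by simpa using hi, ?_⟩
      simp only [NatExpr.eval, RealExpr.eval, hi, h8']
      simp only [ne_eq, Nat.reduceEqDiff, not_false_eq_true,
        State.writeNat_real, State.writeReal_real_self, State.writeReal_real_of_ne]
      refine ⟨fun j hj hj' => hI1 j ?_ hj', fun r hr => hI2 r fun j hj => hr j (by omega),
        fun j hj hj' => hI3 j ?_ hj', fun j hj => hI4 j (by omega), fun j hj hj' => ?_,
        fun j hj => ?_⟩
      · have : j ≠ i := by rintro rfl; exact hj' hb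
        omega
      · have : j ≠ i := by rintro rfl; exact hj' hb
        omega
      · rcases eq_or_ne j i with rfl | h
        · simp [hI6]
        · rw [Function.update_of_ne h]
          exact hI5 j (by omega) hj'
      · rw [Function.update_of_ne (by omega)]
        exact hI6 j (by omega)
    · simp only [Test.Holds, NatExpr.eval, hi, hf.nat_eq 37, h37] at hb
      refine Wp.seq (Wp.setReal (Wp.setReal ⟨by simp, by simpa using hi, ?_⟩))
      simp only [NatExpr.eval, RealExpr.eval, hi, h8', hf.nat_eq 36, h36]
      simp only [ne_eq, Nat.reduceEqDiff, not_false_eq_true,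
        State.writeNat_real, State.writeReal_real_self, State.writeReal_real_of_ne,
        State.writeReal_nat, hi, h8']
      refine ⟨fun j hj hj' => ?_, fun r hr => ?_, fun j hj hj' => ?_, fun j hj => ?_,
        fun j hj hj' => hI5 j ?_ hj', fun j hj => hI6 j (by omega)⟩
      · rcases eq_or_ne j i with rfl | h
        · rw [Function.update_self, hI2]
          intro j' hj1 hj2 hj3
          have := hinj j' (by omega) j (by omega) hj2 hj' hj3
          omega
        · rw [Function.update_of_ne fun h' => h (hinj j (by omega) i (by omega) hj' hb h')]
          exact hI1 j (by omega) hj'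
      · rw [Function.update_of_ne (Ne.symm (hr i (by omega) hb))]
        exact hI2 r fun j hj => hr j (by omega)
      · rcases eq_or_ne j i with rfl | h
        · simp [hI4]
        · rw [Function.update_of_ne h]
          exact hI3 j (by omega) hj'
      · have : j ≠ i := by
          rintro rfl
          rcases hj with hj | hj
          · omega
          · exact hb hj
        rw [Function.update_of_ne this]
        exact hI4 j (by omega)
      · have : j ≠ i := by rintro rfl; exact hb hj'
        omega
  · rintro s' t hf ⟨ht, h1, h2, h3, h4, h5, -⟩
    simp at ht
    exact ⟨by omega, fun j hj => h1 j (by omega), fun r hr => h2 r fun j hj => hr j (by omega),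
      fun j hj => h3 j (by omega), fun j hj hj' => h4 j (Or.inr hj'), fun j hj => h5 j (by omega)⟩

end RAM


/-! ### Correctness of the search, the augmentation and the whole Hungarian algorithm -/

namespace RAM

open Hungarian

variable {L : Type*} {D : CostInput L} {W : ℕ} {s : State}

/-- One round is `Search.relax`, the choice of a least slack, and `AlternatingTree.update`, each in
time linear in `m`. The counter in cell `44` increases, which is the progress measure of the search.
-/
theorem wp_growTree {a : ℕ → ℕ → ℝ} {k m i : ℕ}
    (h : Search a k m i (s.real 3) (s.real 4) (s.nat 36) (s.nat 37) (s.nat 38) (s.real 5)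
      (s.nat 44 0) (s.nat 40 0))
    (hp : s.nat 36 (s.nat 40 0) ≠ 0) (ha : ∀ r j, a r j = s.real 1 (s.nat 34 r + s.nat 35 j))
    (ha₀ : ∀ r, 1 ≤ r → r ≤ k → ∀ j, 1 ≤ j → j ≤ m → a r j ≤ 0) (hik : i ≤ k) (hkm : k ≤ m)
    (hm : s.nat 33 0 = m) (hW : m + 2 ≤ W) :
    Wp D W growTree s fun s' t => t ≤ 300 * (m + 1) ∧
      Search a k m i (s'.real 3) (s'.real 4) (s'.nat 36) (s'.nat 37) (s'.nat 38) (s'.real 5)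
        (s'.nat 44 0) (s'.nat 40 0) ∧
      s'.nat 44 0 = s.nat 44 0 + 1 := by
  have hc := h.count_le
  have hpi := h.invariant.le _ h.le (by have := h.le; omega)
  refine Wp.seq (Wp.setNat (by simp; omega) (Wp.seq (Wp.setNat (by simp; omega)
    (Wp.seq (Wp.setNat (by simp; omega) ?_)))))
  simp only [NatExpr.eval, NatExpr.steps]
  set s₁ := State.writeNat _ 43 0 _ with hs₁
  have e36 : s₁.nat 36 = s.nat 36 := by simp [hs₁]
  have e37 : s₁.nat 37 = Function.update (s.nat 37) (s.nat 40 0) (s.nat 44 0) := by simp [hs₁]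
  have e38 : s₁.nat 38 = s.nat 38 := by simp [hs₁]
  have e40 : s₁.nat 40 = s.nat 40 := by simp [hs₁]
  have e43 : s₁.nat 43 0 = s.nat 36 (s.nat 40 0) := by simp [hs₁]
  have e44 : s₁.nat 44 0 = s.nat 44 0 + 1 := by simp [hs₁]
  have e33 : s₁.nat 33 0 = m := by simp [hs₁, hm]
  have er : s₁.real = s.real := by simp [hs₁]
  refine Wp.seq ((wp_relaxCols (by omega) (by rw [e40]; have := h.le; omega)
    (cur := fun j => a (s.nat 36 (s.nat 40 0)) j - s.real 3 (s.nat 36 (s.nat 40 0)) - s.real 4 j)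
    ?_).mono ?_)
  · intro j
    simp [ha, hs₁]
  rintro s₂ t₂ hf₂ ⟨ht₂, h₂⟩
  rw [e33] at ht₂
  rw [e33, e37, e38, e40, er] at h₂
  obtain ⟨hT, hF⟩ := h.relax hp (way' := s₂.nat 38) (minv' := s₂.real 5)
    (fun j hj hjm => (h₂ j hj hjm).1) (fun j hj hjm => (h₂ j hj hjm).2.1)
    (fun j hj hjm => (h₂ j hj hjm).2.2)
  have f33 : s₂.nat 33 0 = m := by rw [hf₂.nat_eq 33, e33]
  have f36 : s₂.nat 36 = s.nat 36 := by rw [hf₂.nat_eq 36, e36]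
  have f37 := (hf₂.nat_eq 37).trans e37
  have f44 := (congrFun (hf₂.nat_eq 44) 0).trans e44
  have f3 : s₂.real 3 = s.real 3 := by rw [hf₂.real_eq 3, er]
  have f4 : s₂.real 4 = s.real 4 := by rw [hf₂.real_eq 4, er]
  rw [← f36, ← f37, ← f3, ← f4] at hT hF
  refine Wp.seq ((wp_selectCol (by omega) (by rw [f33]; exact hT.exists_unused (by omega))).mono ?_)
  rintro s₃ t₃ hf₃ ⟨ht₃, h₃, h₃', h₃u, h₃min⟩
  rw [f33] at ht₃ h₃' h₃min
  rw [← hf₃.nat_eq 36, ← hf₃.nat_eq 37, ← hf₃.nat_eq 38, ← hf₃.real_eq 3, ← hf₃.real_eq 4]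
    at hT hF
  rw [← hf₃.real_eq 5] at hF
  rw [← hf₃.nat_eq 37] at h₃u h₃min
  rw [← hf₃.real_eq 5] at h₃min
  have g33 : s₃.nat 33 0 = m := by rw [hf₃.nat_eq 33, f33]
  have g44 : s₃.nat 44 0 = s.nat 44 0 + 1 := by rw [hf₃.nat_eq 44, f44]
  refine Wp.seq ((wp_updateDuals (by omega) ?_).mono ?_)
  · rw [g33]
    intro j hj j' hj' h1 h2 h3
    exact hT.invariant.inj j hj (by omega) j' hj' (by omega) h3 (hT.matched j hj h1)
  rintro s₄ t₄ hf₄ ⟨ht₄, h1, h2, h3, h4, h5⟩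
  rw [g33] at ht₄ h1 h2 h3 h4 h5
  have := hT.update hF (by omega) ha₀ h₃ h₃' h₃u h₃min hik h1 h2 h3 h4 h5
  rw [← hf₄.nat_eq 36, ← hf₄.nat_eq 37, ← hf₄.nat_eq 38] at this
  refine Wp.setNat (by simp [hf₄.nat_eq 41]; omega) ⟨?_, ?_, ?_⟩
  · simp
    omega
  · simpa [hf₄.nat_eq 44, g44, hf₄.nat_eq 41] using this
  · simp [hf₄.nat_eq 44, g44]

/-- The discovery number `ρ` bounds the remaining rounds. When column `0` is reached, it is the
ignored column, and the invariant is that of a complete stage. -/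
theorem wp_augmentPath {a : ℕ → ℕ → ℝ} {k m i ρ : ℕ}
    (h : Augment a k m i (s.real 3) (s.real 4) (s.nat 36) (s.nat 37) (s.nat 38) ρ (s.nat 40 0))
    (him : i ≤ m) (hW : m ≤ W) :
    Wp D W augmentPath s fun s' t => t ≤ 30 * (ρ + 1) ∧
      Invariant a k m i 0 (s'.real 3) (s'.real 4) (s'.nat 36) := by
  refine (Wp.loop (fun n s' => ∃ ρ', n = 30 * (ρ' + 1) ∧ Augment a k m i (s'.real 3) (s'.real 4)
    (s'.nat 36) (s'.nat 37) (s'.nat 38) ρ' (s'.nat 40 0)) ⟨ρ, rfl, h⟩ ?_ ?_).mono ?_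
  · rintro n s' - ⟨ρ', rfl, h'⟩ -
    simp
    omega
  · rintro n s' - ⟨ρ', rfl, h'⟩ hb
    simp only [Test.Holds, NatExpr.eval] at hb
    obtain ⟨h1, h2⟩ := h'.step hb
    have h3 := (h'.way_spec _ (by omega) h'.le (Or.inl rfl)).1
    have h4 : s'.nat 36 (s'.nat 38 (s'.nat 40 0)) ≤ i := by
      refine h'.invariant.le _ h3 fun h5 => ?_
      have h6 := (h'.way_spec _ (by omega) h'.le (Or.inl rfl)).2
      rw [h5] at h6
      rcases h'.used_eq with h7 | h7 <;> omega
    refine Wp.seq (Wp.setNat (by simp; omega) (Wp.seq (Wp.setNat (by simp; omega)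
      (Wp.setNat (by simp; omega) ⟨30 * (s'.nat 37 (s'.nat 38 (s'.nat 40 0)) + 1), ⟨_, rfl, ?_⟩,
        ?_⟩))))
    · simpa using h2
    · simp
      omega
  · rintro s' t - ⟨ht, hb, n, ρ', -, h'⟩
    simp only [Test.Holds, NatExpr.eval, not_not] at hb
    exact ⟨ht, hb ▸ h'.invariant⟩

theorem wp_matchRow {a : ℕ → ℕ → ℝ} {k m i : ℕ}
    (h : Invariant a k m i 0 (s.real 3) (s.real 4) (s.nat 36))
    (ha : ∀ r j, a r j = s.real 1 (s.nat 34 r + s.nat 35 j))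
    (ha₀ : ∀ r, 1 ≤ r → r ≤ k → ∀ j, 1 ≤ j → j ≤ m → a r j ≤ 0) (hik : i + 1 ≤ k) (hkm : k ≤ m)
    (hm : s.nat 33 0 = m) (hi : s.nat 39 0 = i + 1) (hW : m + 2 ≤ W) :
    Wp D W matchRow s fun s' t => t ≤ 400 * (k + 2) * (m + 1) ∧
      Invariant a k m (i + 1) 0 (s'.real 3) (s'.real 4) (s'.nat 36) := by
  refine Wp.seq (Wp.setNat (by simp; omega) (Wp.seq ((wp_clearUsed (by simp; omega)).mono ?_)))
  rintro s₁ t₁ hf₁ ⟨ht₁, hu⟩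
  simp only [ne_eq, Nat.reduceEqDiff, not_false_eq_true, NatExpr.eval, hi,
    State.writeNat_nat_of_ne, hm] at ht₁ hu
  refine Wp.seq (Wp.setNat (by simp) (Wp.seq (Wp.setNat (by simp; omega) (Wp.seq ?_))))
  simp only [NatExpr.eval, NatExpr.steps]
  set s₂ := State.writeNat _ 44 0 _ with hs₂
  have hS : Search a k m (i + 1) (s₂.real 3) (s₂.real 4) (s₂.nat 36) (s₂.nat 37) (s₂.nat 38)
      (s₂.real 5) (s₂.nat 44 0) (s₂.nat 40 0) := by
    have := h.search (way := s₁.nat 38) (minv := s₁.real 5) hu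
    simpa [hs₂, hf₁.nat_eq 36, hf₁.real_eq 3, hf₁.real_eq 4, hi] using this
  have ha₂ : ∀ r j, a r j = s₂.real 1 (s₂.nat 34 r + s₂.nat 35 j) := by
    intro r j
    simp [ha, hs₂, hf₁.nat_eq 34, hf₁.nat_eq 35, hf₁.real_eq 1]
  have hm₂ : s₂.nat 33 0 = m := by simp [hs₂, hf₁.nat_eq 33, hm]
  have h44 : s₂.nat 44 0 = 1 := by simp [hs₂]
  -- By `count_le` for `i + 1` rows the discovery counter never exceeds `i + 2`, so this difference
  -- bounds the remaining rounds.
  refine (Wp.loop (fun n s' => Search a k m (i + 1) (s'.real 3) (s'.real 4) (s'.nat 36)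
    (s'.nat 37) (s'.nat 38) (s'.real 5) (s'.nat 44 0) (s'.nat 40 0) ∧
    n = (i + 2 - s'.nat 44 0) * (300 * (m + 1) + 10) + 10) ⟨hS, rfl⟩ ?_ ?_).mono ?_
  · rintro n s' - ⟨-, rfl⟩ -
    simp
  · rintro n s' hf ⟨hS', rfl⟩ hb
    simp only [Test.Holds, NatExpr.eval] at hb
    refine (wp_growTree hS' hb (fun r j => ?_) ha₀ hik hkm ?_ hW).mono ?_
    · rw [ha₂, hf.real_eq 1, hf.nat_eq 34, hf.nat_eq 35]
    · rw [hf.nat_eq 33, hm₂]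
    · rintro s'' t - ⟨ht, hS'', hc⟩
      refine ⟨_, ⟨hS'', rfl⟩, ?_⟩
      have := hS''.count_le
      obtain ⟨e, he⟩ : ∃ e, i + 2 - s'.nat 44 0 = e + 1 := ⟨i + 1 - s'.nat 44 0, by omega⟩
      rw [he, show i + 2 - s''.nat 44 0 = e by omega, add_mul]
      simp
      omega
  · rintro s₃ t₃ hf₃ ⟨ht₃, hb, n, hS₃, -⟩
    simp only [Test.Holds, NatExpr.eval, not_not] at hb
    refine (wp_augmentPath (hS₃.augment hb) (by omega) (by omega)).mono ?_
    rintro s₄ t₄ - ⟨ht₄, h₄⟩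
    refine ⟨?_, h₄⟩
    have h5 := hS₃.count_le
    have h6 : (i + 2 - s₂.nat 44 0) * (300 * (m + 1) + 10) ≤ k * (300 * (m + 1) + 10) :=
      Nat.mul_le_mul_right _ (by omega)
    have h7 : k ≤ k * (m + 1) := Nat.le_mul_of_pos_right _ (by omega)
    have h8 : k * (300 * (m + 1) + 10) = 300 * (k * (m + 1)) + 10 * k := by ring
    have h9 : 400 * (k + 2) * (m + 1) = 400 * (k * (m + 1)) + 800 * (m + 1) := by ring
    simp at ht₃ ⊢
    omega

theorem wp_sumDuals (hk : s.nat 32 0 + 1 ≤ W) (hm : s.nat 33 0 + 1 ≤ W) :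
    Wp D W sumDuals s fun s' t => t ≤ 30 * (s.nat 32 0 + s.nat 33 0 + 2) ∧
      s'.real 7 0 = ∑ r ∈ Finset.Icc 1 (s.nat 32 0), s.real 3 r +
        ∑ j ∈ Finset.Icc 1 (s.nat 33 0), s.real 4 j := by
  refine Wp.seq (Wp.setReal (Wp.seq ?_))
  simp only [NatExpr.eval, NatExpr.steps, RealExpr.eval, RealExpr.steps]
  set s₁ := s.writeReal 7 0 0 with hs₁
  refine (Wp.range (fun i s' => s'.real 7 0 = ∑ r ∈ Finset.Ico 1 i, s.real 3 r)
    (N := s.nat 32 0 + 1) 10 (by omega) hk (by simp [hs₁]) ?_ ?_).mono ?_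
  · intro s' hf
    simp [hf.nat_eq 32, hs₁]
  · intro i s' hf hi h1 h2 hI
    refine Wp.setReal ⟨by simp, by simp [hi], ?_⟩
    simp [hi, hI, hf.real_eq 3, Finset.sum_Ico_succ_top h1, hs₁]
  rintro s₂ t₂ hf₂ ⟨ht₂, h₂⟩
  refine (Wp.range (fun i s' => s'.real 7 0 = ∑ r ∈ Finset.Icc 1 (s.nat 32 0), s.real 3 r +
      ∑ j ∈ Finset.Ico 1 i, s.real 4 j)
    (N := s.nat 33 0 + 1) 10 (by omega) hm (by simp [h₂]; rfl) ?_ ?_).mono ?_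
  · intro s' hf
    simp [hf.nat_eq 33, hf₂.nat_eq 33, hs₁]
  · intro i s' hf hi h1 h2 hI
    refine Wp.setReal ⟨by simp, by simp [hi], ?_⟩
    simp [hi, hI, hf.real_eq 4, hf₂.real_eq 4, Finset.sum_Ico_succ_top h1, hs₁, add_assoc]
  rintro s₃ t₃ hf₃ ⟨ht₃, h₃⟩
  refine ⟨?_, h₃⟩
  simp at ht₂ ht₃
  omega

/-- The Hungarian algorithm computes minimum weight matchings. -/
theorem wp_hungarian {w : ℕ → ℕ → ℝ} {k m : ℕ} (hk : s.nat 32 0 = k) (hm : s.nat 33 0 = m)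
    (hkm : k ≤ m) (hW : m + 2 ≤ W) (hB : s.real 2 0 ≤ 0)
    (ha : ∀ r, 1 ≤ r → r ≤ k → ∀ j, 1 ≤ j → j ≤ m →
      s.real 1 (s.nat 34 r + s.nat 35 j) = min (w r j) 0 ∧
      s.real 2 0 ≤ s.real 1 (s.nat 34 r + s.nat 35 j)) :
    Wp D W hungarian s fun s' t => t ≤ 3000 * (k * (k * m) + m + 1) ∧
      s'.real 7 0 = minMatching (Finset.Icc 1 k) (Finset.Icc 1 m) w := by
  set a : ℕ → ℕ → ℝ := fun r j => s.real 1 (s.nat 34 r + s.nat 35 j) with ha'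
  have ha₀ : ∀ r, 1 ≤ r → r ≤ k → ∀ j, 1 ≤ j → j ≤ m → a r j ≤ 0 := by
    intro r hr hrk j hj hjm
    rw [ha']
    simp only
    rw [(ha r hr hrk j hj hjm).1]
    exact min_le_right _ _
  refine Wp.seq ((wp_initRows (by omega)).mono ?_)
  rintro s₁ t₁ hf₁ ⟨ht₁, h₁⟩
  refine Wp.seq ((wp_initCols (by rw [hf₁.nat_eq 33]; omega)).mono ?_)
  rintro s₂ t₂ hf₂ ⟨ht₂, h₂⟩
  rw [hf₁.nat_eq 33, hm] at h₂ ht₂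
  rw [hk] at h₁ ht₁
  rw [← hf₂.real_eq 3] at h₁
  have hI := Invariant.initial (a := a) h₁ (fun j hj hjm => (h₂ j hj hjm).1)
    (fun j hj hjm => (h₂ j hj hjm).2) hB fun r hr hrk j hj hjm => (ha r hr hrk j hj hjm).2
  have h32 : s₂.nat 32 0 = k := by rw [hf₂.nat_eq 32, hf₁.nat_eq 32, hk]
  have h33 : s₂.nat 33 0 = m := by rw [hf₂.nat_eq 33, hf₁.nat_eq 33, hm]
  -- Rows are numbered from `1`: when the counter is `i`, the rows up to `i - 1` are matched.
  refine Wp.seq ((Wp.range (fun i s' => Invariant a k m (i - 1) 0 (s'.real 3) (s'.real 4)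
    (s'.nat 36)) (N := k + 1) (400 * (k + 2) * (m + 1)) (by omega) (by omega) (by simpa using hI)
    ?_ ?_).mono ?_)
  · intro s' hf
    simp [hf.nat_eq 32, h32]
  · intro i s' hf hi h1 h2 h3
    refine (wp_matchRow h3 (fun r j => ?_) ha₀ (by omega) hkm ?_ (by omega) hW).mono ?_
    · rw [ha', hf.nat_eq 34, hf.nat_eq 35, hf.real_eq 1, hf₂.nat_eq 34, hf₂.nat_eq 35,
        hf₂.real_eq 1, hf₁.nat_eq 34, hf₁.nat_eq 35, hf₁.real_eq 1]
    · rw [hf.nat_eq 33, h33]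
    · rintro s'' t hf' ⟨ht, h4⟩
      refine ⟨ht, by rw [hf'.nat_eq 39, hi], ?_⟩
      rw [show i - 1 + 1 = i + 1 - 1 by omega] at h4
      simpa using h4
  rintro s₃ t₃ hf₃ ⟨ht₃, h₃⟩
  rw [Nat.add_sub_cancel] at h₃
  have g32 : s₃.nat 32 0 = k := by rw [hf₃.nat_eq 32, h32]
  have g33 : s₃.nat 33 0 = m := by rw [hf₃.nat_eq 33, h33]
  refine (wp_sumDuals (by omega) (by omega)).mono ?_
  rintro s₄ t₄ - ⟨ht₄, h₄⟩
  rw [g32, g33] at ht₄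
  rw [h₄, g32, g33, h₃.minMatching_eq fun r hr hrk j hj hjm => (ha r hr hrk j hj hjm).1]
  refine ⟨?_, rfl⟩
  -- Without rows the main loop costs nothing here; otherwise `1 ≤ k ≤ m`, and all lower-order terms
  -- are absorbed by `k²m`.
  have h5 : k * (400 * (k + 2) * (m + 1) + 4 + 10) ≤ 2500 * (k * (k * m)) := by
    rcases Nat.eq_zero_or_pos k with rfl | hk0
    · simp
    · have h6 : k + 2 ≤ 3 * k := by omega
      have h7 : m + 1 ≤ 2 * m := by omega
      have h8 : (k + 2) * (m + 1) ≤ 3 * k * (2 * m) := Nat.mul_le_mul h6 h7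
      have h9 : 1 ≤ k * m := Nat.mul_pos hk0 (by omega)
      calc k * (400 * (k + 2) * (m + 1) + 4 + 10)
          = k * (400 * ((k + 2) * (m + 1)) + 14) := by ring
        _ ≤ k * (400 * (3 * k * (2 * m)) + 14 * (k * m)) := by gcongr; omega
        _ ≤ 2500 * (k * (k * m)) := by ring_nf; omega
  simp at ht₃
  omega

end RAM

/-! ## The recursion for the tree edit distance -/

namespace LabeledRootedTree

variable {V L : Type*} (T : LabeledRootedTree V L)

theorem parent_spec {v : V} (hv : v ≠ T.root) :
    T.graph.Adj v (T.parent v) ∧ T.graph.dist T.root (T.parent v) < T.graph.dist T.root v := by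
  rw [parent, dif_neg hv]
  exact (T.existsUnique_parent hv).choose_spec.1

open Classical in
/-- The children of a vertex. -/
noncomputable def children [Fintype V] (u : V) : Finset V :=
  Finset.univ.filter fun v => v ≠ T.root ∧ T.parent v = u

variable [Fintype V]

@[simp] theorem mem_children {u v : V} : v ∈ T.children u ↔ v ≠ T.root ∧ T.parent v = u := by
  simp [children]

theorem card_children_le (u : V) : (T.children u).card ≤ T.maxDegree := by
  classical
  refine le_trans ?_ (T.graph.degree_le_maxDegree u)
  rw [← SimpleGraph.card_neighborFinset_eq_degree]
  refine Finset.card_le_card fun v hv => ?_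
  rw [mem_children] at hv
  rw [SimpleGraph.mem_neighborFinset, ← hv.2]
  exact (T.parent_spec hv.1).1.symm

/-- Sets of children of different vertices are disjoint. -/
theorem sum_card_children_le : ∑ u, (T.children u).card ≤ Fintype.card V := by
  classical
  rw [← Finset.card_biUnion]
  · exact Finset.card_le_univ _
  · intro u _ u' _ hne
    refine Finset.disjoint_left.2 fun v h1 h2 => hne ?_
    rw [mem_children] at h1 h2
    rw [← h1.2, ← h2.2]

end LabeledRootedTree

/-- Closure under parents is demanded only if neither component is a root. Since the roots occur
only together, it applies to every pair except the root pair. -/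
theorem IsSDMapping.fst_eq_root_iff {V V' L : Type*}
    {T : LabeledRootedTree V L} {T' : LabeledRootedTree V' L} {M : Finset (V × V')}
    (h : IsSDMapping T T' M) {p : V × V'} (hp : p ∈ M) : p.1 = T.root ↔ p.2 = T'.root :=
  h.eq_iff_eq p hp _ h.root_mem

section recursion

variable {V V' L : Type*} (T : LabeledRootedTree V L) (T' : LabeledRootedTree V' L)
  [Fintype V'] [Fintype V]

/-- `minMatching` over the children defines a function by recursion on the depth. -/
theorem exists_eq_add_minMatching (g : V → V' → ℝ) :
    ∃ G : V → V' → ℝ, ∀ u v, G u v = g u v + minMatching (T.children u) (T'.children v) G := by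
  -- Iterating the recursion from zero stabilizes from the leaves upwards: all distances are below
  -- `N`, and `F n` is final at `u` as soon as `n` reaches `N` minus the depth of `u`.
  let F : ℕ → V → V' → ℝ := fun n => n.rec (fun _ _ => 0)
    fun _ F u v => g u v + minMatching (T.children u) (T'.children v) F
  obtain ⟨N, hN⟩ : ∃ N, ∀ u, T.graph.dist T.root u < N :=
    ⟨Finset.univ.sup (T.graph.dist T.root) + 1, fun u =>
      Nat.lt_succ_of_le (Finset.le_sup (f := T.graph.dist T.root) (Finset.mem_univ u))⟩
  have key : ∀ n u v, N - T.graph.dist T.root u ≤ n → F (n + 1) u v = F n u v := by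
    intro n
    induction n with
    | zero =>
      intro u v h
      have := hN u
      omega
    | succ n ih =>
      intro u v h
      change g u v + minMatching _ _ (F (n + 1)) = g u v + minMatching _ _ (F n)
      congr 1
      refine minMatching_congr fun u' hu' v' _ => ih u' v' ?_
      rw [LabeledRootedTree.mem_children] at hu'
      have := (T.parent_spec hu'.1).2
      rw [hu'.2] at this
      omega
  exact ⟨F N, fun u v => (key N u v (Nat.sub_le _ _)).symm⟩

/-- The pairs that are reached from a pair by repeatedly applying `N`. -/
inductive Reach {α β : Type*} (root : α × β) (N : α → β → Finset (α × β)) : α × β → Prop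
  | root : Reach root N root
  | step {q r : α × β} : Reach root N q → r ∈ N q.1 q.2 → Reach root N r

variable {T T'}

/-- Both projections are injective on `M`, so deletions and insertions outside of `M` are the totals
minus sums over `M`. -/
theorem IsSDMapping.mappingCost_eq [DecidableEq V] [DecidableEq V'] {M : Finset (V × V')}
    (h : IsSDMapping T T' M) (c : Option L → Option L → ℝ) :
    mappingCost c T T' M =
      ∑ u, c (some (T.label u)) none + ∑ v, c none (some (T'.label v)) +
      ∑ p ∈ M, (c (some (T.label p.1)) (some (T'.label p.2)) - c (some (T.label p.1)) none -
        c none (some (T'.label p.2))) := by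
  have h1 := Finset.sum_sdiff (f := fun u => c (some (T.label u)) none)
    (Finset.subset_univ (M.image Prod.fst))
  have h2 := Finset.sum_sdiff (f := fun v => c none (some (T'.label v)))
    (Finset.subset_univ (M.image Prod.snd))
  rw [Finset.sum_image fun p hp q hq hpq => Prod.ext hpq ((h.eq_iff_eq p hp q hq).1 hpq)] at h1
  rw [Finset.sum_image fun p hp q hq hpq => Prod.ext ((h.eq_iff_eq p hp q hq).2 hpq) hpq] at h2
  rw [mappingCost, ← h1, ← h2, Finset.sum_sub_distrib, Finset.sum_sub_distrib]
  ring

/-- The pairs of `M` with a given parent pair form a matching between children, whose weight is at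
least the minimum. In the sum over `M` every pair except the root pair occurs once below its parent,
so all values of `G` cancel except the one at the roots. -/
theorem IsSDMapping.sum_ge {M : Finset (V × V')} (h : IsSDMapping T T' M) {g G : V → V' → ℝ}
    (hG : ∀ u v, G u v = g u v + minMatching (T.children u) (T'.children v) G) :
    G T.root T'.root ≤ ∑ p ∈ M, g p.1 p.2 := by
  classical
  have h1 : ∑ p ∈ M, g p.1 p.2 = ∑ p ∈ M, G p.1 p.2 -
      ∑ p ∈ M, minMatching (T.children p.1) (T'.children p.2) G := by
    rw [← Finset.sum_sub_distrib]
    exact Finset.sum_congr rfl fun p _ => by rw [hG p.1 p.2]; ring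
  have h2 : ∑ p ∈ M, minMatching (T.children p.1) (T'.children p.2) G ≤
      ∑ p ∈ M, ∑ q ∈ (M.erase (T.root, T'.root)).filter
        (fun q => (T.parent q.1, T'.parent q.2) = p), G q.1 q.2 := by
    refine Finset.sum_le_sum fun p _ => (isLeast_minMatching _ _ G).2 ⟨_, ⟨?_, ?_, ?_⟩, rfl⟩
    · rintro q hq
      simp only [Finset.mem_filter, Finset.mem_erase] at hq
      rw [LabeledRootedTree.mem_children]
      refine ⟨fun h0 => hq.1.1 (Prod.ext h0 ((h.fst_eq_root_iff hq.1.2).1 h0)), ?_⟩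
      rw [← hq.2]
    · rintro q hq
      simp only [Finset.mem_filter, Finset.mem_erase] at hq
      rw [LabeledRootedTree.mem_children]
      refine ⟨fun h0 => hq.1.1 (Prod.ext ((h.fst_eq_root_iff hq.1.2).2 h0) h0), ?_⟩
      rw [← hq.2]
    · rintro q hq q' hq'
      simp only [Finset.mem_filter, Finset.mem_erase] at hq hq'
      exact h.eq_iff_eq q hq.1.2 q' hq'.1.2
  rw [Finset.sum_fiberwise_of_maps_to] at h2
  · have h3 := Finset.add_sum_erase M (fun q => G q.1 q.2) h.root_mem
    simp only at h3
    linarith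
  · intro q hq
    rw [Finset.mem_erase] at hq
    exact h.parent_mem q hq.2
      (fun h0 => hq.1 (Prod.ext h0 ((h.fst_eq_root_iff hq.2).1 h0)))
      (fun h0 => hq.1 (Prod.ext ((h.fst_eq_root_iff hq.2).2 h0) h0))

/-- Fix an optimal matching for every pair and collect the pairs reached from the root pair. Below
each of them lie precisely the pairs of its matching, so the estimate of `IsSDMapping.sum_ge`
becomes an equality. -/
theorem exists_isSDMapping_sum_eq {g G : V → V' → ℝ}
    (hG : ∀ u v, G u v = g u v + minMatching (T.children u) (T'.children v) G) :
    ∃ M : Finset (V × V'), IsSDMapping T T' M ∧ ∑ p ∈ M, g p.1 p.2 = G T.root T'.root := by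
  classical
  choose N hN hNsum using fun u v => (isLeast_minMatching (T.children u) (T'.children v) G).1
  have hstep : ∀ q r : V × V', r ∈ N q.1 q.2 →
      r.1 ≠ T.root ∧ r.2 ≠ T'.root ∧ (T.parent r.1, T'.parent r.2) = q := by
    intro q r hr
    have h1 := (hN q.1 q.2).fst_mem r hr
    have h2 := (hN q.1 q.2).snd_mem r hr
    rw [LabeledRootedTree.mem_children] at h1 h2
    exact ⟨h1.1, h2.1, Prod.ext h1.2 h2.2⟩
  -- If two reached pairs agree in one component, so do their parent pairs. By induction the parent
  -- pairs are equal, and both pairs lie in the same matching.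
  have hinj : ∀ p, Reach (T.root, T'.root) N p → ∀ q, Reach (T.root, T'.root) N q →
      (p.1 = q.1 ↔ p.2 = q.2) := by
    intro p hp
    induction hp with
    | root =>
      rintro q (_ | ⟨hq₀, hq⟩)
      · simp
      · obtain ⟨h1, h2, -⟩ := hstep _ _ hq
        simp [h1.symm, h2.symm]
    | @step p₀ p hp₀ hp ih =>
      obtain ⟨h1, h2, h3⟩ := hstep _ _ hp
      intro q hq
      cases hq with
      | root => simp [h1, h2]
      | @step q₀ _ hq₀ hq =>
        obtain ⟨h4, h5, h6⟩ := hstep _ _ hq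
        have h7 := ih q₀ hq₀
        rw [← h3, ← h6] at h7
        simp only at h7
        constructor
        · intro h8
          have h9 : p₀ = q₀ := by
            rw [← h3, ← h6, Prod.ext_iff]
            exact ⟨congrArg T.parent h8, h7.1 (congrArg T.parent h8)⟩
          subst h9
          exact ((hN _ _).eq_iff_eq p hp q hq).1 h8
        · intro h8
          have h9 : p₀ = q₀ := by
            rw [← h3, ← h6, Prod.ext_iff]
            exact ⟨h7.2 (congrArg T'.parent h8), congrArg T'.parent h8⟩
          subst h9
          exact ((hN _ _).eq_iff_eq p hp q hq).2 h8
  set M := Finset.univ.filter (Reach (T.root, T'.root) N) with hM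
  have hmem : ∀ p, p ∈ M ↔ Reach (T.root, T'.root) N p := by simp [hM]
  have hroot : (T.root, T'.root) ∈ M := (hmem _).2 .root
  have hfib : ∀ q ∈ M, (M.erase (T.root, T'.root)).filter
      (fun r => (T.parent r.1, T'.parent r.2) = q) = N q.1 q.2 := by
    intro q hq
    ext r
    simp only [Finset.mem_filter, Finset.mem_erase, hmem]
    constructor
    · rintro ⟨⟨h1, h2⟩, h3⟩
      cases h2 with
      | root => exact absurd rfl h1
      | @step q' _ hq' hr =>
        rw [(hstep _ _ hr).2.2] at h3
        rwa [← h3]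
    · intro hr
      obtain ⟨h1, -, h2⟩ := hstep _ _ hr
      exact ⟨⟨fun h => h1 (congrArg Prod.fst h), .step ((hmem q).1 hq) hr⟩, h2⟩
  have hpar : ∀ r ∈ M, r ≠ (T.root, T'.root) → (T.parent r.1, T'.parent r.2) ∈ M := by
    intro r hr h1
    rw [hmem] at hr ⊢
    cases hr with
    | root => exact absurd rfl h1
    | step hq hr =>
      rw [(hstep _ _ hr).2.2]
      exact hq
  refine ⟨M, ⟨fun p hp q hq => hinj p ((hmem p).1 hp) q ((hmem q).1 hq), hroot,
    fun p hp h1 _ => hpar p hp fun h => h1 (congrArg Prod.fst h)⟩, ?_⟩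
  have h1 : ∑ p ∈ M, g p.1 p.2 = ∑ p ∈ M, G p.1 p.2 -
      ∑ p ∈ M, ∑ r ∈ (M.erase (T.root, T'.root)).filter
        (fun r => (T.parent r.1, T'.parent r.2) = p), G r.1 r.2 := by
    rw [← Finset.sum_sub_distrib]
    refine Finset.sum_congr rfl fun p hp => ?_
    rw [hfib p hp, hNsum, hG p.1 p.2]
    ring
  rw [Finset.sum_fiberwise_of_maps_to] at h1
  · have h3 := Finset.add_sum_erase M (fun q => G q.1 q.2) hroot
    simp only at h3
    linarith
  · intro r hr
    rw [Finset.mem_erase] at hr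
    exact hpar r hr.2 hr.1

theorem sdted_eq [DecidableEq V] [DecidableEq V'] (c : Option L → Option L → ℝ) {G : V → V' → ℝ}
    (hG : ∀ u v, G u v = c (some (T.label u)) (some (T'.label v)) - c (some (T.label u)) none -
      c none (some (T'.label v)) + minMatching (T.children u) (T'.children v) G) :
    sdted c T T' = ∑ u, c (some (T.label u)) none + ∑ v, c none (some (T'.label v)) +
      G T.root T'.root := by
  refine (isLeast_sdted c T T').unique ⟨?_, ?_⟩
  · obtain ⟨M, hM, hsum⟩ := exists_isSDMapping_sum_eq hG
    exact ⟨M, hM, by rw [hM.mappingCost_eq, hsum]⟩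
  · rintro _ ⟨M, hM, rfl⟩
    rw [hM.mappingCost_eq]
    have := hM.sum_ge hG
    linarith

end recursion

/-! ## Breadth-first order of the vertices -/

/-- `next` links the vertices of the list to a chain that starts with `x`; the vertex `v` is
encoded by `v + 1`, and the end of the list by `0`. -/
def IsLinkedList (next : ℕ → ℕ) : ℕ → List ℕ → Prop
  | x, [] => x = 0
  | x, v :: l => x = v + 1 ∧ IsLinkedList next (next v) l

theorem IsLinkedList.congr {next next' : ℕ → ℕ} : ∀ {l : List ℕ} {x : ℕ},
    IsLinkedList next x l → (∀ v ∈ l, next' v = next v) → IsLinkedList next' x l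
  | [], _, h, _ => h
  | v :: l, x, h, h' => ⟨h.1, by
      rw [h' v (List.mem_cons_self)]
      exact IsLinkedList.congr h.2 fun w hw => h' w (List.mem_cons_of_mem _ hw)⟩

theorem IsLinkedList.lt {next : ℕ → ℕ} {N : ℕ} {x : ℕ} {l : List ℕ} (h : IsLinkedList next x l)
    (hl : ∀ v ∈ l, v < N) : x ≤ N := by
  cases l with
  | nil => exact (show x = 0 from h) ▸ Nat.zero_le N
  | cons v l =>
    have := h.1
    have := hl v List.mem_cons_self
    omega

/-- The first `e` entries of `Q` are a part of a breadth-first order of the vertices `0, …, n - 1`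
of a rooted tree, in which the children of the first `h` vertices are listed: the children of
`Q x` are in the positions from `lo x` to `hi x - 1`. -/
structure PartialOrderedBFS (n r : ℕ) (par Q lo hi : ℕ → ℕ) (h e : ℕ) : Prop where
  one_le : 1 ≤ e
  le : h ≤ e
  zero : Q 0 = r
  lt : ∀ j < e, Q j < n
  inj : ∀ j < e, ∀ j' < e, Q j = Q j' → j = j'
  parent : ∀ j < e, j ≠ 0 → Q j ≠ r ∧ ∃ x < h, par (Q j) = Q x
  bounds : ∀ x < h, x < lo x ∧ lo x ≤ hi x ∧ hi x ≤ e
  children : ∀ x < h, ∀ v, (v < n ∧ v ≠ r ∧ par v = Q x) ↔ ∃ j, lo x ≤ j ∧ j < hi x ∧ Q j = v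

namespace PartialOrderedBFS

variable {n r h e : ℕ} {par Q lo hi : ℕ → ℕ}

theorem initial (hr : r < n) : PartialOrderedBFS n r par (Function.update Q 0 r) lo hi 0 1 where
  one_le := le_rfl
  le := zero_le_one
  zero := by simp
  lt j hj := by
    obtain rfl : j = 0 := by omega
    simpa using hr
  inj j hj j' hj' _ := by omega
  parent j hj hj' := by omega
  bounds x hx := by omega
  children x hx := by omega

/-- Parents of listed vertices occur among the first `h` entries, so no child of `Q h` has been
listed yet. Hence the queue never outgrows the vertex set, which bounds the stored numbers and the
running time. -/
theorem length_add_le (H : PartialOrderedBFS n r par Q lo hi h e) (he : h < e) {l : List ℕ}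
    (hl : l.Nodup) (hmem : ∀ v, v ∈ l ↔ v < n ∧ v ≠ r ∧ par v = Q h) : e + l.length ≤ n := by
  have hd : Disjoint ((Finset.range e).image Q) l.toFinset := by
    refine Finset.disjoint_left.2 fun v hv hv' => ?_
    obtain ⟨j, hj, rfl⟩ := Finset.mem_image.1 hv
    rw [Finset.mem_range] at hj
    rw [List.mem_toFinset, hmem] at hv'
    have hj0 : j ≠ 0 := by
      rintro rfl
      exact hv'.2.1 H.zero
    obtain ⟨-, x, hx, hpx⟩ := H.parent j hj hj0
    have := H.inj x (by omega) h he (hpx.symm.trans hv'.2.2)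
    omega
  have hs : (Finset.range e).image Q ∪ l.toFinset ⊆ Finset.range n := by
    intro v hv
    rw [Finset.mem_union, Finset.mem_image, List.mem_toFinset, hmem] at hv
    rw [Finset.mem_range]
    rcases hv with ⟨j, hj, rfl⟩ | hv
    · exact H.lt j (Finset.mem_range.1 hj)
    · exact hv.1
  have := Finset.card_le_card hs
  rw [Finset.card_union_of_disjoint hd, List.toFinset_card_of_nodup hl, Finset.card_image_of_injOn,
    Finset.card_range, Finset.card_range] at this
  · exact this
  · intro j hj j' hj'
    simp only [Finset.coe_range, Set.mem_Iio] at hj hj'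
    exact H.inj j hj j' hj'

theorem step (H : PartialOrderedBFS n r par Q lo hi h e) (he : h < e) {l : List ℕ}
    (hl : l.Nodup) (hmem : ∀ v, v ∈ l ↔ v < n ∧ v ≠ r ∧ par v = Q h) {Q' : ℕ → ℕ}
    (hQ : ∀ j < e, Q' j = Q j) (hQ' : ∀ i (hi : i < l.length), Q' (e + i) = l[i]) :
    PartialOrderedBFS n r par Q' (Function.update lo h e) (Function.update hi h (e + l.length))
      (h + 1) (e + l.length) := by
  have hnew : ∀ j, e ≤ j → j < e + l.length → Q' j ∈ l := by
    intro j h1 h2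
    have := hQ' (j - e) (by omega)
    rw [show e + (j - e) = j by omega] at this
    rw [this]
    exact List.getElem_mem _
  have hnot : ∀ j < e, Q j ∉ l := by
    intro j hj hv'
    rw [hmem] at hv'
    have hj0 : j ≠ 0 := by
      rintro rfl
      exact hv'.2.1 H.zero
    obtain ⟨-, x, hx, hpx⟩ := H.parent j hj hj0
    have := H.inj x (by omega) h he (hpx.symm.trans hv'.2.2)
    omega
  have hone := H.one_le
  refine ⟨by omega, by omega, ?_, ?_, ?_, ?_, ?_, ?_⟩
  · rw [hQ 0 (by omega), H.zero]
  · intro j hj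
    by_cases h1 : j < e
    · rw [hQ j h1]
      exact H.lt j h1
    · exact ((hmem _).1 (hnew j (by omega) hj)).1
  · intro j hj j' hj' heq
    by_cases h1 : j < e <;> by_cases h2 : j' < e
    · rw [hQ j h1, hQ j' h2] at heq
      exact H.inj j h1 j' h2 heq
    · rw [hQ j h1] at heq
      exact absurd (heq ▸ hnew j' (by omega) hj') (hnot j h1)
    · rw [hQ j' h2] at heq
      exact absurd (heq ▸ hnew j (by omega) hj) (hnot j' h2)
    · have h3 := hQ' (j - e) (by omega)
      have h4 := hQ' (j' - e) (by omega)
      rw [show e + (j - e) = j by omega] at h3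
      rw [show e + (j' - e) = j' by omega] at h4
      rw [h3, h4] at heq
      have := (List.Nodup.getElem_inj_iff hl).1 heq
      omega
  · intro j hj hj0
    by_cases h1 : j < e
    · rw [hQ j h1]
      obtain ⟨h2, x, hx, hpx⟩ := H.parent j h1 hj0
      exact ⟨h2, x, by omega, by rw [hQ x (by omega), hpx]⟩
    · have := (hmem _).1 (hnew j (by omega) hj)
      exact ⟨this.2.1, h, by omega, by rw [hQ h he, this.2.2]⟩
  · intro x hx
    by_cases h1 : x = h
    · subst h1
      simp
      omega
    · rw [Function.update_of_ne h1, Function.update_of_ne h1]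
      have := H.bounds x (by omega)
      omega
  · intro x hx v
    by_cases h1 : x = h
    · subst h1
      rw [Function.update_self, Function.update_self, hQ x he, ← hmem]
      constructor
      · intro hv
        obtain ⟨i, hi, rfl⟩ := List.getElem_of_mem hv
        exact ⟨e + i, by omega, by omega, hQ' i hi⟩
      · rintro ⟨j, h2, h3, rfl⟩
        exact hnew j h2 h3
    · have hb := H.bounds x (by omega)
      rw [Function.update_of_ne h1, Function.update_of_ne h1, hQ x (by omega),
        H.children x (by omega)]
      refine exists_congr fun j => and_congr_right fun h2 => and_congr_right fun h3 => ?_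
      rw [hQ j (by omega)]

end PartialOrderedBFS

/-- `Q` lists the vertices of `T`, starting with the root, such that the children of `Q x` are in
the positions from `lo x` to `hi x - 1`, and these are greater than `x`. -/
structure IsBFSOrder {n : ℕ} {L : Type*} (T : LabeledRootedTree (Fin n) L) (Q : ℕ → Fin n)
    (lo hi : ℕ → ℕ) : Prop where
  zero : Q 0 = T.root
  inj : Set.InjOn Q (Finset.range n)
  bounds : ∀ x < n, x < lo x ∧ lo x ≤ hi x ∧ hi x ≤ n
  children : ∀ x < n, T.children (Q x) = (Finset.Ico (lo x) (hi x)).image Q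

theorem PartialOrderedBFS.isBFSOrder {n : ℕ} {L : Type*} {T : LabeledRootedTree (Fin n) L}
    {Q lo hi : ℕ → ℕ} {e : ℕ} (H : PartialOrderedBFS n T.root T.parentArray Q lo hi e e) :
    ∃ q : ℕ → Fin n, (∀ x < n, Q x = q x) ∧ IsBFSOrder T q lo hi := by
  have hpar : ∀ v : Fin n, T.parentArray v = T.parent v := fun v => by
    simp [LabeledRootedTree.parentArray]
  -- Once all listed vertices are processed, induction on the depth shows that every vertex is
  -- listed; by injectivity there are exactly `n` entries.
  have hall : ∀ d, ∀ v : Fin n, T.graph.dist T.root v ≤ d → ∃ j < e, Q j = v := by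
    intro d
    induction d with
    | zero =>
      intro v hv
      by_cases hr : v = T.root
      · exact ⟨0, H.one_le, by rw [H.zero, hr]⟩
      · have := (T.parent_spec hr).2
        omega
    | succ d ih =>
      intro v hv
      by_cases hr : v = T.root
      · exact ⟨0, H.one_le, by rw [H.zero, hr]⟩
      · have := (T.parent_spec hr).2
        obtain ⟨x, hx, hQx⟩ := ih (T.parent v) (by omega)
        have hb := H.bounds x hx
        obtain ⟨j, h1, h2, h3⟩ := (H.children x hx v).1
          ⟨v.2, fun h => hr (Fin.ext h), by rw [hQx, hpar]⟩
        exact ⟨j, by omega, h3⟩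
  have he : e = n := by
    refine le_antisymm ?_ ?_
    · have := Finset.card_le_card_of_injOn (s := Finset.range e) (t := Finset.range n) Q
        (fun j hj => by simpa using H.lt j (by simpa using hj))
        (fun j hj j' hj' => by
          simp only [Finset.coe_range, Set.mem_Iio] at hj hj'
          exact H.inj j hj j' hj')
      simpa using this
    · have := Finset.card_le_card_of_surjOn (s := Finset.range e) (t := Finset.range n) Q
        (fun v hv => by
          simp only [Finset.coe_range, Set.mem_Iio] at hv
          obtain ⟨j, hj, hjv⟩ := hall _ ⟨v, hv⟩ le_rfl
          exact ⟨j, by simpa using hj, hjv⟩)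
      simpa using this
  subst he
  refine ⟨fun x => if hx : x < e then ⟨Q x, H.lt x hx⟩ else T.root, fun x hx => by simp [hx],
    ?_, ?_, H.bounds, ?_⟩
  · have := H.one_le
    ext
    simp [show 0 < e by omega, H.zero]
  · intro j hj j' hj' heq
    simp only [Finset.coe_range, Set.mem_Iio] at hj hj'
    simp only [hj, hj', dif_pos, Fin.mk.injEq] at heq
    exact H.inj j hj j' hj' heq
  · intro x hx
    have hb := H.bounds x hx
    ext v
    have := H.children x hx v
    rw [hpar] at this
    simp only [LabeledRootedTree.mem_children, Finset.mem_image, Finset.mem_Ico, dif_pos hx]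
    constructor
    · rintro ⟨h1, h2⟩
      obtain ⟨j, h3, h4, h5⟩ := this.1 ⟨v.2, fun h => h1 (Fin.ext h), by rw [h2]⟩
      refine ⟨j, ⟨h3, h4⟩, ?_⟩
      rw [dif_pos (by omega)]
      exact Fin.ext h5
    · rintro ⟨j, ⟨h3, h4⟩, h5⟩
      rw [dif_pos (by omega)] at h5
      obtain ⟨-, h6, h7⟩ := this.2 ⟨j, h3, h4, by rw [← h5]⟩
      exact ⟨fun h => h6 (by rw [h]), Fin.ext h7⟩

/-! ### Breadth-first traversal on the machine -/

namespace RAM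

/-- Link the children of each vertex of the `t`-th tree to a list. -/
def linkChildren (t : ℕ) : Program :=
  .range (10 * t + 5) 0 (.load 0 (.const (t - 1)))
    (.ifThenElse (.natEq (.var (10 * t + 5)) (.load 0 (.const (t + 1))))
      .skip
      (.seq
        (.setNat (10 * t + 1) (.var (10 * t + 5))
          (.load (10 * t) (.load t (.var (10 * t + 5)))))
        (.setNat (10 * t) (.load t (.var (10 * t + 5))) (.add (.var (10 * t + 5)) (.const 1)))))

/-- Append a list of children to the queue. -/
def enqueueChildren (t : ℕ) : Program :=
  .loop (.natLt (.const 0) (.var (10 * t + 8)))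
    (.seq (.setNat (10 * t + 2) (.var (10 * t + 6)) (.sub (.var (10 * t + 8)) (.const 1)))
      (.seq (.setNat (10 * t + 6) (.const 0) (.add (.var (10 * t + 6)) (.const 1)))
        (.setNat (10 * t + 8) (.const 0)
          (.load (10 * t + 1) (.sub (.var (10 * t + 8)) (.const 1))))))

/-- Breadth-first traversal of the `t`-th tree. -/
def traverse (t : ℕ) : Program :=
  .seq (.setNat (10 * t + 2) (.const 0) (.load 0 (.const (t + 1))))
    (.seq (.setNat (10 * t + 6) (.const 0) (.const 1))
      (.seq (.setNat (10 * t + 7) (.const 0) (.const 0))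
        (.loop (.natLt (.var (10 * t + 7)) (.var (10 * t + 6)))
          (.seq (.setNat (10 * t + 3) (.var (10 * t + 7)) (.var (10 * t + 6)))
            (.seq (.setNat (10 * t + 8) (.const 0)
                (.load (10 * t) (.load (10 * t + 2) (.var (10 * t + 7)))))
              (.seq (enqueueChildren t)
                (.seq (.setNat (10 * t + 4) (.var (10 * t + 7)) (.var (10 * t + 6)))
                  (.setNat (10 * t + 7) (.const 0)
                    (.add (.var (10 * t + 7)) (.const 1))))))))))

variable {L : Type*} {D : CostInput L} {W : ℕ} {s : State}

/-- Together with `Wp.loop_step` this unfolds a loop round by round, for the induction on the linked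
list in `wp_enqueueChildren`. -/
theorem Wp.loop_exit {b : Test} {P : Program} {R : State → ℕ → Prop} (hb : ¬ b.Holds D s)
    (h : R s (b.steps + 1)) : Wp D W (.loop b P) s R :=
  ⟨_, _, .loopStop hb, h⟩

theorem Wp.loop_step {b : Test} {P : Program} {R : State → ℕ → Prop} (hb : b.Holds D s)
    (h : Wp D W P s fun s₁ t₁ => Wp D W (.loop b P) s₁ fun s₂ t₂ =>
      R s₂ (b.steps + t₁ + t₂ + 1)) : Wp D W (.loop b P) s R := by
  obtain ⟨s₁, t₁, h₁, s₂, t₂, h₂, h₃⟩ := h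
  exact ⟨_, _, .loopStep hb h₁ h₂, h₃⟩

/-- Array `10 * t` holds the heads of the lists of children, array `10 * t + 1` the sibling links.
Vertex `i` is put in front of the list of its parent; all links in use belong to smaller vertices,
so writing cell `i` destroys nothing. -/
theorem wp_linkChildren {t n r : ℕ} {par : ℕ → ℕ} (ht : t = 1 ∨ t = 2)
    (hn : s.nat 0 (t - 1) = n) (hr : s.nat 0 (t + 1) = r) (hpar : s.nat t = par)
    (h₀ : ∀ w, s.nat (10 * t) w = 0) (hW : n ≤ W) :
    Wp D W (linkChildren t) s fun s' T => T ≤ 50 * (n + 1) ∧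
      ∀ w, ∃ l, IsLinkedList (s'.nat (10 * t + 1)) (s'.nat (10 * t) w) l ∧ l.Nodup ∧
        ∀ v, v ∈ l ↔ v < n ∧ v ≠ r ∧ par v = w := by
  have hframe : ∀ a, a = 0 ∨ a = t → a ∉ (linkChildren t).natTargets := by
    intro a ha
    simp [linkChildren, Program.range, Program.upTo, Program.natTargets]
    omega
  refine (Wp.range (fun i s' =>
      ∀ w, ∃ l, IsLinkedList (s'.nat (10 * t + 1)) (s'.nat (10 * t) w) l ∧ l.Nodup ∧
        ∀ v, v ∈ l ↔ v < i ∧ v ≠ r ∧ par v = w) (N := n) 30 (by omega) hW ?_ ?_ ?_).mono ?_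
  · intro w
    refine ⟨[], ?_, List.nodup_nil, by simp⟩
    simp (disch := omega) [IsLinkedList, h₀]
  · intro s' hf
    simp [hf.nat_eq 0 (hframe 0 (by simp)), hn]
  · intro i s' hf hi _ hin hI
    have f0 := hf.nat_eq 0 (hframe 0 (by simp))
    have ft := (hf.nat_eq t (hframe t (by simp))).trans hpar
    refine Wp.ite (fun hb => ?_) (fun hb => ?_)
    · simp only [Test.Holds, NatExpr.eval, hi, f0, hr] at hb
      refine Wp.skip ⟨by simp, hi, fun w => ?_⟩
      obtain ⟨l, h1, h2, h3⟩ := hI w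
      refine ⟨l, by simpa (disch := omega) using h1, h2, fun v => ?_⟩
      rw [h3]
      constructor
      · rintro ⟨h4, h5⟩
        exact ⟨by omega, h5⟩
      · rintro ⟨h4, h5, h6⟩
        exact ⟨by omega, h5, h6⟩
    · simp only [Test.Holds, NatExpr.eval, hi, f0, hr] at hb
      obtain ⟨l₀, h1, h2, h3⟩ := hI (par i)
      have hle : s'.nat (10 * t) (par i) ≤ i :=
        h1.lt fun v hv => ((h3 v).1 hv).1
      refine Wp.seq (Wp.setNat (by simp [hi, ft]; omega)
        (Wp.setNat (by simp (disch := omega) [hi]; omega) ⟨by simp, ?_, fun w => ?_⟩))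
      · simpa (disch := omega) using hi
      · simp (disch := omega) only [NatExpr.eval, hi, ft, State.writeNat_nat_self,
          State.writeNat_nat_of_ne]
        by_cases hw : w = par i
        · subst hw
          refine ⟨i :: l₀, ⟨by simp, ?_⟩, ?_, ?_⟩
          · rw [Function.update_self]
            refine h1.congr fun v hv => ?_
            have := ((h3 v).1 hv).1
            rw [Function.update_of_ne (by omega)]
          · refine List.nodup_cons.2 ⟨fun hmem => ?_, h2⟩
            have := ((h3 i).1 hmem).1
            omega
          · intro v
            rw [List.mem_cons, h3]
            constructor
            · rintro (rfl | ⟨h4, h5⟩)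
              · exact ⟨by omega, hb, rfl⟩
              · exact ⟨by omega, h5⟩
            · rintro ⟨h4, h5⟩
              by_cases h6 : v = i
              · exact Or.inl h6
              · exact Or.inr ⟨by omega, h5⟩
        · obtain ⟨l, h4, h5, h6⟩ := hI w
          rw [Function.update_of_ne hw]
          refine ⟨l, h4.congr fun v hv => ?_, h5, fun v => ?_⟩
          · have := ((h6 v).1 hv).1
            rw [Function.update_of_ne (by omega)]
          · rw [h6]
            constructor
            · rintro ⟨h7, h8⟩
              exact ⟨by omega, h8⟩
            · rintro ⟨h7, h8, h9⟩
              have : v ≠ i := by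
                rintro rfl
                exact hw h9.symm
              exact ⟨by omega, h8, h9⟩
  · rintro s' T hf ⟨hT, h⟩
    refine ⟨?_, h⟩
    simp at hT
    omega

theorem wp_enqueueChildren {t : ℕ} {l : List ℕ}
    (hl : IsLinkedList (s.nat (10 * t + 1)) (s.nat (10 * t + 8) 0) l) (hlW : ∀ v ∈ l, v < W)
    (hW : s.nat (10 * t + 6) 0 + l.length ≤ W) :
    Wp D W (enqueueChildren t) s fun s' T => T ≤ 40 * l.length + 10 ∧
      s'.nat (10 * t + 6) 0 = s.nat (10 * t + 6) 0 + l.length ∧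
      (∀ j < s.nat (10 * t + 6) 0, s'.nat (10 * t + 2) j = s.nat (10 * t + 2) j) ∧
      ∀ i (hi : i < l.length), s'.nat (10 * t + 2) (s.nat (10 * t + 6) 0 + i) = l[i] := by
  induction l generalizing s with
  | nil =>
    have hl : s.nat (10 * t + 8) 0 = 0 := hl
    exact Wp.loop_exit (by simp [hl]) ⟨by simp, rfl, fun _ _ => rfl, fun i hi => by simp at hi⟩
  | cons v l ih =>
    obtain ⟨h1, h2⟩ := hl
    have hnext := h2.lt (N := W) fun w hw => hlW w (List.mem_cons_of_mem _ hw)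
    have hv := hlW v List.mem_cons_self
    rw [List.length_cons] at hW
    refine Wp.loop_step (by simp [h1]) (Wp.seq (Wp.setNat (by simp [h1]; omega)
      (Wp.seq (Wp.setNat (by simp (disch := omega); omega)
        (Wp.setNat (by simpa (disch := omega) [h1] using hnext) ?_)))))
    simp (disch := omega) only [NatExpr.eval, State.writeNat_nat_of_ne, h1, Nat.add_sub_cancel]
    set s₁ := State.writeNat _ (10 * t + 8) 0 _ with hs₁
    have e1 : s₁.nat (10 * t + 1) = s.nat (10 * t + 1) := by simp (disch := omega) [hs₁]
    have e2 : s₁.nat (10 * t + 2) =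
        Function.update (s.nat (10 * t + 2)) (s.nat (10 * t + 6) 0) v := by
      simp (disch := omega) [hs₁]
    have e6 : s₁.nat (10 * t + 6) 0 = s.nat (10 * t + 6) 0 + 1 := by simp (disch := omega) [hs₁]
    have e8 : s₁.nat (10 * t + 8) 0 = s.nat (10 * t + 1) v := by simp (disch := omega) [hs₁]
    refine (ih (s := s₁) (by rwa [e1, e8]) (fun w hw => hlW w (List.mem_cons_of_mem _ hw))
      (by omega)).mono ?_
    rintro s₂ T - ⟨hT, h3, h4, h5⟩
    rw [e6] at h3 h4 h5
    rw [e2] at h4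
    refine ⟨?_, by rw [h3, List.length_cons]; omega, fun j hj => ?_, fun i hi => ?_⟩
    · simp
      omega
    · rw [h4 j (by omega), Function.update_of_ne (by omega)]
    · cases i with
      | zero => simpa using h4 (s.nat (10 * t + 6) 0) (by omega)
      | succ i =>
        rw [List.getElem_cons_succ, ← h5 i (by simpa using hi)]
        congr 1
        omega

/-- Arrays `10 * t + 2`, `10 * t + 3`, `10 * t + 4` are the queue and the bounds `lo`, `hi`. Cells
`10 * t + 6` and `10 * t + 7` hold the queue length and the number of processed entries, and cell
`10 * t + 8` runs through a list of children. -/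
theorem wp_traverse {t n r : ℕ} {par : ℕ → ℕ} (hn : r < n)
    (hr : s.nat 0 (t + 1) = r)
    (hl : ∀ w, ∃ l, IsLinkedList (s.nat (10 * t + 1)) (s.nat (10 * t) w) l ∧ l.Nodup ∧
        ∀ v, v ∈ l ↔ v < n ∧ v ≠ r ∧ par v = w) (hW : n ≤ W) :
    Wp D W (traverse t) s fun s' T => T ≤ 200 * (n + 1) ∧ ∃ e,
      PartialOrderedBFS n r par (s'.nat (10 * t + 2)) (s'.nat (10 * t + 3)) (s'.nat (10 * t + 4))
        e e := by
  refine Wp.seq (Wp.setNat (by simp; omega) (Wp.seq (Wp.setNat (by simp; omega)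
    (Wp.seq (Wp.setNat (by simp) ?_)))))
  simp only [NatExpr.eval, NatExpr.steps]
  set s₁ := State.writeNat _ (10 * t + 7) 0 _ with hs₁
  have e0 : s₁.nat (10 * t) = s.nat (10 * t) := by simp (disch := omega) [hs₁]
  have e1 : s₁.nat (10 * t + 1) = s.nat (10 * t + 1) := by simp (disch := omega) [hs₁]
  have e2 : s₁.nat (10 * t + 2) = Function.update (s.nat (10 * t + 2)) 0 r := by
    simp (disch := omega) [hs₁, hr]
  have e6 : s₁.nat (10 * t + 6) 0 = 1 := by simp (disch := omega) [hs₁]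
  have e7 : s₁.nat (10 * t + 7) 0 = 0 := by simp (disch := omega) [hs₁]
  -- Amortized time: each vertex is processed once and enqueued at most once, with separate credits
  -- for the two events.
  refine (Wp.loop (fun N s' => PartialOrderedBFS n r par (s'.nat (10 * t + 2))
    (s'.nat (10 * t + 3)) (s'.nat (10 * t + 4)) (s'.nat (10 * t + 7) 0) (s'.nat (10 * t + 6) 0) ∧
    s'.nat (10 * t + 6) 0 ≤ n ∧
    N = 100 * (n - s'.nat (10 * t + 7) 0) + 40 * (n - s'.nat (10 * t + 6) 0) + 10)
    (n := 100 * n + 40 * (n - 1) + 10) ⟨?_, by omega, by rw [e6, e7]; omega⟩ ?_ ?_).mono ?_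
  · rw [e2, e6, e7]
    exact PartialOrderedBFS.initial hn
  · rintro N s' - ⟨-, -, rfl⟩ -
    simp
  · rintro N s' hf ⟨H, hen, rfl⟩ hb
    simp only [Test.Holds, NatExpr.eval] at hb
    have f0 : s'.nat (10 * t) = s.nat (10 * t) := by
      rw [hf.nat_eq (10 * t) (by simp [enqueueChildren, Program.natTargets]), e0]
    have f1 : s'.nat (10 * t + 1) = s.nat (10 * t + 1) := by
      rw [hf.nat_eq (10 * t + 1) (by simp [enqueueChildren, Program.natTargets]), e1]
    obtain ⟨l, hc, hnd, hmem⟩ := hl (s'.nat (10 * t + 2) (s'.nat (10 * t + 7) 0))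
    have hlen := H.length_add_le hb hnd hmem
    have hptr := hc.lt fun v hv => ((hmem v).1 hv).1
    refine Wp.seq (Wp.setNat (by simp; omega) (Wp.seq (Wp.setNat ?_ (Wp.seq ?_))))
    · simp (disch := omega) [f0]
      omega
    simp only [NatExpr.eval, NatExpr.steps]
    set s₂ := State.writeNat _ (10 * t + 8) 0 _ with hs₂
    have g1 : s₂.nat (10 * t + 1) = s.nat (10 * t + 1) := by simp (disch := omega) [hs₂, f1]
    have g2 : s₂.nat (10 * t + 2) = s'.nat (10 * t + 2) := by simp (disch := omega) [hs₂]
    have g3 : s₂.nat (10 * t + 3) = Function.update (s'.nat (10 * t + 3))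
        (s'.nat (10 * t + 7) 0) (s'.nat (10 * t + 6) 0) := by simp (disch := omega) [hs₂]
    have g4 : s₂.nat (10 * t + 4) = s'.nat (10 * t + 4) := by simp (disch := omega) [hs₂]
    have g6 : s₂.nat (10 * t + 6) = s'.nat (10 * t + 6) := by simp (disch := omega) [hs₂]
    have g7 : s₂.nat (10 * t + 7) = s'.nat (10 * t + 7) := by simp (disch := omega) [hs₂]
    have g8 : s₂.nat (10 * t + 8) 0 =
        s.nat (10 * t) (s'.nat (10 * t + 2) (s'.nat (10 * t + 7) 0)) := by
      simp (disch := omega) [hs₂, f0]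
    refine (wp_enqueueChildren (l := l) (by rwa [g1, g8])
      (fun v hv => ((hmem v).1 hv).1.trans_le hW) (by rw [g6]; omega)).mono ?_
    rintro s₃ T hf₃ ⟨hT, h1, h2, h3⟩
    rw [g6] at h1 h2 h3
    rw [g2] at h2
    have k3 : s₃.nat (10 * t + 3) = s₂.nat (10 * t + 3) :=
      hf₃.nat_eq _ (by simp [enqueueChildren, Program.natTargets])
    have k4 : s₃.nat (10 * t + 4) = s₂.nat (10 * t + 4) :=
      hf₃.nat_eq _ (by simp [enqueueChildren, Program.natTargets])
    have k7 : s₃.nat (10 * t + 7) = s₂.nat (10 * t + 7) :=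
      hf₃.nat_eq _ (by simp [enqueueChildren, Program.natTargets])
    refine Wp.seq (Wp.setNat (by simp; omega) (Wp.setNat ?_ ⟨_, ⟨?_, ?_, rfl⟩, ?_⟩))
    · simp (disch := omega) [k7, g7]
      omega
    · have := H.step hb hnd hmem h2 h3
      simpa (disch := omega) [k3, k4, k7, h1, g3, g4, g7] using this
    · simpa (disch := omega) [h1] using hlen
    · simp (disch := omega) [k7, g7, h1]
      omega
  · rintro s' T - ⟨hT, hb, N, H, hen, -⟩
    simp only [Test.Holds, NatExpr.eval] at hb
    refine ⟨by omega, s'.nat (10 * t + 6) 0, ?_⟩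
    have := H.le
    rwa [show s'.nat (10 * t + 7) 0 = s'.nat (10 * t + 6) 0 by omega] at H

/-- Compute a breadth-first order of the `t`-th tree. -/
def bfs (t : ℕ) : Program :=
  .seq (linkChildren t) (traverse t)

theorem wp_bfs {t n : ℕ} {L' : Type*} {T : LabeledRootedTree (Fin n) L'} (ht : t = 1 ∨ t = 2)
    (hn : s.nat 0 (t - 1) = n) (hr : s.nat 0 (t + 1) = T.root) (hpar : s.nat t = T.parentArray)
    (h₀ : ∀ w, s.nat (10 * t) w = 0) (hW : n ≤ W) :
    Wp D W (bfs t) s fun s' time => time ≤ 250 * (n + 1) ∧ ∃ q : ℕ → Fin n,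
      (∀ x < n, s'.nat (10 * t + 2) x = q x) ∧
      IsBFSOrder T q (s'.nat (10 * t + 3)) (s'.nat (10 * t + 4)) := by
  refine Wp.seq ((wp_linkChildren ht hn hr hpar h₀ hW).mono ?_)
  rintro s₁ t₁ hf₁ ⟨ht₁, h₁⟩
  have hr₁ : s₁.nat 0 (t + 1) = T.root := by
    rw [hf₁.nat_eq 0 ?_, hr]
    simp [linkChildren, Program.range, Program.upTo, Program.natTargets]
    omega
  refine (wp_traverse T.root.2 hr₁ h₁ hW).mono ?_
  rintro s₂ t₂ - ⟨ht₂, e, H⟩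
  exact ⟨by omega, H.isBFSOrder⟩

end RAM

/-! ## A program for the tree edit distance -/

namespace RAM

/-- Store the multiples of `step` in the array `dst`. -/
def multiples (dst c : ℕ) (step : NatExpr) : Program :=
  .seq (.setNat dst (.const 0) (.const 0))
    (.range 42 0 (.load 0 (.const c))
      (.setNat dst (.add (.var 42) (.const 1)) (.add (.load dst (.var 42)) step)))

/-- Add up the costs of deleting the first tree and inserting the second tree. -/
def sumCosts : Program :=
  .seq (.setReal 9 (.const 0) .zero)
    (.seq
      (.range 42 0 (.load 0 (.const 0))
        (.setReal 9 (.const 0) (.add (.var 9) (.cost (.label₁ (.var 42)) .eps))))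
      (.range 42 0 (.load 0 (.const 1))
        (.setReal 9 (.const 0) (.add (.var 9) (.cost .eps (.label₂ (.var 42)))))))

/-- Copy a segment of the array `src` to the array `dst`. -/
def copySegment (dst src st len : ℕ) : Program :=
  .range 42 1 (.add (.var len) (.const 1))
    (.setNat dst (.var 42) (.load src (.sub (.add (.var st) (.var 42)) (.const 1))))

/-- Provide the input of the Hungarian algorithm for the children of two vertices, whose
positions in the breadth-first orders are given in the cells `30` and `31`. -/
def setupMatching : Program :=
  .seq (.setNat 45 (.const 0) (.load 13 (.var 30)))
    (.seq (.setNat 46 (.const 0) (.load 23 (.var 31)))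
      (.seq (.setNat 32 (.const 0) (.sub (.load 14 (.var 30)) (.var 45)))
        (.seq (.setNat 33 (.const 0) (.sub (.load 24 (.var 31)) (.var 46)))
          (.ifThenElse (.natLt (.var 33) (.var 32))
            (.seq (.setNat 47 (.const 0) (.var 32))
              (.seq (.setNat 32 (.const 0) (.var 33))
                (.seq (.setNat 33 (.const 0) (.var 47))
                  (.seq (copySegment 34 29 46 32) (copySegment 35 19 45 33)))))
            (.seq (copySegment 34 19 45 32) (copySegment 35 29 46 33))))))

/-- Compute a table entry from the minimum weight of a matching between the children. -/
def storeEntry : Program :=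
  .seq (.setReal 10 (.const 0)
      (.add (.sub (.sub
        (.cost (.label₁ (.load 12 (.var 30))) (.label₂ (.load 22 (.var 31))))
        (.cost (.label₁ (.load 12 (.var 30))) .eps))
        (.cost .eps (.label₂ (.load 22 (.var 31))))) (.var 7)))
    (.seq (.ifThenElse (.realLt .zero (.var 10))
        (.setReal 1 (.add (.load 19 (.var 30)) (.load 29 (.var 31))) .zero)
        (.setReal 1 (.add (.load 19 (.var 30)) (.load 29 (.var 31))) (.var 10)))
      (.ifThenElse (.realLt (.var 10) (.var 2))
        (.setReal 2 (.const 0) (.var 10))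
        .skip))

/-- Compute the table entry for the positions in the cells `30` and `31`. -/
def computeEntry : Program :=
  .seq setupMatching (.seq hungarian storeEntry)

/-- Fill the table. -/
def fillTable : Program :=
  .seq (.setNat 30 (.const 0) (.load 0 (.const 0)))
    (.downTo 30
      (.seq (.setNat 31 (.const 0) (.load 0 (.const 1)))
        (.downTo 31 computeEntry)))

/-- Compute the structure and depth preserving tree edit distance. -/
def sdtedProgram : Program :=
  .seq (bfs 1) (.seq (bfs 2)
    (.seq (multiples 19 0 (.load 0 (.const 1))) (.seq (multiples 29 1 (.const 1))
      (.seq sumCosts (.seq fillTable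
        (.setReal 0 (.const 0) (.add (.var 9) (.var 10))))))))

/-! ### Correctness of the preparatory programs -/

section

variable {L : Type*} {D : CostInput L} {W : ℕ} {s : State}

/-- The machine cannot multiply, so row offsets are tabulated by repeated addition. With step `1`
this gives the column offsets, so a table address is a sum of two array entries, symmetric in the
two trees. -/
theorem wp_multiples {dst c N d : ℕ} {step : NatExpr} (h0 : dst ≠ 0) (h42 : dst ≠ 42)
    (hN : s.nat 0 c = N) (hd : ∀ s', s'.nat 0 = s.nat 0 → step.eval s' = d)
    (hW : N ≤ W) (hdW : N * d ≤ W) :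
    Wp D W (multiples dst c step) s fun s' t => t ≤ (40 + step.steps) * (N + 1) ∧
      ∀ x ≤ N, s'.nat dst x = x * d := by
  refine Wp.seq (Wp.setNat (by simp) ?_)
  simp only [NatExpr.eval, NatExpr.steps]
  set s₁ := s.writeNat dst 0 0 with hs₁
  have e0 : s₁.nat 0 = s.nat 0 := by simp [hs₁, h0.symm]
  refine (Wp.range (fun i s' => ∀ x ≤ i, s'.nat dst x = x * d) (N := N) (15 + step.steps)
    (by omega) hW ?_ ?_ ?_).mono ?_
  · intro x hx
    obtain rfl : x = 0 := by omega
    simp [hs₁, h42]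
  · intro s' hf
    have := hf.nat_eq 0 (by simp [Program.range, Program.upTo, Program.natTargets, h0.symm])
    simp [this, e0, hN]
  · intro i s' hf hi _ hiN hI
    have f0 := hf.nat_eq 0 (by simp [Program.range, Program.upTo, Program.natTargets, h0.symm])
    have hle : (i + 1) * d ≤ N * d := Nat.mul_le_mul_right _ hiN
    have hnew : s'.nat dst i + step.eval s' = (i + 1) * d := by
      rw [hI i le_rfl, hd s' (f0.trans e0), add_mul, one_mul]
    refine Wp.setNat ?_ ⟨?_, ?_, ?_⟩
    · simp only [NatExpr.eval, hi, hnew]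
      omega
    · simp
      omega
    · simp [h42.symm, hi]
    · intro x hx
      simp only [NatExpr.eval, hi, hnew]
      rcases eq_or_ne x (i + 1) with rfl | h
      · simp [h42]
      · simp [h42, h]
        exact hI x (by omega)
  · rintro s' t - ⟨ht, h⟩
    refine ⟨?_, h⟩
    have h1 : (40 + step.steps) * (N + 1) =
      N * (15 + step.steps + 2 + 10) + (13 * N + 40 + step.steps) := by ring
    simp at ht ⊢
    omega

theorem wp_copySegment {dst src st len N b : ℕ} {f : ℕ → ℕ} (h42 : dst ≠ 42) (hs42 : src ≠ 42)
    (ht42 : st ≠ 42) (hl42 : len ≠ 42) (hs : src ≠ dst) (ht : st ≠ dst) (hl : len ≠ dst)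
    (hsrc : s.nat src = f) (hst : s.nat st 0 = b) (hlen : s.nat len 0 = N) (hW : N + 1 ≤ W)
    (hf : ∀ r, 1 ≤ r → r ≤ N → f (b + r - 1) ≤ W) :
    Wp D W (copySegment dst src st len) s fun s' t => t ≤ 40 * (N + 1) ∧
      ∀ r, 1 ≤ r → r ≤ N → s'.nat dst r = f (b + r - 1) := by
  have hframe : ∀ a, a ≠ dst → a ≠ 42 → a ∉ (copySegment dst src st len).natTargets := by
    intro a h1 h2
    simp [copySegment, Program.range, Program.upTo, Program.natTargets, h1, h2]
  refine (Wp.range (fun i s' => ∀ r, 1 ≤ r → r < i → s'.nat dst r = f (b + r - 1))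
    (N := N + 1) 20 (by omega) hW (by intros; omega) ?_ ?_).mono ?_
  · intro s' hf'
    simp [hf'.nat_eq len (hframe _ hl hl42), hlen]
  · intro i s' hf' hi h1 h2 hI
    have e1 := (hf'.nat_eq src (hframe _ hs hs42)).trans hsrc
    have e2 := (congrFun (hf'.nat_eq st (hframe _ ht ht42)) 0).trans hst
    refine Wp.setNat (by simpa [hi, e1, e2] using hf i h1 (by omega)) ⟨by simp, ?_, ?_⟩
    · simp [h42.symm, hi]
    · intro r hr hr'
      rcases eq_or_ne r i with rfl | h
      · simp [h42, hi, e1, e2]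
      · simp [h42, hi, h]
        exact hI r hr (by omega)
  · rintro s' t - ⟨ht, h⟩
    refine ⟨?_, fun r h1 h2 => h r h1 (by omega)⟩
    simp at ht
    omega

/-- The Hungarian algorithm needs at most as many rows as columns, so the trees exchange roles if
the first vertex has more children. Only offsets are copied, not the matrix. -/
theorem wp_setupMatching {x y l₁ h₁ l₂ h₂ : ℕ} {f g : ℕ → ℕ} (hx : s.nat 30 0 = x)
    (hy : s.nat 31 0 = y) (hl₁ : s.nat 13 x = l₁) (hh₁ : s.nat 14 x = h₁) (hl₂ : s.nat 23 y = l₂)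
    (hh₂ : s.nat 24 y = h₂) (hf : s.nat 19 = f) (hg : s.nat 29 = g) (hlW₁ : l₁ < W)
    (hlW₂ : l₂ < W) (hhW₁ : h₁ < W) (hhW₂ : h₂ < W) (hle₁ : l₁ ≤ h₁) (hle₂ : l₂ ≤ h₂)
    (hfW : ∀ r, r < h₁ → f r ≤ W) (hgW : ∀ r, r < h₂ → g r ≤ W) :
    Wp D W setupMatching s fun s' t => t ≤ 200 * ((h₁ - l₁) + (h₂ - l₂) + 1) ∧
      ((h₁ - l₁ ≤ h₂ - l₂ ∧ s'.nat 32 0 = h₁ - l₁ ∧ s'.nat 33 0 = h₂ - l₂ ∧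
        (∀ r, 1 ≤ r → r ≤ h₁ - l₁ → s'.nat 34 r = f (l₁ + r - 1)) ∧
        (∀ r, 1 ≤ r → r ≤ h₂ - l₂ → s'.nat 35 r = g (l₂ + r - 1))) ∨
      (h₂ - l₂ ≤ h₁ - l₁ ∧ s'.nat 32 0 = h₂ - l₂ ∧ s'.nat 33 0 = h₁ - l₁ ∧
        (∀ r, 1 ≤ r → r ≤ h₂ - l₂ → s'.nat 34 r = g (l₂ + r - 1)) ∧
        (∀ r, 1 ≤ r → r ≤ h₁ - l₁ → s'.nat 35 r = f (l₁ + r - 1)))) := by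
  refine Wp.seq (Wp.setNat (by simp [hx, hl₁]; omega) (Wp.seq (Wp.setNat
    (by simp [hy, hl₂]; omega) (Wp.seq (Wp.setNat (by simp [hx, hh₁, hl₁]; omega)
    (Wp.seq (Wp.setNat (by simp [hy, hh₂, hl₂]; omega) ?_)))))))
  simp only [NatExpr.eval, NatExpr.steps]
  set s₁ := State.writeNat _ 33 0 _ with hs₁
  have e32 : s₁.nat 32 0 = h₁ - l₁ := by simp [hs₁, hx, hl₁, hh₁]
  have e33 : s₁.nat 33 0 = h₂ - l₂ := by simp [hs₁, hy, hl₂, hh₂]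
  have e45 : s₁.nat 45 0 = l₁ := by simp [hs₁, hx, hl₁]
  have e46 : s₁.nat 46 0 = l₂ := by simp [hs₁, hy, hl₂]
  have e19 : s₁.nat 19 = f := by simp [hs₁, hf]
  have e29 : s₁.nat 29 = g := by simp [hs₁, hg]
  refine Wp.ite (fun hb => ?_) (fun hb => ?_)
  · simp only [Test.Holds, NatExpr.eval, e32, e33] at hb
    refine Wp.seq (Wp.setNat (by simp; omega) (Wp.seq (Wp.setNat (by simp; omega)
      (Wp.seq (Wp.setNat (by simp; omega) (Wp.seq ?_))))))
    refine (wp_copySegment (N := h₂ - l₂) (b := l₂) (f := g) (by simp) (by simp) (by simp)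
      (by simp) (by simp) (by simp) (by simp) (by simpa using e29) (by simpa using e46)
      (by simpa using e33) (by omega) (fun r h1 h2 => hgW _ (by omega))).mono ?_
    rintro s₂ t₂ hf₂ ⟨ht₂, hr₂⟩
    refine (wp_copySegment (N := h₁ - l₁) (b := l₁) (f := f) (by simp) (by simp) (by simp)
      (by simp) (by simp) (by simp) (by simp) (by simpa [hf₂.nat_eq 19] using e19)
      (by simpa [hf₂.nat_eq 45] using e45)
      (by simpa [hf₂.nat_eq 33] using e32) (by omega) (fun r h1 h2 => hfW _ (by omega))).mono ?_
    rintro s₃ t₃ hf₃ ⟨ht₃, hr₃⟩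
    refine ⟨?_, Or.inr ⟨by omega, ?_, ?_, ?_, hr₃⟩⟩
    · simp
      omega
    · simpa [hf₃.nat_eq 32, hf₂.nat_eq 32] using e33
    · simpa [hf₃.nat_eq 33, hf₂.nat_eq 33] using e32
    · rwa [hf₃.nat_eq 34]
  · simp only [Test.Holds, NatExpr.eval, e32, e33] at hb
    refine Wp.seq ((wp_copySegment (N := h₁ - l₁) (b := l₁) (f := f) (by simp) (by simp) (by simp)
      (by simp) (by simp) (by simp) (by simp) e19 e45 e32 (by omega)
      (fun r h1 h2 => hfW _ (by omega))).mono ?_)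
    rintro s₂ t₂ hf₂ ⟨ht₂, hr₂⟩
    refine (wp_copySegment (N := h₂ - l₂) (b := l₂) (f := g) (by simp) (by simp) (by simp)
      (by simp) (by simp) (by simp) (by simp) (by simpa [hf₂.nat_eq 29] using e29)
      (by simpa [hf₂.nat_eq 46] using e46)
      (by simpa [hf₂.nat_eq 33] using e33) (by omega) (fun r h1 h2 => hgW _ (by omega))).mono ?_
    rintro s₃ t₃ hf₃ ⟨ht₃, hr₃⟩
    refine ⟨?_, Or.inl ⟨by omega, ?_, ?_, ?_, hr₃⟩⟩
    · simp
      omega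
    · simpa [hf₃.nat_eq 32, hf₂.nat_eq 32] using e32
    · simpa [hf₃.nat_eq 33, hf₂.nat_eq 33] using e33
    · rwa [hf₃.nat_eq 34]

end

section

variable {n n' : ℕ} {L : Type*} {c : Option L → Option L → ℝ} {T : LabeledRootedTree (Fin n) L}
  {T' : LabeledRootedTree (Fin n') L} {W : ℕ} {s : State}

theorem wp_sumCosts (hn : s.nat 0 0 = n) (hn' : s.nat 0 1 = n') (hW : n ≤ W) (hW' : n' ≤ W) :
    Wp (costInput c T T') W sumCosts s fun s' t => t ≤ 50 * (n + n' + 1) ∧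
      s'.real 9 0 = ∑ u, c (some (T.label u)) none + ∑ v, c none (some (T'.label v)) := by
  have hT : ∀ u : Fin n, T.labelArray u = some (T.label u) := fun u => by
    simp [LabeledRootedTree.labelArray]
  have hT' : ∀ u : Fin n', T'.labelArray u = some (T'.label u) := fun u => by
    simp [LabeledRootedTree.labelArray]
  refine Wp.seq (Wp.setReal (Wp.seq ?_))
  simp only [NatExpr.eval, NatExpr.steps, RealExpr.eval, RealExpr.steps]
  set s₁ := s.writeReal 9 0 0 with hs₁
  refine (Wp.range (fun i s' => s'.real 9 0 = ∑ u ∈ Finset.range i, c (T.labelArray u) none)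
    (N := n) 20 (by omega) hW (by simp [hs₁]) ?_ ?_).mono ?_
  · intro s' hf
    simp [hf.nat_eq 0, hs₁, hn]
  · intro i s' hf hi h1 h2 hI
    refine Wp.setReal ⟨by simp, by simp [hi], ?_⟩
    simp [hi, hI, Finset.sum_range_succ, costInput]
  rintro s₂ t₂ hf₂ ⟨ht₂, h₂⟩
  refine (Wp.range (fun i s' => s'.real 9 0 = ∑ u ∈ Finset.range n, c (T.labelArray u) none +
      ∑ u ∈ Finset.range i, c none (T'.labelArray u))
    (N := n') 20 (by omega) hW' (by simp [h₂]) ?_ ?_).mono ?_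
  · intro s' hf
    simp [hf.nat_eq 0, hf₂.nat_eq 0, hs₁, hn']
  · intro i s' hf hi h1 h2 hI
    refine Wp.setReal ⟨by simp, by simp [hi], ?_⟩
    simp [hi, hI, Finset.sum_range_succ, costInput, add_assoc]
  rintro s₃ t₃ - ⟨ht₃, h₃⟩
  refine ⟨?_, ?_⟩
  · simp at ht₂ ht₃
    omega
  · rw [h₃, Finset.sum_range, Finset.sum_range]
    simp only [hT, hT']

end

end RAM


/-! ### Children as segments of the breadth-first order -/

theorem IsBFSOrder.children_eq {n : ℕ} {L : Type*} {T : LabeledRootedTree (Fin n) L}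
    {Q : ℕ → Fin n} {lo hi : ℕ → ℕ} (h : IsBFSOrder T Q lo hi) {x : ℕ} (hx : x < n) :
    T.children (Q x) = (Finset.Icc 1 (hi x - lo x)).image (fun r => Q (lo x + r - 1)) ∧
      Set.InjOn (fun r => Q (lo x + r - 1)) (Finset.Icc 1 (hi x - lo x)) := by
  have hb := h.bounds x hx
  constructor
  · rw [h.children x hx]
    ext v
    simp only [Finset.mem_image, Finset.mem_Ico, Finset.mem_Icc]
    constructor
    · rintro ⟨j, ⟨h1, h2⟩, rfl⟩
      -- The segment starting at `lo x` is renumbered from `1`, as the Hungarian algorithm expects.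
      exact ⟨j + 1 - lo x, by omega, by congr 1; omega⟩
    · rintro ⟨r, ⟨h1, h2⟩, rfl⟩
      exact ⟨lo x + r - 1, by omega, rfl⟩
  · intro r hr r' hr' heq
    simp only [Finset.coe_Icc, Set.mem_Icc] at hr hr'
    have := h.inj (by simp; omega) (by simp; omega) heq
    omega

theorem IsBFSOrder.card_children {n : ℕ} {L : Type*} {T : LabeledRootedTree (Fin n) L}
    {Q : ℕ → Fin n} {lo hi : ℕ → ℕ} (h : IsBFSOrder T Q lo hi) {x : ℕ} (hx : x < n) :
    (T.children (Q x)).card = hi x - lo x := by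
  obtain ⟨h1, h2⟩ := h.children_eq hx
  rw [h1, Finset.card_image_of_injOn h2, Nat.card_Icc, Nat.add_sub_cancel]

theorem IsBFSOrder.sum_le {n : ℕ} {L : Type*} {T : LabeledRootedTree (Fin n) L}
    {Q : ℕ → Fin n} {lo hi : ℕ → ℕ} (h : IsBFSOrder T Q lo hi) :
    ∑ x ∈ Finset.range n, (hi x - lo x) ≤ n := by
  rw [Finset.sum_congr rfl fun x hx => (h.card_children (Finset.mem_range.1 hx)).symm,
    ← Finset.sum_image (f := fun u => (T.children u).card) h.inj]
  refine (Finset.sum_le_sum_of_subset (Finset.subset_univ _)).trans ?_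
  simpa using T.sum_card_children_le

/-! ### Filling the table -/

namespace RAM

/-- The read-only data of the main loops. -/
structure Prepared {n n' : ℕ} {L : Type*} (T : LabeledRootedTree (Fin n) L)
    (T' : LabeledRootedTree (Fin n') L) (q : ℕ → Fin n) (q' : ℕ → Fin n') (s : State) : Prop where
  size : s.nat 0 0 = n
  size' : s.nat 0 1 = n'
  eq : ∀ x < n, s.nat 12 x = q x
  eq' : ∀ y < n', s.nat 22 y = q' y
  order : IsBFSOrder T q (s.nat 13) (s.nat 14)
  order' : IsBFSOrder T' q' (s.nat 23) (s.nat 24)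
  offset : ∀ x ≤ n, s.nat 19 x = x * n'
  offset' : ∀ y ≤ n', s.nat 29 y = y

variable {n n' : ℕ} {L : Type*} {c : Option L → Option L → ℝ} {T : LabeledRootedTree (Fin n) L}
  {T' : LabeledRootedTree (Fin n') L} {q : ℕ → Fin n} {q' : ℕ → Fin n'} {W : ℕ} {s : State}

theorem Prepared.of_frame {P : Program} {s' : State} (h : Prepared T T' q q' s)
    (hf : Frame P s s') (hP : ∀ a ∈ [0, 12, 13, 14, 19, 22, 23, 24, 29], a ∉ P.natTargets) :
    Prepared T T' q q' s' := by
  simp only [List.forall_mem_cons, List.not_mem_nil, false_imp_iff, implies_true, and_true] at hP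
  obtain ⟨h0, h12, h13, h14, h19, h22, h23, h24, h29⟩ := hP
  refine ⟨?_, ?_, ?_, ?_, ?_, ?_, ?_, ?_⟩
  · rw [hf.nat_eq 0 h0, h.size]
  · rw [hf.nat_eq 0 h0, h.size']
  · rw [hf.nat_eq 12 h12]
    exact h.eq
  · rw [hf.nat_eq 22 h22]
    exact h.eq'
  · rw [hf.nat_eq 13 h13, hf.nat_eq 14 h14]
    exact h.order
  · rw [hf.nat_eq 23 h23, hf.nat_eq 24 h24]
    exact h.order'
  · rw [hf.nat_eq 19 h19]
    exact h.offset
  · rw [hf.nat_eq 29 h29]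
    exact h.offset'

/-- The table gets the truncated value, which is all that matchings need. The exact value stays in
real cell `10`, since the roots must be mapped to each other even at positive cost. Real cell `2`
remains a lower bound of the table. -/
theorem wp_storeEntry {x y : ℕ} (hP : Prepared T T' q q' s) (hx : x < n) (hy : y < n')
    (hsx : s.nat 30 0 = x) (hsy : s.nat 31 0 = y) {w : ℝ}
    (hw : w = c (some (T.label (q x))) (some (T'.label (q' y))) - c (some (T.label (q x))) none -
      c none (some (T'.label (q' y))) + s.real 7 0) :
    Wp (costInput c T T') W storeEntry s fun s' t => t ≤ 100 ∧
      s'.real 10 0 = w ∧ s'.real 1 = Function.update (s.real 1) (x * n' + y) (min w 0) ∧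
      s'.real 2 0 ≤ s.real 2 0 ∧ s'.real 2 0 ≤ w := by
  have e1 : (costInput c T T').label₁ (s.nat 12 x) = some (T.label (q x)) := by
    simp [costInput, hP.eq x hx, LabeledRootedTree.labelArray]
  have e2 : (costInput c T T').label₂ (s.nat 22 y) = some (T'.label (q' y)) := by
    simp [costInput, hP.eq' y hy, LabeledRootedTree.labelArray]
  have e3 : (costInput c T T').cost = c := rfl
  have e19 := hP.offset x hx.le
  have e29 := hP.offset' y hy.le
  refine Wp.seq (Wp.setReal ?_)
  simp only [NatExpr.eval, LabelExpr.eval, RealExpr.eval, hsx, hsy, e1, e2, e3, ← hw]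
  refine Wp.seq (Wp.ite (fun hb => Wp.setReal (Wp.ite (fun hb' => Wp.setReal ?_)
    (fun hb' => Wp.skip ?_))) (fun hb => Wp.setReal (Wp.ite (fun hb' => Wp.setReal ?_)
    (fun hb' => Wp.skip ?_))))
  all_goals
    simp only [Test.Holds, NatExpr.eval, RealExpr.eval, ne_eq, Nat.reduceEqDiff,
      not_false_eq_true, State.writeReal_real_of_ne, State.writeReal_real_self,
      Function.update_self, not_lt] at hb hb'
    simp [hsx, hsy, e19, e29]
  · exact ⟨by rw [min_eq_right hb.le], hb'.le⟩
  · exact ⟨by rw [min_eq_right hb.le], hb'⟩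
  · exact ⟨by rw [min_eq_left hb], hb'.le⟩
  · exact ⟨by rw [min_eq_left hb], hb'⟩

/-- Children have greater positions, so the matrix is read from rows of the table that are complete.
The number of matrix rows is at most both numbers of children, hence at most the minimum of the
maximum degrees. -/
theorem wp_computeEntry {G : Fin n → Fin n' → ℝ}
    (hG : ∀ u v, G u v = c (some (T.label u)) (some (T'.label v)) - c (some (T.label u)) none -
      c none (some (T'.label v)) + minMatching (T.children u) (T'.children v) G)
    {x y : ℕ} (hP : Prepared T T' q q' s) (hx : x < n) (hy : y < n')
    (hsx : s.nat 30 0 = x) (hsy : s.nat 31 0 = y) (hW : n * n' ≤ W) (hnW : n + 2 ≤ W)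
    (hnW' : n' + 2 ≤ W) (hB : s.real 2 0 ≤ 0)
    (htab : ∀ x₁, x < x₁ → x₁ < n → ∀ y₁ < n', s.real 1 (x₁ * n' + y₁) = min (G (q x₁) (q' y₁)) 0 ∧
      s.real 2 0 ≤ s.real 1 (x₁ * n' + y₁)) :
    Wp (costInput c T T') W computeEntry s fun s' t =>
      t ≤ 4000 * (min T.maxDegree T'.maxDegree *
        ((s.nat 14 x - s.nat 13 x) * (s.nat 24 y - s.nat 23 y)) +
        (s.nat 14 x - s.nat 13 x) + (s.nat 24 y - s.nat 23 y) + 1) ∧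
      s'.real 10 0 = G (q x) (q' y) ∧
      s'.real 1 = Function.update (s.real 1) (x * n' + y) (min (G (q x) (q' y)) 0) ∧
      s'.real 2 0 ≤ s.real 2 0 ∧ s'.real 2 0 ≤ min (G (q x) (q' y)) 0 := by
  have hb := hP.order.bounds x hx
  have hb' := hP.order'.bounds y hy
  set l₁ := s.nat 13 x with hl₁
  set h₁ := s.nat 14 x with hh₁
  set l₂ := s.nat 23 y with hl₂
  set h₂ := s.nat 24 y with hh₂
  obtain ⟨hc, hi⟩ := hP.order.children_eq hx
  obtain ⟨hc', hi'⟩ := hP.order'.children_eq hy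
  have hd := (T.card_children_le (q x)).trans' (hP.order.card_children hx).ge
  have hd' := (T'.card_children_le (q' y)).trans' (hP.order'.card_children hy).ge
  rw [← hl₁, ← hh₁] at hc hi hd
  rw [← hl₂, ← hh₂] at hc' hi' hd'
  have hoff : ∀ r < h₁, s.nat 19 r ≤ W := fun r hr => by
    rw [hP.offset r (by omega)]
    exact (Nat.mul_le_mul_right _ (by omega)).trans hW
  have hoff' : ∀ r < h₂, s.nat 29 r ≤ W := fun r hr => by
    rw [hP.offset' r (by omega)]
    omega
  have hmat := minMatching_image _ _ hi hi' G
  rw [← hc, ← hc'] at hmat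
  refine Wp.seq ((wp_setupMatching hsx hsy rfl rfl rfl rfl rfl rfl (by omega) (by omega)
    (by omega) (by omega) hb.2.1 hb'.2.1 hoff hoff').mono ?_)
  rintro s₁ t₁ hf₁ ⟨ht₁, h⟩
  rw [← hl₁, ← hh₁, ← hl₂, ← hh₂] at ht₁ h
  have hfin : ∀ s₂ t₂, Frame hungarian s₁ s₂ →
      t₂ ≤ 3000 * (min T.maxDegree T'.maxDegree * ((h₁ - l₁) * (h₂ - l₂)) +
        (h₁ - l₁) + (h₂ - l₂) + 1) →
      s₂.real 7 0 = minMatching (T.children (q x)) (T'.children (q' y)) G →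
      Wp (costInput c T T') W storeEntry s₂ fun s' t =>
        t₁ + (t₂ + t) ≤ 4000 * (min T.maxDegree T'.maxDegree *
        ((h₁ - l₁) * (h₂ - l₂)) + (h₁ - l₁) + (h₂ - l₂) + 1) ∧
        s'.real 10 0 = G (q x) (q' y) ∧
        s'.real 1 = Function.update (s.real 1) (x * n' + y) (min (G (q x) (q' y)) 0) ∧
        s'.real 2 0 ≤ s.real 2 0 ∧ s'.real 2 0 ≤ min (G (q x) (q' y)) 0 := by
    intro s₂ t₂ hf₂ ht₂ h7
    refine (wp_storeEntry ((hP.of_frame hf₁ (by decide)).of_frame hf₂ (by decide)) hx hy ?_ ?_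
      (w := G (q x) (q' y)) (by rw [h7]; exact hG _ _)).mono ?_
    · rw [hf₂.nat_eq 30, hf₁.nat_eq 30, hsx]
    · rw [hf₂.nat_eq 31, hf₁.nat_eq 31, hsy]
    · rintro s₃ t₃ - ⟨ht₃, h3, h4, h5, h6⟩
      rw [hf₂.real_eq 1, hf₁.real_eq 1] at h4
      rw [hf₂.real_eq 2, hf₁.real_eq 2] at h5
      exact ⟨by omega, h3, h4, h5, le_min h6 (h5.trans hB)⟩
  rcases h with ⟨hle, e32, e33, e34, e35⟩ | ⟨hle, e32, e33, e34, e35⟩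
  · refine Wp.seq ((wp_hungarian (w := fun r j => G (q (l₁ + r - 1)) (q' (l₂ + j - 1))) e32 e33 hle
      (by omega) (by rw [hf₁.real_eq 2]; exact hB) ?_).mono ?_)
    · intro r hr hr' j hj hj'
      rw [e34 r hr hr', e35 j hj hj', hP.offset _ (by omega), hP.offset' _ (by omega),
        hf₁.real_eq 1, hf₁.real_eq 2]
      exact htab _ (by omega) (by omega) _ (by omega)
    · rintro s₂ t₂ hf₂ ⟨ht₂, h7⟩
      refine hfin s₂ t₂ hf₂ (ht₂.trans ?_) (h7.trans hmat.symm)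
      have : (h₁ - l₁) * ((h₁ - l₁) * (h₂ - l₂)) ≤
          min T.maxDegree T'.maxDegree * ((h₁ - l₁) * (h₂ - l₂)) :=
        Nat.mul_le_mul_right _ (le_min hd (hle.trans hd'))
      omega
  -- Here the second tree supplies the rows: the two offsets are added in the other order, and the
  -- minimum matching is transposed.
  · refine Wp.seq ((wp_hungarian (w := fun r j => G (q (l₁ + j - 1)) (q' (l₂ + r - 1))) e32 e33 hle
      (by omega) (by rw [hf₁.real_eq 2]; exact hB) ?_).mono ?_)
    · intro r hr hr' j hj hj'
      rw [e34 r hr hr', e35 j hj hj', hP.offset _ (by omega), hP.offset' _ (by omega),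
        hf₁.real_eq 1, hf₁.real_eq 2, add_comm]
      exact htab _ (by omega) (by omega) _ (by omega)
    · rintro s₂ t₂ hf₂ ⟨ht₂, h7⟩
      refine hfin s₂ t₂ hf₂ (ht₂.trans ?_) ?_
      · have : (h₂ - l₂) * ((h₂ - l₂) * (h₁ - l₁)) ≤
            min T.maxDegree T'.maxDegree * ((h₁ - l₁) * (h₂ - l₂)) := by
          rw [mul_comm (h₁ - l₁)]
          exact Nat.mul_le_mul_right _ (le_min (hle.trans hd) hd')
        omega
      · rw [h7, hmat]
        exact minMatching_swap _ _ fun r j => G (q (l₁ + r - 1)) (q' (l₂ + j - 1))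

end RAM


theorem LabeledRootedTree.one_le_maxDegree {V L : Type*} [Fintype V] (T : LabeledRootedTree V L)
    (h : 2 ≤ Fintype.card V) : 1 ≤ T.maxDegree := by
  have : Nontrivial V := Fintype.one_lt_card_iff_nontrivial.1 h
  obtain ⟨v, hv⟩ := exists_ne T.root
  refine le_trans ?_ (T.card_children_le (T.parent v))
  exact Finset.card_pos.2 ⟨v, by simp [hv]⟩

namespace RAM

variable {n n' : ℕ} {L : Type*} {c : Option L → Option L → ℝ} {T : LabeledRootedTree (Fin n) L}
  {T' : LabeledRootedTree (Fin n') L} {q : ℕ → Fin n} {q' : ℕ → Fin n'} {W : ℕ} {s : State}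

theorem Prepared.writeNat (h : Prepared T T' q q' s) {a i x : ℕ}
    (ha : a ∉ [0, 12, 13, 14, 19, 22, 23, 24, 29]) : Prepared T T' q q' (s.writeNat a i x) := by
  refine h.of_frame (P := .setNat a (.const i) (.const x))
    (Exec.frame (D := costInput (fun _ _ => 0) T T') (.setNat a (.const i) (.const x) s le_rfl))
    fun b hb hb' => ?_
  rw [Program.natTargets, List.mem_singleton] at hb'
  rw [hb'] at hb
  exact ha hb

/-- The table entry for the positions `x` and `y` is correct. -/
def EntryCorrect (G : Fin n → Fin n' → ℝ) (q : ℕ → Fin n) (q' : ℕ → Fin n') (s : State)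
    (x y : ℕ) : Prop :=
  s.real 1 (x * n' + y) = min (G (q x) (q' y)) 0 ∧ s.real 2 0 ≤ s.real 1 (x * n' + y)

/-- Distinct positions have distinct addresses, as division by `n'` with remainder recovers both
coordinates. -/
theorem EntryCorrect.update {G : Fin n → Fin n' → ℝ} {s' : State} {x y x₁ y₁ : ℕ}
    (h : EntryCorrect G q q' s x₁ y₁) (hy : y < n') (hy₁ : y₁ < n') (hne : x₁ = x → y₁ ≠ y)
    (h1 : s'.real 1 = Function.update (s.real 1) (x * n' + y) (min (G (q x) (q' y)) 0))
    (h2 : s'.real 2 0 ≤ s.real 2 0) : EntryCorrect G q q' s' x₁ y₁ := by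
  have : x₁ * n' + y₁ ≠ x * n' + y := by
    intro h
    have hmod := congrArg (· % n') h
    have hdiv := congrArg (· / n') h
    simp only [Nat.add_comm (_ * n'), Nat.add_mul_mod_self_right,
      Nat.mod_eq_of_lt hy, Nat.mod_eq_of_lt hy₁] at hmod
    simp only [Nat.add_comm (_ * n'), Nat.add_mul_div_right _ _ (hy.trans_le' (Nat.zero_le y)),
      Nat.div_eq_of_lt hy, Nat.div_eq_of_lt hy₁, Nat.zero_add] at hdiv
    exact hne hdiv hmod
  rw [EntryCorrect, h1, Function.update_of_ne this]
  exact ⟨h.1, h2.trans h.2⟩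

theorem wp_fillTable {G : Fin n → Fin n' → ℝ}
    (hG : ∀ u v, G u v = c (some (T.label u)) (some (T'.label v)) - c (some (T.label u)) none -
      c none (some (T'.label v)) + minMatching (T.children u) (T'.children v) G)
    (hP : Prepared T T' q q' s) (hW : n * n' ≤ W) (hnW : n + 2 ≤ W) (hnW' : n' + 2 ≤ W)
    (hB : s.real 2 0 ≤ 0) :
    Wp (costInput c T T') W fillTable s fun s' t =>
      t ≤ ∑ x ∈ Finset.range n, (∑ y ∈ Finset.range n',
        (4000 * (min T.maxDegree T'.maxDegree *
          ((s.nat 14 x - s.nat 13 x) * (s.nat 24 y - s.nat 23 y)) +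
          (s.nat 14 x - s.nat 13 x) + (s.nat 24 y - s.nat 23 y) + 1) + 12) + 10 + 12) + 10 ∧
      s'.real 10 0 = G T.root T'.root := by
  have hn : 0 < n := T.root.pos
  have hn' : 0 < n' := T'.root.pos
  refine Wp.seq (Wp.setNat (by simp [hP.size]; omega) ?_)
  simp only [NatExpr.eval, NatExpr.steps, hP.size]
  set s₀ := s.writeNat 30 0 n with hs₀
  have e30 : s₀.nat 30 0 = n := by simp [hs₀]
  have hP₀ : Prepared T T' q q' s₀ := hP.writeNat (by decide)
  -- The last clause follows real cell `10`: after row `x` it contains the exact value for column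
  -- `0`, the last one computed. At `x = 0` this is the value for the two roots.
  refine (Wp.downTo (fun x s' => s'.real 2 0 ≤ 0 ∧
      (∀ x₁, x ≤ x₁ → x₁ < n → ∀ y₁ < n', EntryCorrect G q q' s' x₁ y₁) ∧
      (x < n → s'.real 10 0 = G (q x) (q' 0)))
    (fun x => ∑ y ∈ Finset.range n',
        (4000 * (min T.maxDegree T'.maxDegree *
          ((s.nat 14 x - s.nat 13 x) * (s.nat 24 y - s.nat 23 y)) +
          (s.nat 14 x - s.nat 13 x) + (s.nat 24 y - s.nat 23 y) + 1) + 12) + 10)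
    (e30.le.trans (by omega)) ⟨hB, by omega, by omega⟩ ?_).mono ?_
  · rintro x s₁ hf₁ - hx ⟨hB₁, hI, -⟩
    rw [e30] at hx
    have hP₁ : Prepared T T' q q' (s₁.writeNat 30 0 x) :=
      (hP₀.of_frame hf₁ (by decide)).writeNat (by decide)
    refine Wp.seq (Wp.setNat (by simp [(hP₀.of_frame hf₁ (by decide)).size']; omega) ?_)
    simp only [NatExpr.eval, NatExpr.steps, hP₁.size']
    set s₂ := State.writeNat _ 31 0 n' with hs₂
    have hP₂ : Prepared T T' q q' s₂ := hP₁.writeNat (by decide)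
    have e31 : s₂.nat 31 0 = n' := by simp [hs₂]
    have e30' : s₂.nat 30 0 = x := by simp [hs₂]
    have er : s₂.real = s₁.real := by simp [hs₂]
    have e13 : s₂.nat 13 = s.nat 13 := by simp [hs₂, hf₁.nat_eq 13, hs₀]
    have e14 : s₂.nat 14 = s.nat 14 := by simp [hs₂, hf₁.nat_eq 14, hs₀]
    have e23 : s₂.nat 23 = s.nat 23 := by simp [hs₂, hf₁.nat_eq 23, hs₀]
    have e24 : s₂.nat 24 = s.nat 24 := by simp [hs₂, hf₁.nat_eq 24, hs₀]
    refine (Wp.downTo (fun y s' => s'.real 2 0 ≤ 0 ∧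
        (∀ x₁, x < x₁ → x₁ < n → ∀ y₁ < n', EntryCorrect G q q' s' x₁ y₁) ∧
        (∀ y₁, y ≤ y₁ → y₁ < n' → EntryCorrect G q q' s' x y₁) ∧
        (y < n' → s'.real 10 0 = G (q x) (q' y)))
      (fun y => 4000 * (min T.maxDegree T'.maxDegree *
          ((s.nat 14 x - s.nat 13 x) * (s.nat 24 y - s.nat 23 y)) +
          (s.nat 14 x - s.nat 13 x) + (s.nat 24 y - s.nat 23 y) + 1))
      (e31.le.trans (by omega)) ⟨by rwa [er], ?_, by omega, by omega⟩ ?_).mono ?_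
    · intro x₁ h1 h2 y₁ h3
      have := hI x₁ h1 h2 y₁ h3
      rwa [EntryCorrect, ← er] at this
    · rintro y s₃ hf₃ - hy ⟨hB₃, hJ, hJ', -⟩
      rw [e31] at hy
      have := wp_computeEntry hG (s := s₃.writeNat 31 0 y)
        ((hP₂.of_frame hf₃ (by decide)).writeNat (by decide)) hx hy
        (by simp [hf₃.nat_eq 30, e30']) (by simp) hW hnW hnW' hB₃ hJ
      refine this.mono ?_
      rintro s₄ t₄ hf₄ ⟨ht₄, h10, h1, h2, h2'⟩
      simp only [ne_eq, Nat.reduceEqDiff, not_false_eq_true, State.writeNat_nat_of_ne,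
        State.writeNat_real, hf₃.nat_eq 13, hf₃.nat_eq 14, hf₃.nat_eq 23, hf₃.nat_eq 24,
        e13, e14, e23, e24] at ht₄ h1 h2
      refine ⟨ht₄, by simp [hf₄.nat_eq 31], h2.trans hB₃, fun x₁ h3 h4 y₁ h5 => ?_,
        fun y₁ h3 h4 => ?_, fun _ => h10⟩
      · exact (hJ x₁ h3 h4 y₁ h5).update hy h5 (by omega) h1 h2
      · rcases eq_or_ne y₁ y with rfl | h5
        · rw [EntryCorrect, h1, Function.update_self]
          exact ⟨rfl, h2'⟩
        · exact (hJ' y₁ (by omega) h4).update hy h4 (fun _ => h5) h1 h2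
    · rintro s₃ t₃ hf₃ ⟨ht₃, -, hB₃, hJ, hJ', h10⟩
      rw [e31] at ht₃
      refine ⟨by omega, by rw [hf₃.nat_eq 30, e30'], hB₃, fun x₁ h1 h2 y₁ h3 => ?_,
        fun _ => h10 hn'⟩
      rcases eq_or_ne x₁ x with rfl | h4
      · exact hJ' y₁ (Nat.zero_le _) h3
      · exact hJ x₁ (by omega) h2 y₁ h3
  · rintro s₁ t₁ - ⟨ht₁, -, -, -, h10⟩
    rw [e30] at ht₁
    refine ⟨by omega, ?_⟩
    rw [h10 hn, hP.order.zero, hP.order'.zero]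

/-- The double sum of `d x * d' y` factors, and the linear terms contribute a multiple of `n * n'`.
-/
theorem sum_entries_le {n n' m : ℕ} {d d' : ℕ → ℕ} (hd : ∑ x ∈ Finset.range n, d x ≤ n)
    (hd' : ∑ y ∈ Finset.range n', d' y ≤ n') :
    ∑ x ∈ Finset.range n, (∑ y ∈ Finset.range n',
      (4000 * (m * (d x * d' y) + d x + d' y + 1) + 12) + 10 + 12) ≤
      4000 * (n * n' * m) + 13000 * (n * n') + 22 * n := by
  have h1 : ∑ x ∈ Finset.range n, (∑ y ∈ Finset.range n',
      (4000 * (m * (d x * d' y) + d x + d' y + 1) + 12) + 10 + 12) =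
      4000 * (m * ((∑ x ∈ Finset.range n, d x) * ∑ y ∈ Finset.range n', d' y)) +
      4000 * (n' * ∑ x ∈ Finset.range n, d x) + 4000 * (n * ∑ y ∈ Finset.range n', d' y) +
      4012 * (n * n') + 22 * n := by
    simp only [Finset.sum_add_distrib, Finset.sum_const, Finset.card_range, smul_eq_mul,
      ← Finset.mul_sum, ← Finset.sum_mul]
    ring
  rw [h1]
  have h2 := Nat.mul_le_mul_left m (Nat.mul_le_mul hd hd')
  have h3 := Nat.mul_le_mul_left n' hd
  have h4 := Nat.mul_le_mul_left n hd'
  have h5 : m * (n * n') = n * n' * m := mul_comm _ _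
  have h6 : n' * n = n * n' := mul_comm _ _
  omega

theorem wp_sdtedProgram (c : Option L → Option L → ℝ) (T : LabeledRootedTree (Fin n) L)
    (T' : LabeledRootedTree (Fin n') L) (hW : n * n' ≤ W) (hnW : n + 2 ≤ W) (hnW' : n' + 2 ≤ W) :
    Wp (costInput c T T') W sdtedProgram (initialState T T') fun s t =>
      t ≤ 20000 * (n * n' * max T.maxDegree T'.maxDegree + 1) ∧ s.real 0 0 = sdted c T T' := by
  have hn : 0 < n := T.root.pos
  have hn' : 0 < n' := T'.root.pos
  set s := initialState T T' with hs
  refine Wp.seq ((wp_bfs (t := 1) (T := T) (Or.inl rfl) rfl rfl rfl (fun _ => rfl)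
    (by omega)).mono ?_)
  rintro s₁ t₁ hf₁ ⟨ht₁, q, hq, hT⟩
  refine Wp.seq ((wp_bfs (t := 2) (T := T') (Or.inr rfl) ?_ ?_ ?_ ?_ (by omega)).mono ?_)
  · rw [hf₁.nat_eq 0]
    rfl
  · rw [hf₁.nat_eq 0]
    rfl
  · rw [hf₁.nat_eq 2]
    rfl
  · intro w
    rw [hf₁.nat_eq (10 * 2)]
    rfl
  rintro s₂ t₂ hf₂ ⟨ht₂, q', hq', hT'⟩
  have e0 : s₂.nat 0 = s.nat 0 := by rw [hf₂.nat_eq 0, hf₁.nat_eq 0]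
  refine Wp.seq ((wp_multiples (N := n) (d := n') (by simp) (by simp) (by rw [e0]; rfl)
    (fun s' h => by simp only [NatExpr.eval, h, e0]; rfl) (by omega) hW).mono ?_)
  rintro s₃ t₃ hf₃ ⟨ht₃, h₃⟩
  refine Wp.seq ((wp_multiples (N := n') (d := 1) (by simp) (by simp)
    (by rw [hf₃.nat_eq 0, e0]; rfl) (fun s' h => rfl) (by omega) (by omega)).mono ?_)
  rintro s₄ t₄ hf₄ ⟨ht₄, h₄⟩
  have g0 : s₄.nat 0 = s.nat 0 := by rw [hf₄.nat_eq 0, hf₃.nat_eq 0, e0]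
  have g13 : s₄.nat 13 = s₁.nat 13 := by rw [hf₄.nat_eq 13, hf₃.nat_eq 13, hf₂.nat_eq 13]
  have g14 : s₄.nat 14 = s₁.nat 14 := by rw [hf₄.nat_eq 14, hf₃.nat_eq 14, hf₂.nat_eq 14]
  have g23 : s₄.nat 23 = s₂.nat 23 := by rw [hf₄.nat_eq 23, hf₃.nat_eq 23]
  have g24 : s₄.nat 24 = s₂.nat 24 := by rw [hf₄.nat_eq 24, hf₃.nat_eq 24]
  have hP₄ : Prepared T T' q q' s₄ := by
    refine ⟨by rw [g0]; rfl, by rw [g0]; rfl, ?_, ?_, by rwa [g13, g14], by rwa [g23, g24], ?_, ?_⟩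
    · rw [hf₄.nat_eq 12, hf₃.nat_eq 12, hf₂.nat_eq 12]
      exact hq
    · rw [hf₄.nat_eq 22, hf₃.nat_eq 22]
      exact hq'
    · rw [hf₄.nat_eq 19]
      exact h₃
    · simpa using h₄
  refine Wp.seq ((wp_sumCosts (by rw [g0]; rfl) (by rw [g0]; rfl) (by omega) (by omega)).mono ?_)
  rintro s₅ t₅ hf₅ ⟨ht₅, h₅⟩
  obtain ⟨G, hG⟩ := exists_eq_add_minMatching T T' fun u v =>
    c (some (T.label u)) (some (T'.label v)) - c (some (T.label u)) none -
      c none (some (T'.label v))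
  have hB : s₅.real 2 0 ≤ 0 := by
    rw [hf₅.real_eq 2, hf₄.real_eq 2, hf₃.real_eq 2, hf₂.real_eq 2, hf₁.real_eq 2]
    exact le_rfl
  have hP₅ := hP₄.of_frame hf₅ (by decide)
  refine Wp.seq ((wp_fillTable hG hP₅ hW hnW hnW' hB).mono ?_)
  rintro s₆ t₆ hf₆ ⟨ht₆, h₆⟩
  refine Wp.setReal ⟨?_, ?_⟩
  · have h1 := sum_entries_le (m := min T.maxDegree T'.maxDegree) hP₅.order.sum_le
      hP₅.order'.sum_le
    have h2 : n ≤ n * n' := Nat.le_mul_of_pos_right _ hn'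
    have h3 : n' ≤ n * n' := Nat.le_mul_of_pos_left _ hn
    have h4 : n * n' * min T.maxDegree T'.maxDegree ≤ n * n' * max T.maxDegree T'.maxDegree :=
      Nat.mul_le_mul_left _ min_le_max
    -- The maximum degree vanishes only if both trees are single vertices; the summand `1` covers
    -- this case.
    have h5 : n * n' ≤ n * n' * max T.maxDegree T'.maxDegree + 1 := by
      by_cases h : n = 1 ∧ n' = 1
      · simp [h]
      · have : 1 ≤ max T.maxDegree T'.maxDegree := by
          by_cases h' : n = 1
          · exact (T'.one_le_maxDegree (by simp; omega)).trans (le_max_right _ _)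
          · exact (T.one_le_maxDegree (by simp; omega)).trans (le_max_left _ _)
        exact (Nat.le_mul_of_pos_right _ this).trans (Nat.le_succ _)
    simp at ht₃ ht₄ ⊢
    omega
  · simp [hf₆.real_eq 9, h₅, h₆, sdted_eq c hG]

end RAM

/-! ### The main theorem -/

theorem theorem2 :
    ∃ (P : RAM.Program) (K : ℕ),
      ∀ (L : Type*) (c : Option L → Option L → ℝ), (∀ x y, 0 ≤ c x y) →
      ∀ (n n' : ℕ) (T : LabeledRootedTree (Fin n) L) (T' : LabeledRootedTree (Fin n') L),
        ∃ (s : RAM.State) (t : ℕ),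
          RAM.Exec (costInput c T T') ((n + n') ^ K) P (initialState T T') s t ∧
          t ≤ K * (n * n' * max T.maxDegree T'.maxDegree + 1) ∧
          s.real 0 0 = sdted c T T' := by
  -- The constant is kept opaque so that `(n + n') ^ K` is not a power with a huge literal exponent.
  -- For the word length an exponent of `2` would suffice, as both trees are nonempty.
  obtain ⟨K, hK⟩ : ∃ K, K = 20000 := ⟨_, rfl⟩
  refine ⟨RAM.sdtedProgram, K, fun L c _ n n' T T' => ?_⟩
  have hn : 0 < n := T.root.pos
  have hn' : 0 < n' := T'.root.pos
  have h1 : n * n' ≤ (n + n') ^ 2 := by nlinarith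
  have h2 : n + 2 ≤ (n + n') ^ 2 := by nlinarith
  have h3 : n' + 2 ≤ (n + n') ^ 2 := by nlinarith
  have hW : (n + n') ^ 2 ≤ (n + n') ^ K := Nat.pow_le_pow_right (by omega) (by omega)
  obtain ⟨s, t, hE, ht, hs⟩ :=
    RAM.wp_sdtedProgram c T T' (h1.trans hW) (h2.trans hW) (h3.trans hW)
  exact ⟨s, t, hE, hK ▸ ht, hs⟩
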